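/- Let $N\ge 3$ and let $V:(0,\infty)\to[0,\infty)$, $K:(0,\infty)\to(0,\infty)$ be continuous, with $V(r)\le C/r^2$ for all $r\in(0,1)$ and some $C>0$. Let $g:\mathbb R\to\mathbb R$ be continuous, $G(t)=\int_0^t g(s)\,ds$, and let $q_1,q_2\in\mathbb R$ be such that: * there is $\theta>2$ with $0\le 2\theta G(t)\le g(t)t$ for all $t\in\mathbb R$; * there is $t_0>0$ with $G(t_0)>0$; * there is $C>0$ with $|g(t)|\le C\min\{|t|^{q_1-1},|t|^{q_2-1}\}$ for all $t\in\mathbb R$. For $\alpha\in\mathbb R$, $\beta\in[0,1]$ set $$\alpha^*(\beta)=\max\Big\{\beta\tfrac{N+2}{2}-1-\tfrac N2,\ \tfrac{\beta}{2}(3N-2)-N\Big\},\quad q_0^*(\alpha,\beta)=\frac{2\alpha+2N-\beta(N+2)}{N-2},\quad q_\infty^*(\alpha,\beta)=2\,\frac{\alpha+N-2\beta}{N-2}.$$ Assume that there are $R_1,R_2>0$, $\beta_0,\beta_\infty\in[0,1]$, $\alpha_0>\alpha^*(\beta_0)$ and $\alpha_\infty\in\mathbb R$ with $$\sup_{0<r<R_1}\frac{K(r)}{r^{\alpha_0}V(r)^{\beta_0}}<\infty,\qquad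 \sup_{r>R_2}\frac{K(r)}{r^{\alpha_\infty}V(r)^{\beta_\infty}}<\infty$$ (where $V(r)^0=1$ for every $r$, and the quotient is $+\infty$ if its denominator vanishes), and that $$\max\{1,2\beta_0\}<q_1<q_0^*(\alpha_0,\beta_0),\qquad q_2>\max\{1,2\beta_\infty,q_\infty^*(\alpha_\infty,\beta_\infty)\}.$$ Let $f:\mathbb R\to\mathbb R$ be the unique solution of $f'=1/\sqrt{1+2f^2}$, $f(0)=0$. Let $D^{1,2}_r(\mathbb R^N)$ be the closure of the radial functions in $C_c^\infty(\mathbb R^N)$ with respect to $\|u\|_{1,2}=(\int_{\mathbb R^N}|\nabla u|^2dx)^{1/2}$ (a space of functions in $L^{2N/(N-2)}(\mathbb R^N)$ with weak gradient in $L^2$), and $$X=\Big\{u\in D^{1,2}_r:\int_{\mathbb R^N} V(|x|)u^2dx<\infty\Big\},\qquad E=\Big\{u\in D^{1,2}_r:\int_{\mathbb R^N} V(|x|)f(u)^2dx<\infty\Big\},$$ where $E$ carries the norm $\|u\|=\|u\|_{1,2}+\inf_{k>0}\frac1k\big[1+\int_{\mathbb R^N} V(|x|)f(ku)^2dx\big]$.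 Then the functional $$I(u)=\frac12\int_{\mathbb R^N}|\nabla u|^2dx+\frac12\int_{\mathbb R^N}V(|x|)f(u)^2dx-\int_{\mathbb R^N}K(|x|)G(f(u))\,dx$$ is well defined on $E$ (all integrals converge), and it has a critical point $u\in E$, $u\ge0$, $u\ne0$, that is, $I$ is Fréchet differentiable at $u$ on $(E,\|\cdot\|)$ with $I'(u)=0$. Moreover (for a suitable representative of $u$) the function $w=f(u)$ is a nonnegative nontrivial solution of $$-\Delta w+V(|x|)w-w\,\Delta(w^2)=K(|x|)g(w)\quad\text{in }\mathbb R^N$$ in both of the following senses: * weak: $w\in X$ and, for every radial $h\in C_c^\infty(\mathbb R^N)$, the integrals below converge and $$\int_{\mathbb R^N}(1+2w^2)\nabla w\cdot\nabla h\,dx+\int_{\mathbb R^N}2w|\nabla w|^2h\,dx+\int_{\mathbb R^N}V(|x|)wh\,dx=\int_{\mathbb R^N}K(|x|)g(w)h\,dx;$$ * classical away from the origin: $w\in C^2(\mathbb R^N\setminus\{0\})$ and the equation holds pointwise in $\mathbb R^N\setminus\{0\}$. -/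

import Mathlib

open MeasureTheory Filter Topology
open scoped ENNReal ContDiff

namespace QLS

/-! ### The change of variable -/

/-- An explicit primitive inverting the change of variable: `s ↦ ∫₀ˢ √(1 + 2 τ²) dτ`. -/
noncomputable def changeInv (s : ℝ) : ℝ := ∫ τ in (0 : ℝ)..s, √(1 + 2 * τ ^ 2)

theorem changeInv_hasDerivAt (s : ℝ) : HasDerivAt changeInv (√(1 + 2 * s ^ 2)) s := by
  have hc : Continuous (fun τ : ℝ => √(1 + 2 * τ ^ 2)) := by fun_prop
  exact intervalIntegral.integral_hasDerivAt_right (hc.intervalIntegrable _ _)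
    hc.stronglyMeasurable.stronglyMeasurableAtFilter hc.continuousAt

theorem one_le_sqrt_aux (s : ℝ) : 1 ≤ √(1 + 2 * s ^ 2) := by
  rw [Real.one_le_sqrt]
  nlinarith [sq_nonneg s]

theorem changeInv_zero : changeInv 0 = 0 := by simp [changeInv]

theorem changeInv_strictMono : StrictMono changeInv := by
  apply strictMono_of_deriv_pos
  intro s
  rw [(changeInv_hasDerivAt s).deriv]
  linarith [one_le_sqrt_aux s]

theorem changeInv_sub_monotone : Monotone (fun s => changeInv s - s) := by
  have hd : ∀ s, HasDerivAt (fun s => changeInv s - s) (√(1 + 2 * s ^ 2) - 1) s :=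
    fun s => (changeInv_hasDerivAt s).sub (hasDerivAt_id s)
  apply monotone_of_deriv_nonneg
  · exact fun s => (hd s).differentiableAt
  · intro s
    rw [(hd s).deriv]
    linarith [one_le_sqrt_aux s]

theorem changeInv_continuous : Continuous changeInv :=
  continuous_iff_continuousAt.2 fun s => (changeInv_hasDerivAt s).continuousAt

theorem changeInv_surjective : Function.Surjective changeInv := by
  apply changeInv_continuous.surjective
  · refine tendsto_atTop_mono' _ ?_ tendsto_id
    filter_upwards [eventually_ge_atTop (0 : ℝ)] with s hs
    have := changeInv_sub_monotone hs
    simp only [changeInv_zero] at this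
    simp only [id]
    linarith
  · refine tendsto_atBot_mono' _ ?_ tendsto_id
    filter_upwards [eventually_le_atBot (0 : ℝ)] with s hs
    have := changeInv_sub_monotone hs
    simp only [changeInv_zero] at this
    simp only [id]
    linarith

/-- The Cauchy problem `f' = 1 / √(1 + 2 f²)` on `ℝ`, `f 0 = 0`, has exactly one solution. -/
theorem existsUnique_change :
    ∃! f : ℝ → ℝ, (∀ t, HasDerivAt f (1 / √(1 + 2 * f t ^ 2)) t) ∧ f 0 = 0 := by
  let e : ℝ ≃o ℝ := changeInv_strictMono.orderIsoOfSurjective _ changeInv_surjective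
  have he : ∀ t, changeInv (e.symm t) = t := fun t => e.apply_symm_apply t
  refine ⟨e.symm, ⟨fun t => ?_, ?_⟩, ?_⟩
  · have hne : √(1 + 2 * (e.symm t) ^ 2) ≠ 0 := by
      have := one_le_sqrt_aux (e.symm t)
      positivity
    rw [one_div]
    exact HasDerivAt.of_local_left_inverse (e.symm.continuous.continuousAt)
      (changeInv_hasDerivAt _) hne (Eventually.of_forall he)
  · apply changeInv_strictMono.injective
    rw [he, changeInv_zero]
  · rintro f ⟨hf, hf0⟩
    have hd : ∀ t, HasDerivAt (fun t => changeInv (f t) - t) 0 t := by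
      intro t
      have h1 := ((changeInv_hasDerivAt (f t)).comp t (hf t)).sub (hasDerivAt_id t)
      have hne : √(1 + 2 * (f t) ^ 2) ≠ 0 := by
        have := one_le_sqrt_aux (f t)
        positivity
      rw [mul_one_div_cancel hne, sub_self] at h1
      exact h1
    funext t
    apply changeInv_strictMono.injective
    rw [he]
    have := is_const_of_deriv_eq_zero (fun t => (hd t).differentiableAt)
      (fun t => (hd t).deriv) t 0
    simp only [hf0, changeInv_zero, sub_zero] at this
    linarith

/-- The change of variable `f`: the unique solution of `f' = 1 / √(1 + 2 f²)` on `ℝ`,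
`f 0 = 0`. -/
noncomputable def change : ℝ → ℝ := existsUnique_change.choose

theorem change_hasDerivAt (t : ℝ) : HasDerivAt change (1 / √(1 + 2 * change t ^ 2)) t :=
  existsUnique_change.choose_spec.1.1 t

theorem change_zero : change 0 = 0 := existsUnique_change.choose_spec.1.2

/-! ### Function spaces -/

variable {N : ℕ}

/-- Infinitely differentiable real functions with compact support in `ℝ^N`. -/
def IsTestFunction (φ : EuclideanSpace ℝ (Fin N) → ℝ) : Prop :=
  ContDiff ℝ ∞ φ ∧ HasCompactSupport φ

/-- Infinitely differentiable radial real functions with compact support in `ℝ^N`. -/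
def IsRadialTestFunction (φ : EuclideanSpace ℝ (Fin N) → ℝ) : Prop :=
  IsTestFunction φ ∧ ∀ x y, ‖x‖ = ‖y‖ → φ x = φ y

/-- `F` is a weak (distributional) gradient of `u` in `ℝ^N`. -/
def HasWeakGradient (u : EuclideanSpace ℝ (Fin N) → ℝ)
    (F : EuclideanSpace ℝ (Fin N) → EuclideanSpace ℝ (Fin N)) : Prop :=
  LocallyIntegrable u ∧ LocallyIntegrable F ∧
    ∀ ψ : EuclideanSpace ℝ (Fin N) → ℝ, IsTestFunction ψ →
      ∫ x, u x • gradient ψ x = - ∫ x, ψ x • F x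

open Classical in
/-- The weak gradient `∇u` (unique up to null sets when it exists; `0` when it does not). -/
noncomputable def weakGrad (u : EuclideanSpace ℝ (Fin N) → ℝ) :
    EuclideanSpace ℝ (Fin N) → EuclideanSpace ℝ (Fin N) :=
  if h : ∃ F, HasWeakGradient u F then h.choose else 0

/-- The critical Sobolev exponent `2^* = 2N / (N - 2)`. -/
noncomputable def sobolevExp (N : ℕ) : ℝ≥0∞ := ENNReal.ofReal (2 * N / ((N : ℝ) - 2))

/-- The space `D_r^{1,2}(ℝ^N)`, the closure of the radial test functions with respect to
`‖u‖_{1,2} = (∫ |∇u|²)^{1/2}`, realised by the Sobolev inequality as a space of functions in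
`L^{2^*}` with weak gradient in `L²`. -/
def MemD12r (u : EuclideanSpace ℝ (Fin N) → ℝ) : Prop :=
  MemLp u (sobolevExp N) ∧ (∃ F, HasWeakGradient u F) ∧ MemLp (weakGrad u) 2 ∧
    ∃ φ : ℕ → EuclideanSpace ℝ (Fin N) → ℝ, (∀ n, IsRadialTestFunction (φ n)) ∧
      Tendsto (fun n => eLpNorm (fun x => gradient (φ n) x - weakGrad u x) 2) atTop (𝓝 0) ∧
      Tendsto (fun n => eLpNorm (fun x => φ n x - u x) (sobolevExp N)) atTop (𝓝 0)

/-- The space `X` of all `u ∈ D_r^{1,2}` with `∫ V(|x|) u² < ∞`. -/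
def MemX (V : ℝ → ℝ) (u : EuclideanSpace ℝ (Fin N) → ℝ) : Prop :=
  MemD12r u ∧ Integrable (fun x => V ‖x‖ * u x ^ 2)

/-- The Orlicz–Sobolev space `E` of all `u ∈ D_r^{1,2}` with `∫ V(|x|) f(u)² < ∞`. -/
def MemE (V : ℝ → ℝ) (u : EuclideanSpace ℝ (Fin N) → ℝ) : Prop :=
  MemD12r u ∧ Integrable (fun x => V ‖x‖ * change (u x) ^ 2)

/-- The Orlicz norm `‖u‖_o = inf_{k > 0} (1 / k) (1 + ∫ V(|x|) f(k u)²)`. -/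
noncomputable def orliczNorm (V : ℝ → ℝ) (u : EuclideanSpace ℝ (Fin N) → ℝ) : ℝ≥0∞ :=
  ⨅ k : Set.Ioi (0 : ℝ), ENNReal.ofReal (1 / (k : ℝ)) *
    (1 + ∫⁻ x, ENNReal.ofReal (V ‖x‖ * change ((k : ℝ) * u x) ^ 2))

/-- The norm `‖u‖ = ‖u‖_{1,2} + ‖u‖_o` of `E`. -/
noncomputable def normE (V : ℝ → ℝ) (u : EuclideanSpace ℝ (Fin N) → ℝ) : ℝ :=
  √(∫ x, ‖weakGrad u x‖ ^ 2) + (orliczNorm V u).toReal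

/-! ### The functional and its critical points -/

/-- The primitive `G(t) = ∫₀ᵗ g`. -/
noncomputable def primitive (g : ℝ → ℝ) (t : ℝ) : ℝ := ∫ s in (0 : ℝ)..t, g s

/-- The functional
`I(u) = (1/2) ∫ |∇u|² + (1/2) ∫ V(|x|) f(u)² - ∫ K(|x|) G(f(u))`. -/
noncomputable def energy (V K g : ℝ → ℝ) (u : EuclideanSpace ℝ (Fin N) → ℝ) : ℝ :=
  (1 / 2) * (∫ x, ‖weakGrad u x‖ ^ 2) + (1 / 2) * (∫ x, V ‖x‖ * change (u x) ^ 2)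
    - ∫ x, K ‖x‖ * primitive g (change (u x))

/-- `u ∈ E` is a critical point of `I : E → ℝ`: the functional is Fréchet differentiable at `u`
with respect to the norm of `E`, with differential `0`, that is
`I(u + h) - I(u) = o(‖h‖)` as `h → 0` in `E`. -/
def IsCriticalPoint (V K g : ℝ → ℝ) (u : EuclideanSpace ℝ (Fin N) → ℝ) : Prop :=
  MemE V u ∧ ∀ ε > 0, ∃ δ > 0, ∀ h : EuclideanSpace ℝ (Fin N) → ℝ, MemE V h →
    normE V h < δ → |energy V K g (u + h) - energy V K g u| ≤ ε * normE V h

/-! ### The equation `-Δw + V(|x|) w - w Δ(w²) = K(|x|) g(w)` -/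

/-- Weak solutions: `w ∈ X` and, for every radial test function `h`, all integrals in
`∫ (1 + 2w²) ∇w·∇h + ∫ 2w |∇w|² h + ∫ V(|x|) w h = ∫ K(|x|) g(w) h`
converge and the identity holds. -/
def IsWeakSolution (V K g : ℝ → ℝ) (w : EuclideanSpace ℝ (Fin N) → ℝ) : Prop :=
  MemX V w ∧ ∀ h : EuclideanSpace ℝ (Fin N) → ℝ, IsRadialTestFunction h →
    Integrable (fun x => (1 + 2 * w x ^ 2) * inner ℝ (weakGrad w x) (gradient h x)) ∧
    Integrable (fun x => 2 * w x * ‖weakGrad w x‖ ^ 2 * h x) ∧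
    Integrable (fun x => V ‖x‖ * w x * h x) ∧
    Integrable (fun x => K ‖x‖ * g (w x) * h x) ∧
    (∫ x, (1 + 2 * w x ^ 2) * inner ℝ (weakGrad w x) (gradient h x))
      + (∫ x, 2 * w x * ‖weakGrad w x‖ ^ 2 * h x) + (∫ x, V ‖x‖ * w x * h x)
      = ∫ x, K ‖x‖ * g (w x) * h x

/-- Classical solutions in `ℝ^N ∖ {0}`. -/
def IsClassicalSolution (V K g : ℝ → ℝ) (w : EuclideanSpace ℝ (Fin N) → ℝ) : Prop :=
  ContDiffOn ℝ 2 w {0}ᶜ ∧ ∀ x : EuclideanSpace ℝ (Fin N), x ≠ 0 →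
    - Laplacian.laplacian w x + V ‖x‖ * w x - w x * Laplacian.laplacian (fun y => w y ^ 2) x
      = K ‖x‖ * g (w x)

/-! ### Hypotheses -/

/-- Hypothesis `(H)` on the potentials, which matter only on `(0, ∞)`. -/
def HypH (V K : ℝ → ℝ) : Prop :=
  ContinuousOn V (Set.Ioi 0) ∧ ContinuousOn K (Set.Ioi 0) ∧
    (∀ r > 0, 0 ≤ V r) ∧ (∀ r > 0, 0 < K r) ∧
    ∃ C > 0, ∀ r ∈ Set.Ioo (0 : ℝ) 1, V r ≤ C / r ^ 2

/-- Hypothesis `(g₁)`. -/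
def HypG1 (g : ℝ → ℝ) : Prop :=
  ∃ θ > 2, ∀ t, 0 ≤ 2 * θ * primitive g t ∧ 2 * θ * primitive g t ≤ g t * t

/-- Hypothesis `(g₂)`. -/
def HypG2 (g : ℝ → ℝ) : Prop := ∃ t₀ > 0, 0 < primitive g t₀

/-- The double-power growth condition. -/
def HypGrowth (g : ℝ → ℝ) (q₁ q₂ : ℝ) : Prop :=
  ∃ C > 0, ∀ t, |g t| ≤ C * min (|t| ^ (q₁ - 1)) (|t| ^ (q₂ - 1))

noncomputable def alphaStar (N : ℕ) (β : ℝ) : ℝ :=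
  max (β * ((N + 2) / 2) - 1 - N / 2) (β / 2 * (3 * N - 2) - N)

noncomputable def qZeroStar (N : ℕ) (α β : ℝ) : ℝ :=
  (2 * α + 2 * N - β * (N + 2)) / (N - 2)

noncomputable def qInftyStar (N : ℕ) (α β : ℝ) : ℝ :=
  2 * ((α + N - 2 * β) / (N - 2))

/-- `sup_{r ∈ S} K(r) / (r^α V(r)^β) < ∞`, with `V(r)^0 = 1` for every `r`. It is written without
division, so that the ratio counts as `+∞` where `V(r) = 0` and `β > 0`. -/
def RatioBounded (V K : ℝ → ℝ) (S : Set ℝ) (α β : ℝ) : Prop :=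
  ∃ Λ : ℝ, ∀ r ∈ S, K r ≤ Λ * (r ^ α * V r ^ β)

end QLS

namespace QLS

/-! ### Elementary properties of the change of variable -/

/-! The substitution w = f(u) turns the quasilinear equation into the semilinear one -Δu + V φ(u) =
K γ(u), where φ = f f' and γ(t) = g(f(t)) f'(t). The functional I is its energy. Everything is done
for radial profiles. A function of D^{1,2}_r is, up to null sets, u(r) = -∫_r^∞ v with v square
integrable for the radial measure (`memD12r_radialFun`, `MemD12r.exists_eq_radialFun`).
Cauchy-Schwarz gives the decay |u(r)| ≤ c ‖v‖ r^{-(N-2)/2} (`abs_tailIntegral_le`), and Hardy's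
inequality is `lintegral_hardy`.

The Orlicz space E is a Hilbert space in disguise. On the unit ball V ≤ C/r², so Hardy bounds ∫ V u²
by the Dirichlet integral. Outside the ball u is bounded, and on bounded sets f(t)² is comparable
with t². So, up to null sets, E consists of the functions in `RadialSpace` (`RadialSpace.memE`,
`MemE.exists_radialSpace`), and the Hilbert norm is at most a constant times the norm of E
(`RadialSpace.exists_norm_le_normE`). A remainder that is o of the Hilbert norm is therefore o of
the norm of E, and critical points may be sought in the Hilbert space.

There the gradient of the energy is T - B. The map T (`quasiGrad`) is 1-Lipschitz, and strongly
monotone on bounded sets because φ' is bounded below on them (`quasiGrad_strong_mono`). The map B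
(`IsNonlinearity.grad`) is continuous and compact: the conditions on q₁ and q₂ allow K |γ(u)| |h| to
be dominated on bounded sets by an integrable function plus an arbitrarily small multiple of V (|u|
+ |h|)² (`isNonlinearity_of_growth`). Bounded sequences converge pointwise along a subsequence, and
then their images under B converge (`IsNonlinearity.tendsto_grad_sub`).

Ekeland's principle on the space of paths produces almost critical points at the mountain pass level
(`exists_palais_smale`). The Ambrosetti-Rabinowitz condition bounds them. Compactness of B makes
T(u_n) converge along a subsequence, and strong monotonicity then makes u_n converge
(`exists_critical_point_of_mountain_pass`).

The argument is run with g(max(t, 0)) in place of g. Its critical points are nonnegative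
(`IsNonlinearity.eval_nonneg`), hence critical for g itself. Testing with r ↦ -(a - r)⁺ shows that
the profile is twice differentiable on (0, ∞) and satisfies the radial ordinary differential
equation (`IsNonlinearity.exists_hasDerivAt`). The equation for w follows weakly by testing with h
√(1 + 2w²) (`IsNonlinearity.radial_weak`), and pointwise by algebra (`quasilinear_identity`). -/

theorem sqrt_change_pos (t : ℝ) : 0 < √(1 + 2 * change t ^ 2) :=
  lt_of_lt_of_le one_pos (one_le_sqrt_aux _)

theorem sqrt_change_sq (t : ℝ) : √(1 + 2 * change t ^ 2) ^ 2 = 1 + 2 * change t ^ 2 :=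
  Real.sq_sqrt (by positivity)

theorem continuous_change : Continuous change :=
  continuous_iff_continuousAt.2 fun t => (change_hasDerivAt t).continuousAt

theorem deriv_change : deriv change = fun t => 1 / √(1 + 2 * change t ^ 2) :=
  funext fun t => (change_hasDerivAt t).deriv

/-- The right side of the differential equation is a smooth function of f, so each pass through the
equation gains one derivative. Two are enough for the classical solution. -/
theorem contDiff_change : ContDiff ℝ 2 change := by
  have step : ∀ n : ℕ, ContDiff ℝ n change → ContDiff ℝ (n + 1 : ℕ) change := by
    intro n h
    have : ContDiff ℝ ((n : WithTop ℕ∞) + 1) change := by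
      rw [contDiff_succ_iff_deriv]
      refine ⟨fun t => (change_hasDerivAt t).differentiableAt, by simp, ?_⟩
      rw [deriv_change]
      refine contDiff_const.div ?_ fun t => (sqrt_change_pos t).ne'
      refine ContDiff.sqrt (contDiff_const.add (contDiff_const.mul (h.pow 2))) fun t => ?_
      positivity
    exact_mod_cast this
  have h0 : ContDiff ℝ (0 : ℕ) change := contDiff_zero.2 continuous_change
  exact_mod_cast step 1 (step 0 h0)

theorem strictMono_change : StrictMono change := by
  apply strictMono_of_deriv_pos
  intro t
  rw [deriv_change]
  have := sqrt_change_pos t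
  positivity

theorem change_nonneg {t : ℝ} (ht : 0 ≤ t) : 0 ≤ change t := by
  rw [← change_zero]; exact strictMono_change.monotone ht

/-- The function t ↦ -f(-t) solves the same Cauchy problem, so uniqueness applies. -/
theorem change_neg (t : ℝ) : change (-t) = -change t := by
  have h : (fun t => -change (-t)) = change := by
    apply existsUnique_change.unique
    · refine ⟨fun t => ?_, by simp [change_zero]⟩
      have h1 := ((change_hasDerivAt (-t)).comp t (hasDerivAt_neg t)).neg
      refine h1.congr_deriv ?_
      simp
    · exact existsUnique_change.choose_spec.1
  have := congrFun h t
  linarith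

theorem change_abs (t : ℝ) : change |t| = |change t| := by
  rcases le_total 0 t with h | h
  · rw [abs_of_nonneg h, abs_of_nonneg (change_nonneg h)]
  · have := change_nonneg (neg_nonneg.2 h)
    rw [abs_of_nonpos h, change_neg, abs_of_nonpos]
    rw [change_neg] at this; linarith

theorem change_sq_abs (t : ℝ) : change |t| ^ 2 = change t ^ 2 := by
  rw [change_abs, sq_abs]

theorem change_le_self {t : ℝ} (ht : 0 ≤ t) : change t ≤ t := by
  have hm : Monotone fun s => s - change s := by
    apply monotone_of_deriv_nonneg
    · exact fun s => ((hasDerivAt_id' s).fun_sub (change_hasDerivAt s)).differentiableAt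
    · intro s
      rw [((hasDerivAt_id' s).fun_sub (change_hasDerivAt s)).deriv]
      have : 1 / √(1 + 2 * change s ^ 2) ≤ 1 := by
        rw [div_le_one (sqrt_change_pos s)]; exact one_le_sqrt_aux _
      linarith
  have := hm ht
  simp only [change_zero, sub_zero] at this
  linarith

theorem abs_change_le (t : ℝ) : |change t| ≤ |t| := by
  rw [← change_abs]; exact change_le_self (abs_nonneg t)

theorem change_sq_le_sq (t : ℝ) : change t ^ 2 ≤ t ^ 2 := sq_le_sq.2 (abs_change_le t)

theorem sqrtChange_hasDerivAt (t : ℝ) :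
    HasDerivAt (fun t => √(1 + 2 * change t ^ 2))
      (2 * change t / (1 + 2 * change t ^ 2)) t := by
  have h2 : HasDerivAt (fun t => √(1 + 2 * change t ^ 2)) _ t :=
    ((((change_hasDerivAt t).fun_pow 2).const_mul 2).const_add 1).sqrt
      (by nlinarith [sq_nonneg (change t)])
  refine h2.congr_deriv ?_
  have hs := sqrt_change_pos t
  have hs2 := sqrt_change_sq t
  set s := √(1 + 2 * change t ^ 2)
  rw [← hs2]
  field_simp
  norm_num

/-- This derivative lies between 1 and 2. Integration from 0 therefore traps f √(1 + 2f²) between t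
and 2t for t ≥ 0, and the later comparisons of f(t), f(t)² and t rest on these two bounds. -/
theorem changeMulSqrt_hasDerivAt (t : ℝ) :
    HasDerivAt (fun t => change t * √(1 + 2 * change t ^ 2))
      ((1 + 4 * change t ^ 2) / (1 + 2 * change t ^ 2)) t := by
  have h1 := change_hasDerivAt t
  have h2 := sqrtChange_hasDerivAt t
  refine (h1.mul h2).congr_deriv ?_
  have hs := sqrt_change_pos t
  have hs2 := sqrt_change_sq t
  set s := √(1 + 2 * change t ^ 2)
  rw [← hs2]
  field_simp
  linarith [hs2]

theorem self_le_change_mul_sqrt {t : ℝ} (ht : 0 ≤ t) :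
    t ≤ change t * √(1 + 2 * change t ^ 2) := by
  have hd := fun s => (changeMulSqrt_hasDerivAt s).fun_sub (hasDerivAt_id' s)
  have hm : Monotone fun s => change s * √(1 + 2 * change s ^ 2) - s := by
    apply monotone_of_deriv_nonneg
    · exact fun s => (hd s).differentiableAt
    · intro s
      rw [(hd s).deriv, sub_nonneg, one_le_div (by positivity)]
      nlinarith [sq_nonneg (change s)]
  have := hm ht
  simp only [change_zero, sub_zero, zero_mul] at this
  linarith

theorem change_mul_sqrt_le {t : ℝ} (ht : 0 ≤ t) :
    change t * √(1 + 2 * change t ^ 2) ≤ 2 * t := by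
  have hd := fun s => ((hasDerivAt_id' s).const_mul 2).fun_sub (changeMulSqrt_hasDerivAt s)
  have hm : Monotone fun s => 2 * s - change s * √(1 + 2 * change s ^ 2) := by
    apply monotone_of_deriv_nonneg
    · exact fun s => (hd s).differentiableAt
    · intro s
      rw [(hd s).deriv, sub_nonneg, mul_one, div_le_iff₀ (by positivity)]
      nlinarith [sq_nonneg (change s)]
  have := hm ht
  simp only [change_zero, sub_zero, zero_mul, mul_zero] at this
  linarith

theorem abs_change_le_sqrt (t : ℝ) : |change t| ≤ √(1 + 2 * change t ^ 2) := by
  apply Real.le_sqrt_of_sq_le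
  rw [sq_abs]; nlinarith [sq_nonneg (change t)]

/-- The change of variable grows only like a square root. This beats |f(t)| ≤ |t| near the origin of
space, where u may be unbounded. -/
theorem change_sq_le_two_mul_abs (t : ℝ) : change t ^ 2 ≤ 2 * |t| := by
  have h1 := change_mul_sqrt_le (abs_nonneg t)
  have h2 := abs_change_le_sqrt |t|
  have h3 := change_nonneg (abs_nonneg t)
  rw [abs_of_nonneg h3] at h2
  rw [← change_sq_abs]
  nlinarith

theorem sq_le_change_sq_mul (t : ℝ) : t ^ 2 ≤ change t ^ 2 * (1 + 2 * change t ^ 2) := by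
  have h1 := self_le_change_mul_sqrt (abs_nonneg t)
  have h3 := change_nonneg (abs_nonneg t)
  rw [← change_sq_abs, ← sq_abs t, ← sqrt_change_sq |t|, ← mul_pow]
  exact pow_le_pow_left₀ (abs_nonneg t) h1 2

/-- On bounded sets f² controls the square. Radial functions are bounded for r ≥ 1, and there this
converts the Orlicz integral into the quadratic one. -/
theorem sq_le_of_abs_le {t M : ℝ} (h : |t| ≤ M) : t ^ 2 ≤ (1 + 2 * M ^ 2) * change t ^ 2 := by
  have h1 := sq_le_change_sq_mul t
  have h2 := change_sq_le_sq t
  have h3 : t ^ 2 ≤ M ^ 2 := by rw [← sq_abs]; exact pow_le_pow_left₀ (abs_nonneg t) h 2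
  nlinarith [sq_nonneg (change t)]

/-- Half the derivative of `f²`, that is `f f'`. -/
noncomputable def phi (t : ℝ) : ℝ := change t / √(1 + 2 * change t ^ 2)

/-- The derivative is (f')⁴. It is positive, so φ is strictly increasing and f² is convex; it is at
most 1, so φ is 1-Lipschitz; and it is bounded below on bounded sets. -/
theorem phi_hasDerivAt (t : ℝ) : HasDerivAt phi (1 / (1 + 2 * change t ^ 2) ^ 2) t := by
  have h1 := change_hasDerivAt t
  have h2 := sqrtChange_hasDerivAt t
  refine (h1.div h2 (sqrt_change_pos t).ne').congr_deriv ?_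
  have hs := sqrt_change_pos t
  have hs2 := sqrt_change_sq t
  set s := √(1 + 2 * change t ^ 2)
  rw [← hs2]
  field_simp
  linarith [hs2]

theorem continuous_phi : Continuous phi :=
  continuous_iff_continuousAt.2 fun t => (phi_hasDerivAt t).continuousAt

theorem changeSq_hasDerivAt (t : ℝ) : HasDerivAt (fun t => change t ^ 2) (2 * phi t) t := by
  refine ((change_hasDerivAt t).pow 2).congr_deriv ?_
  simp only [phi]
  push_cast
  ring

theorem deriv_phi_le_one (t : ℝ) : 1 / (1 + 2 * change t ^ 2) ^ 2 ≤ 1 := by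
  rw [div_le_one (by positivity)]
  nlinarith [sq_nonneg (change t), sq_nonneg (change t ^ 2)]

theorem phi_strictMono : StrictMono phi := by
  apply strictMono_of_deriv_pos
  intro t
  rw [(phi_hasDerivAt t).deriv]
  positivity

theorem phi_zero : phi 0 = 0 := by simp [phi, change_zero]

theorem abs_phi_sub_le (a b : ℝ) : |phi a - phi b| ≤ |a - b| := by
  have := Convex.norm_image_sub_le_of_norm_hasDerivWithin_le (f := phi) (s := Set.univ)
    (C := 1) (x := b) (y := a) (fun t _ => (phi_hasDerivAt t).hasDerivWithinAt)
    (fun t _ => by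
      rw [Real.norm_of_nonneg (by positivity)]; exact deriv_phi_le_one t)
    convex_univ trivial trivial
  simpa using this

theorem phi_neg (t : ℝ) : phi (-t) = -phi t := by
  simp [phi, change_neg, neg_div]

theorem phi_mul_le_change_sq (t : ℝ) : phi t * t ≤ change t ^ 2 := by
  have key : ∀ t, 0 ≤ t → phi t * t ≤ change t ^ 2 := by
    intro t ht
    have h1 := self_le_change_mul_sqrt ht
    have h2 := change_nonneg ht
    rw [phi, div_mul_eq_mul_div, div_le_iff₀ (sqrt_change_pos t)]
    nlinarith
  rcases le_total 0 t with h | h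
  · exact key t h
  · have := key (-t) (neg_nonneg.2 h)
    rw [phi_neg, change_neg] at this
    nlinarith

/-- In other words f ≤ 2 t f' for t > 0. The factor 2 lost here is what the 2θ in the condition on g
pays for. -/
theorem change_sq_le_two_phi_mul (t : ℝ) : change t ^ 2 ≤ 2 * (phi t * t) := by
  have key : ∀ t, 0 ≤ t → change t ^ 2 ≤ 2 * (phi t * t) := by
    intro t ht
    have h1 := change_mul_sqrt_le ht
    have h2 := change_nonneg ht
    rw [phi, div_mul_eq_mul_div, mul_div_assoc', le_div_iff₀ (sqrt_change_pos t)]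
    nlinarith
  rcases le_total 0 t with h | h
  · exact key t h
  · have := key (-t) (neg_nonneg.2 h)
    rw [phi_neg, change_neg] at this
    nlinarith

/-- Convexity of f², which vanishes at 0. It compares different scalings k in the Orlicz norm. -/
theorem change_mul_sq_le {l : ℝ} (h0 : 0 ≤ l) (h1 : l ≤ 1) (t : ℝ) :
    change (l * t) ^ 2 ≤ l * change t ^ 2 := by
  have hc : ConvexOn ℝ Set.univ fun t => change t ^ 2 := by
    apply MonotoneOn.convexOn_of_deriv convex_univ
    · exact (continuous_change.pow 2).continuousOn
    · exact fun t _ => (changeSq_hasDerivAt t).differentiableAt.differentiableWithinAt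
    · intro a _ b _ hab
      rw [(changeSq_hasDerivAt a).deriv, (changeSq_hasDerivAt b).deriv]
      linarith [phi_strictMono.monotone hab]
  have := hc.2 (Set.mem_univ t) (Set.mem_univ 0) h0 (sub_nonneg.2 h1) (by ring)
  simpa [change_zero] using this

theorem phi_sub_mul_sub_nonneg (a b : ℝ) : 0 ≤ (phi a - phi b) * (a - b) := by
  rcases le_total a b with h | h
  · exact mul_nonneg_of_nonpos_of_nonpos (sub_nonpos.2 (phi_strictMono.monotone h))
      (sub_nonpos.2 h)
  · exact mul_nonneg (sub_nonneg.2 (phi_strictMono.monotone h)) (sub_nonneg.2 h)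

/-- By the mean value theorem the slope of φ between a and b is φ'(c) with |c| ≤ M, and φ'(c) ≥ (1 +
2M²)⁻². This is the source of strong monotonicity. -/
theorem sq_sub_le_of_abs_le {a b M : ℝ} (ha : |a| ≤ M) (hb : |b| ≤ M) :
    (a - b) ^ 2 ≤ (1 + 2 * M ^ 2) ^ 2 * ((phi a - phi b) * (a - b)) := by
  have key : ∀ a b : ℝ, |a| ≤ M → |b| ≤ M → b < a →
      (a - b) ^ 2 ≤ (1 + 2 * M ^ 2) ^ 2 * ((phi a - phi b) * (a - b)) := by
    intro a b ha hb hab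
    obtain ⟨c, hc, hce⟩ := exists_hasDerivAt_eq_slope phi _ hab continuous_phi.continuousOn
      fun t _ => phi_hasDerivAt t
    have hcM : |c| ≤ M := abs_le.2 ⟨by linarith [(abs_le.1 hb).1, hc.1],
      by linarith [(abs_le.1 ha).2, hc.2]⟩
    have h2 : change c ^ 2 ≤ M ^ 2 := by
      rw [← sq_abs]; exact pow_le_pow_left₀ (abs_nonneg _) ((abs_change_le c).trans hcM) 2
    rw [eq_div_iff (sub_pos.2 hab).ne'] at hce
    rw [← hce]
    have h3 : (1 + 2 * change c ^ 2) ^ 2 ≤ (1 + 2 * M ^ 2) ^ 2 := by gcongr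
    have h4 : 1 ≤ (1 + 2 * M ^ 2) ^ 2 * (1 / (1 + 2 * change c ^ 2) ^ 2) := by
      rw [mul_one_div, one_le_div (by positivity)]; exact h3
    nlinarith [sq_nonneg (a - b)]
  rcases lt_trichotomy a b with h | h | h
  · have := key b a hb ha h; nlinarith
  · simp [h]
  · exact key a b ha hb h

/-- Mean value inequality for t ↦ f(a + t)² - 2φ(a)t, whose derivative is at most 2|b| between 0 and
b because φ is 1-Lipschitz. -/
theorem abs_changeSq_sub_le (a b : ℝ) :
    |change (a + b) ^ 2 - change a ^ 2 - 2 * (phi a * b)| ≤ 2 * b ^ 2 := by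
  have := Convex.norm_image_sub_le_of_norm_hasDerivWithin_le
    (f := fun t => change (a + t) ^ 2 - 2 * (phi a * t)) (s := Set.uIcc 0 b)
    (f' := fun t => 2 * phi (a + t) - 2 * phi a) (C := 2 * |b|) (x := 0) (y := b)
    (fun t _ => by
      have h1 := (changeSq_hasDerivAt (a + t)).comp_const_add a t
      have h2 := ((hasDerivAt_id t).const_mul (phi a)).const_mul 2
      refine ((h1.sub h2).congr_deriv ?_).hasDerivWithinAt
      ring)
    (fun t ht => by
      have h1 := abs_phi_sub_le (a + t) a
      have h2 : |t| ≤ |b| := by simpa using Set.abs_sub_left_of_mem_uIcc ht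
      rw [Real.norm_eq_abs, ← mul_sub, abs_mul, abs_two]
      simp only [add_sub_cancel_left] at h1
      linarith)
    (convex_uIcc 0 b) Set.left_mem_uIcc Set.right_mem_uIcc
  simp only [Real.norm_eq_abs, add_zero, mul_zero, sub_zero] at this
  rw [mul_assoc, abs_mul_abs_self] at this
  rw [show change (a + b) ^ 2 - change a ^ 2 - 2 * (phi a * b)
    = change (a + b) ^ 2 - 2 * (phi a * b) - change a ^ 2 by ring]
  linarith [sq b]

end QLS

namespace QLS

/-! ### Ekeland's variational principle and the mountain pass theorem -/

/-- Repeated near-minimisation over the points reachable by a descent of slope at least ε gives a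
Cauchy sequence. Its limit admits no further such descent. -/
theorem exists_ekeland_point {X : Type*} [MetricSpace X] [CompleteSpace X] {ψ : X → ℝ}
    (hψ : Continuous ψ) {m : ℝ} (hm : ∀ x, m ≤ ψ x) {ε : ℝ} (hε : 0 < ε) (x₀ : X) :
    ∃ p, ψ p ≤ ψ x₀ ∧ ∀ q, ψ p - ε * dist p q ≤ ψ q := by
  -- The relation `y ∈ S x` is reflexive and transitive, and each `S x` is closed.
  let S : X → Set X := fun x => {y | ψ y + ε * dist x y ≤ ψ x}
  have hself : ∀ x, x ∈ S x := fun x => by simp [S]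
  have hnext : ∀ (n : ℕ) (x : X), ∃ y ∈ S x, ∀ z ∈ S x, ψ y ≤ ψ z + (1 / 2) ^ n := by
    intro n x
    have hne : (ψ '' S x).Nonempty := ⟨_, x, hself x, rfl⟩
    have hbd : BddBelow (ψ '' S x) := ⟨m, by rintro _ ⟨y, -, rfl⟩; exact hm y⟩
    obtain ⟨_, ⟨y, hy, rfl⟩, hlt⟩ := exists_lt_of_csInf_lt hne
      (lt_add_of_pos_right (sInf (ψ '' S x)) (show (0 : ℝ) < (1 / 2) ^ n by positivity))
    exact ⟨y, hy, fun z hz => hlt.le.trans (by gcongr; exact csInf_le hbd ⟨z, hz, rfl⟩)⟩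
  choose nx hnx1 hnx2 using hnext
  let x : ℕ → X := fun n => Nat.rec x₀ (fun k y => nx k y) n
  have hxs : ∀ n, x (n + 1) = nx n (x n) := fun n => rfl
  have htrans : ∀ a b c, b ∈ S a → c ∈ S b → c ∈ S a := by
    intro a b c hb hc
    simp only [S, Set.mem_ofPred_eq] at hb hc ⊢
    nlinarith [dist_triangle a b c]
  have hmem : ∀ n k, x (n + k) ∈ S (x n) := by
    intro n k
    induction k with
    | zero => exact hself _
    | succ k ih => exact htrans _ _ _ ih (by rw [← add_assoc, hxs]; exact hnx1 _ _)
  have hanti : Antitone fun n => ψ (x n) := by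
    apply antitone_nat_of_succ_le
    intro n
    have := hmem n 1
    simp only [S, Set.mem_ofPred_eq] at this
    nlinarith [dist_nonneg (x := x n) (y := x (n + 1))]
  have hconv : Tendsto (fun n => ψ (x n)) atTop (𝓝 (⨅ n, ψ (x n))) :=
    tendsto_atTop_ciInf hanti ⟨m, by rintro _ ⟨n, rfl⟩; exact hm _⟩
  have hcau : CauchySeq x := by
    rw [Metric.cauchySeq_iff']
    intro η hη
    obtain ⟨n, hn⟩ := Metric.cauchySeq_iff'.1 hconv.cauchySeq (ε * η) (by positivity)
    refine ⟨n, fun k hk => ?_⟩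
    have h1 := hn k hk
    obtain ⟨j, rfl⟩ := Nat.exists_eq_add_of_le hk
    have h2 := hmem n j
    simp only [S, Set.mem_ofPred_eq] at h2
    rw [Real.dist_eq, abs_lt] at h1
    rw [dist_comm]
    by_contra hcon
    nlinarith [mul_le_mul_of_nonneg_left (not_lt.1 hcon) hε.le]
  obtain ⟨p, hp⟩ := cauchySeq_tendsto_of_complete hcau
  have hpS : ∀ n, p ∈ S (x n) := by
    intro n
    have hcl : IsClosed (S (x n)) := isClosed_le (by fun_prop) continuous_const
    refine hcl.mem_of_tendsto hp ?_
    filter_upwards [eventually_ge_atTop n] with k hk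
    obtain ⟨j, rfl⟩ := Nat.exists_eq_add_of_le hk
    exact hmem n j
  have hpx : ∀ n, ψ p ≤ ψ (x n) := by
    intro n
    have := hpS n
    simp only [S, Set.mem_ofPred_eq] at this
    nlinarith [dist_nonneg (x := x n) (y := p)]
  refine ⟨p, hpx 0, fun q => ?_⟩
  -- A violating `q` would lie in every `S (x n)`. The near-minimality of `x (n + 1)` there then
  -- forces ψ p ≤ ψ q in the limit.
  by_contra hcon
  push Not at hcon
  have hq : ∀ n, q ∈ S (x n) := fun n => htrans _ p _ (hpS n) (by
    simp only [S, Set.mem_ofPred_eq]; linarith)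
  have hle : ∀ n, ψ p ≤ ψ q + (1 / 2) ^ n := fun n =>
    (hpx (n + 1)).trans (by rw [hxs]; exact hnx2 n _ q (hq n))
  have hlim : Tendsto (fun n : ℕ => ψ q + (1 / 2 : ℝ) ^ n) atTop (𝓝 (ψ q + 0)) :=
    tendsto_const_nhds.add (tendsto_pow_atTop_nhds_zero_of_lt_one (by norm_num) (by norm_num))
  have := ge_of_tendsto' hlim hle
  nlinarith [dist_nonneg (x := p) (y := q)]

variable {H : Type*} [NormedAddCommGroup H] [InnerProductSpace ℝ H]

/-- A bound on the decrease along a segment gives, by the mean value theorem, a bound on the slope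
at an interior point. The offset σ tends to 0 with s in the application. -/
theorem exists_inner_gradient_of_le {F : H → ℝ} {G : H → H}
    (hF : ∀ u, HasFDerivAt F (innerSL ℝ (G u)) u) (u d : H) {s ε : ℝ} (hs : 0 < s)
    (h : F u - ε * s ≤ F (u + s • d)) :
    ∃ σ ∈ Set.Ioo 0 s, -ε ≤ inner ℝ (G (u + σ • d)) d := by
  have hd : ∀ t : ℝ, HasDerivAt (fun t : ℝ => F (u + t • d)) (inner ℝ (G (u + t • d)) d) t := by
    intro t
    have h1 : HasDerivAt (fun t : ℝ => u + t • d) d t := by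
      simpa using ((hasDerivAt_id t).smul_const d).const_add u
    exact (hF (u + t • d)).comp_hasDerivAt t h1
  obtain ⟨σ, hσ, he⟩ := exists_hasDerivAt_eq_slope (fun t : ℝ => F (u + t • d)) _ hs
    (fun t _ => (hd t).continuousAt.continuousWithinAt) fun t _ => hd t
  refine ⟨σ, hσ, ?_⟩
  rw [he, le_div_iff₀ (by linarith)]
  simp only [zero_smul, add_zero, sub_zero]
  linarith

variable [CompleteSpace H]

/-- The mountain pass theorem without a compactness condition: there are almost critical points
at (almost) the minimax level. -/
theorem exists_palais_smale {F : H → ℝ} {G : H → H} (hG : Continuous G)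
    (hF : ∀ u, HasFDerivAt F (innerSL ℝ (G u)) u) {e : H} {ρ a : ℝ} (hρ : 0 < ρ) (ha : 0 < a)
    (h0 : F 0 ≤ 0) (he : F e ≤ 0) (hρe : ρ ≤ ‖e‖) (hs : ∀ u, ‖u‖ = ρ → a ≤ F u) :
    ∃ c, a ≤ c ∧ ∀ ε > 0, ∃ u, |F u - c| ≤ ε ∧ ‖G u‖ ≤ ε := by
  have hFc : Continuous F := continuous_iff_continuousAt.2 fun u => (hF u).continuousAt
  -- Paths with fixed ends form a complete metric space, on which Ekeland's principle is applied to
  -- the maximum of F along the path.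
  let P := {p : C(unitInterval, H) // p 0 = 0 ∧ p 1 = e}
  have hPc : IsClosed {p : C(unitInterval, H) | p 0 = 0 ∧ p 1 = e} :=
    (isClosed_eq (by fun_prop) continuous_const).inter
      (isClosed_eq (by fun_prop) continuous_const)
  have : CompleteSpace P := hPc.completeSpace_coe
  let ψ : P → ℝ := fun p => sSup ((fun t => F (p.1 t)) '' Set.univ)
  have hψ : Continuous ψ := by
    apply IsCompact.continuous_sSup isCompact_univ
    exact hFc.comp ((continuous_subtype_val.comp continuous_fst).eval continuous_snd)
  have hFp : ∀ p : P, Continuous fun t => F (p.1 t) := fun p => hFc.comp p.1.continuous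
  have hle : ∀ (p : P) t, F (p.1 t) ≤ ψ p := fun p t =>
    le_csSup (isCompact_univ.image (hFp p)).bddAbove ⟨t, trivial, rfl⟩
  have hmax : ∀ p : P, ∃ t, F (p.1 t) = ψ p := fun p => by
    obtain ⟨t, -, ht⟩ := (isCompact_univ.image (hFp p)).sSup_mem ⟨_, 0, trivial, rfl⟩
    exact ⟨t, ht⟩
  have hψa : ∀ p : P, a ≤ ψ p := by
    intro p
    have hc : Continuous fun t => ‖p.1 t‖ := p.1.continuous.norm
    have := intermediate_value_univ (0 : unitInterval) 1 hc
    rw [p.2.1, p.2.2, norm_zero] at this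
    obtain ⟨t, ht⟩ := this ⟨hρ.le, hρe⟩
    exact (hs _ ht).trans (hle p t)
  let p₀ : P := ⟨⟨fun t => (t : ℝ) • e, by fun_prop⟩, by simp, by simp⟩
  have hbdd : BddBelow (Set.range ψ) := ⟨a, by rintro _ ⟨p, rfl⟩; exact hψa p⟩
  have : Nonempty P := ⟨p₀⟩
  refine ⟨⨅ p, ψ p, le_ciInf hψa, fun ε hε => ?_⟩
  obtain ⟨p₁, hp₁⟩ := exists_lt_of_ciInf_lt (lt_add_of_pos_right (⨅ p, ψ p) hε)
  obtain ⟨p, hpp₁, hp⟩ := exists_ekeland_point hψ hψa hε p₁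
  -- a continuous descent direction along the path, vanishing at its ends
  let d : unitInterval → H := fun t =>
    -((max 0 (min 1 (F (p.1 t) / a)) / max ‖G (p.1 t)‖ ε) • G (p.1 t))
  have hmp : ∀ t, 0 < max ‖G (p.1 t)‖ ε := fun t => lt_max_of_lt_right hε
  have hGp : Continuous fun t => G (p.1 t) := hG.comp p.1.continuous
  have hd : Continuous d := by
    refine (Continuous.smul (Continuous.div ?_ ?_ fun t => (hmp t).ne') hGp).neg
    · exact continuous_const.max (continuous_const.min ((hFp p).div_const a))
    · exact hGp.norm.max continuous_const
  have hd1 : ∀ t, ‖d t‖ ≤ 1 := by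
    intro t
    have h1 : max 0 (min 1 (F (p.1 t) / a)) ≤ 1 := max_le zero_le_one (min_le_left _ _)
    have h2 : 0 ≤ max 0 (min 1 (F (p.1 t) / a)) := le_max_left _ _
    simp only [d, norm_neg, norm_smul, Real.norm_eq_abs]
    rw [abs_of_nonneg (div_nonneg h2 (hmp t).le), div_mul_eq_mul_div, div_le_one (hmp t)]
    calc _ ≤ 1 * ‖G (p.1 t)‖ := by gcongr
      _ ≤ _ := by rw [one_mul]; exact le_max_left _ _
  have hdz : ∀ t, F (p.1 t) ≤ 0 → d t = 0 := by
    intro t ht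
    have : max 0 (min 1 (F (p.1 t) / a)) = 0 :=
      max_eq_left ((min_le_right _ _).trans (div_nonpos_of_nonpos_of_nonneg ht ha.le))
    simp only [d, this, zero_div, zero_smul, neg_zero]
  have hdm : ∀ t, F (p.1 t) = ψ p →
      inner ℝ (G (p.1 t)) (d t) = -(‖G (p.1 t)‖ ^ 2 / max ‖G (p.1 t)‖ ε) := by
    intro t ht
    have h1 : 1 ≤ F (p.1 t) / a := by rw [ht, one_le_div ha]; exact hψa p
    have : max 0 (min 1 (F (p.1 t) / a)) = 1 := by
      rw [min_eq_left h1]; exact max_eq_right zero_le_one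
    simp only [d, this, inner_neg_right, inner_smul_right, real_inner_self_eq_norm_sq]
    ring
  -- The path is pushed by d/(n + 1), which moves it by at most 1/(n + 1). By the Ekeland property
  -- its maximum drops by at most ε/(n + 1), and `t` is a point where the new maximum is attained.
  have hstep : ∀ n : ℕ, ∃ t, ∃ σ ∈ Set.Ioo (0 : ℝ) (1 / (n + 1)),
      ψ p - ε * (1 / (n + 1)) ≤ F (p.1 t + (1 / (n + 1) : ℝ) • d t) ∧
      -ε ≤ inner ℝ (G (p.1 t + σ • d t)) (d t) := by
    intro n
    have hs0 : (0 : ℝ) < 1 / (n + 1) := by positivity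
    let q : P := ⟨⟨fun t => p.1 t + (1 / (n + 1) : ℝ) • d t, p.1.continuous.add (hd.const_smul _)⟩, by
      have : F (p.1 0) ≤ 0 := by rw [p.2.1]; exact h0
      simp [hdz 0 this, p.2.1], by
      have : F (p.1 1) ≤ 0 := by rw [p.2.2]; exact he
      simp [hdz 1 this, p.2.2]⟩
    have hdist : dist p q ≤ 1 / (n + 1) := by
      change dist p.1 q.1 ≤ _
      rw [ContinuousMap.dist_le hs0.le]
      intro t
      simp only [q, ContinuousMap.coe_mk, dist_self_add_right, norm_smul, Real.norm_eq_abs,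
        abs_of_pos hs0]
      exact mul_le_of_le_one_right hs0.le (hd1 t)
    obtain ⟨t, ht⟩ := hmax q
    have h1 : ψ p - ε * (1 / (n + 1)) ≤ F (p.1 t + (1 / (n + 1) : ℝ) • d t) := by
      have := hp q
      rw [← ht] at this
      have h3 : ε * dist p q ≤ ε * (1 / (n + 1)) := by gcongr
      exact le_trans (by linarith) this
    obtain ⟨σ, hσ, hi⟩ := exists_inner_gradient_of_le (ε := ε) hF (p.1 t) (d t) hs0
      (le_trans (by linarith [hle p t]) h1)
    exact ⟨t, σ, hσ, h1, hi⟩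
  choose t σ hσ h1 h2 using hstep
  obtain ⟨t₀, -, φ, hφ, htφ⟩ := isCompact_univ.tendsto_subseq fun n => Set.mem_univ (t n)
  have hs0 : Tendsto (fun n : ℕ => (1 / (φ n + 1) : ℝ)) atTop (𝓝 0) :=
    (tendsto_one_div_add_atTop_nhds_zero_nat).comp hφ.tendsto_atTop
  have hσ0 : Tendsto (fun n => σ (φ n)) atTop (𝓝 0) :=
    squeeze_zero (fun n => (hσ _).1.le) (fun n => (hσ _).2.le) hs0
  have hpt : Tendsto (fun n => p.1 (t (φ n))) atTop (𝓝 (p.1 t₀)) :=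
    (p.1.continuous.tendsto t₀).comp htφ
  have hdt : Tendsto (fun n => d (t (φ n))) atTop (𝓝 (d t₀)) := (hd.tendsto t₀).comp htφ
  have hlim1 : Tendsto (fun n => F (p.1 (t (φ n)) + (1 / (φ n + 1) : ℝ) • d (t (φ n)))) atTop
      (𝓝 (F (p.1 t₀))) := by
    have : Tendsto (fun n => p.1 (t (φ n)) + (1 / (φ n + 1) : ℝ) • d (t (φ n))) atTop
      (𝓝 (p.1 t₀ + (0 : ℝ) • d t₀)) := hpt.add (hs0.smul hdt)
    rw [zero_smul, add_zero] at this
    exact (hFc.tendsto _).comp this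
  have hlim2 : Tendsto (fun n => inner ℝ (G (p.1 (t (φ n)) + σ (φ n) • d (t (φ n))))
      (d (t (φ n)))) atTop (𝓝 (inner ℝ (G (p.1 t₀)) (d t₀))) := by
    have : Tendsto (fun n => p.1 (t (φ n)) + σ (φ n) • d (t (φ n))) atTop
      (𝓝 (p.1 t₀ + (0 : ℝ) • d t₀)) := hpt.add (hσ0.smul hdt)
    rw [zero_smul, add_zero] at this
    exact ((hG.tendsto _).comp this).inner hdt
  -- An accumulation point of the maximum points of the pushed paths is a maximum point of `p`.
  -- There the cut-off in `d` equals 1, because ψ p ≥ a.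
  have hmax0 : F (p.1 t₀) = ψ p := by
    refine le_antisymm (hle p t₀) ?_
    have hl : Tendsto (fun n : ℕ => ψ p - ε * (1 / (φ n + 1))) atTop (𝓝 (ψ p - ε * 0)) :=
      tendsto_const_nhds.sub (hs0.const_mul ε)
    rw [mul_zero, sub_zero] at hl
    exact le_of_tendsto_of_tendsto' hl hlim1 fun n => h1 (φ n)
  have hge : -ε ≤ inner ℝ (G (p.1 t₀)) (d t₀) := ge_of_tendsto' hlim2 fun n => h2 (φ n)
  refine ⟨p.1 t₀, ?_, ?_⟩
  · rw [hmax0, abs_of_nonneg (sub_nonneg.2 (ciInf_le hbdd p))]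
    linarith
  -- The inequality is now ‖G‖² / max(‖G‖, ε) ≤ ε, which excludes ‖G‖ > ε.
  · rw [hdm t₀ hmax0, neg_le_neg_iff] at hge
    by_contra hcon
    push Not at hcon
    rw [max_eq_left hcon.le, sq, mul_div_assoc, div_self (hε.trans hcon).ne'] at hge
    linarith

/-- A mountain pass theorem for gradients of the form `T - B` with `T` strongly monotone on bounded
sets and `B` compact, under a boundedness condition on Palais-Smale sequences. -/
theorem exists_critical_point_of_mountain_pass {F : H → ℝ} {T B : H → H} (hT : Continuous T)
    (hB : Continuous B) (hF : ∀ u, HasFDerivAt F (innerSL ℝ (T u - B u)) u)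
    (hmono : ∀ M, ∃ C > 0, ∀ u w, ‖u‖ ≤ M → ‖w‖ ≤ M →
      ‖u - w‖ ^ 2 ≤ C * inner ℝ (T u - T w) (u - w))
    (hcpt : ∀ (M : ℝ) (u : ℕ → H), (∀ n, ‖u n‖ ≤ M) →
      ∃ φ : ℕ → ℕ, StrictMono φ ∧ CauchySeq fun n => B (u (φ n)))
    (hbdd : ∀ c, ∃ ε > 0, ∃ M, ∀ u, F u ≤ c → ‖T u - B u‖ ≤ ε → ‖u‖ ≤ M)
    {e : H} {ρ a : ℝ} (hρ : 0 < ρ) (ha : 0 < a)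
    (h0 : F 0 ≤ 0) (he : F e ≤ 0) (hρe : ρ ≤ ‖e‖) (hs : ∀ u, ‖u‖ = ρ → a ≤ F u) :
    ∃ u, T u = B u ∧ 0 < F u := by
  obtain ⟨c, hac, hps⟩ := exists_palais_smale (hT.sub hB) hF hρ ha h0 he hρe hs
  obtain ⟨ε₀, hε₀, M, hM⟩ := hbdd (c + 1)
  have hpos : ∀ n : ℕ, 0 < min (min 1 ε₀) (1 / ((n : ℝ) + 1)) := fun n => by positivity
  choose u hu1 hu2 using fun n : ℕ => hps _ (hpos n)
  have hz : Tendsto (fun n : ℕ => 1 / ((n : ℝ) + 1)) atTop (𝓝 0) :=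
    tendsto_one_div_add_atTop_nhds_zero_nat
  have huM : ∀ n, ‖u n‖ ≤ M := by
    intro n
    have h1 : min (min 1 ε₀) (1 / ((n : ℝ) + 1)) ≤ 1 := (min_le_left _ _).trans (min_le_left _ _)
    have h2 : min (min 1 ε₀) (1 / ((n : ℝ) + 1)) ≤ ε₀ := (min_le_left _ _).trans (min_le_right _ _)
    exact hM _ (by linarith [(abs_le.1 ((hu1 n).trans h1)).2]) ((hu2 n).trans h2)
  have hG0 : Tendsto (fun n => T (u n) - B (u n)) atTop (𝓝 0) :=
    squeeze_zero_norm (fun n => (hu2 n).trans (min_le_right _ _)) hz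
  have hFc : Tendsto (fun n => F (u n)) atTop (𝓝 c) := by
    rw [tendsto_iff_norm_sub_tendsto_zero]
    exact squeeze_zero (fun n => norm_nonneg _) (fun n => (hu1 n).trans (min_le_right _ _)) hz
  obtain ⟨φ, hφ, hBc⟩ := hcpt M u huM
  -- T = (T - B) + B, where the first term tends to 0 and the second is Cauchy along φ.
  have hTc : CauchySeq fun n => T (u (φ n)) := by
    have := (hG0.comp hφ.tendsto_atTop).cauchySeq.add hBc
    have heq : (fun n => T (u (φ n)))
        = (fun n => T (u n) - B (u n)) ∘ φ + fun n => B (u (φ n)) := by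
      funext n
      simp
    rw [heq]
    exact this
  obtain ⟨C, hC, hCm⟩ := hmono M
  have hcau : CauchySeq fun n => u (φ n) := by
    rw [Metric.cauchySeq_iff'] at hTc ⊢
    intro η hη
    obtain ⟨n, hn⟩ := hTc (η / C) (by positivity)
    refine ⟨n, fun k hk => ?_⟩
    have h1 := hn k hk
    rw [dist_eq_norm] at h1 ⊢
    have h2 := hCm (u (φ k)) (u (φ n)) (huM _) (huM _)
    have h3 := real_inner_le_norm (T (u (φ k)) - T (u (φ n))) (u (φ k) - u (φ n))
    rw [lt_div_iff₀ hC] at h1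
    by_contra hcon
    push Not at hcon
    have h4 : 0 < ‖u (φ k) - u (φ n)‖ := hη.trans_le hcon
    have h5 : ‖u (φ k) - u (φ n)‖ ^ 2
        ≤ C * (‖T (u (φ k)) - T (u (φ n))‖ * ‖u (φ k) - u (φ n)‖) :=
      h2.trans (by gcongr)
    nlinarith
  obtain ⟨w, hw⟩ := cauchySeq_tendsto_of_complete hcau
  refine ⟨w, ?_, ?_⟩
  · have h1 : Tendsto (fun n => T (u (φ n)) - B (u (φ n))) atTop (𝓝 (T w - B w)) :=
      ((hT.sub hB).tendsto w).comp hw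
    exact sub_eq_zero.1 (tendsto_nhds_unique h1 (hG0.comp hφ.tendsto_atTop))
  · have h1 : Tendsto (fun n => F (u (φ n))) atTop (𝓝 (F w)) := ((hF w).continuousAt.tendsto).comp hw
    rw [tendsto_nhds_unique h1 (hFc.comp hφ.tendsto_atTop)]
    linarith

end QLS

namespace QLS

/-! ### The radial measure -/

/-- The image of the Lebesgue measure of `ℝ^N` under the norm. -/
noncomputable def radialMeasure (N : ℕ) : Measure ℝ :=
  Measure.map (fun x : EuclideanSpace ℝ (Fin N) => ‖x‖) volume

/-- The surface measure of the unit sphere of `ℝ^N`. -/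
noncomputable def sphereArea (N : ℕ) : ℝ :=
  (volume : Measure (EuclideanSpace ℝ (Fin N))).toSphere.real Set.univ

variable {N : ℕ}

theorem measurable_norm_euclidean : Measurable fun x : EuclideanSpace ℝ (Fin N) => ‖x‖ :=
  measurable_norm

theorem ae_comp_norm {p : ℝ → Prop} (h : ∀ᵐ r ∂(radialMeasure N), p r) :
    ∀ᵐ x : EuclideanSpace ℝ (Fin N), p ‖x‖ :=
  ae_of_ae_map measurable_norm_euclidean.aemeasurable h

theorem radialMeasure_Iio_lt_top (b : ℝ) : radialMeasure N (Set.Iio b) < ⊤ := by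
  rw [radialMeasure, Measure.map_apply measurable_norm_euclidean measurableSet_Iio]
  have : (fun x : EuclideanSpace ℝ (Fin N) => ‖x‖) ⁻¹' Set.Iio b = Metric.ball 0 b := by
    ext x; simp
  rw [this]
  exact measure_ball_lt_top

instance sigmaFinite_radialMeasure : SigmaFinite (radialMeasure N) :=
  ⟨⟨{ set := fun n => Set.Iio (n : ℝ)
      set_mem := fun _ => trivial
      finite := fun n => radialMeasure_Iio_lt_top n
      spanning := Set.eq_univ_of_forall fun x => by
        obtain ⟨n, hn⟩ := exists_nat_gt x
        exact Set.mem_iUnion.2 ⟨n, hn⟩ }⟩⟩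

variable [hN : Fact (3 ≤ N)]

instance nontrivial_euclidean : Nontrivial (EuclideanSpace ℝ (Fin N)) := by
  have : 0 < Module.finrank ℝ (EuclideanSpace ℝ (Fin N)) := by
    rw [finrank_euclideanSpace_fin]; have := hN.out; omega
  exact Module.nontrivial_of_finrank_pos this

theorem sphereArea_pos : 0 < sphereArea N := by
  rw [sphereArea, Measure.toSphere_real_apply_univ, finrank_euclideanSpace_fin]
  have h1 : 0 < (volume : Measure (EuclideanSpace ℝ (Fin N))).real (Metric.ball 0 1) :=
    ENNReal.toReal_pos (Metric.measure_ball_pos _ _ one_pos).ne' measure_ball_lt_top.ne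
  have := hN.out
  positivity

/-- Polar coordinates: off the origin, space is the product of the unit sphere and the half line
with density r^{N-1}, and the integrand ignores the sphere factor. -/
theorem lintegral_radialMeasure {F : ℝ → ℝ≥0∞} (hF : Measurable F) :
    ∫⁻ r, F r ∂(radialMeasure N)
      = ENNReal.ofReal (sphereArea N) * ∫⁻ r in Set.Ioi 0, ENNReal.ofReal (r ^ (N - 1)) * F r := by
  rw [radialMeasure, lintegral_map hF measurable_norm_euclidean]
  set μ := (volume : Measure (EuclideanSpace ℝ (Fin N)))
  rw [← restrict_compl_singleton (μ := μ) 0,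
    ← lintegral_subtype_comap (measurableSet_singleton _).compl]
  have h1 := μ.measurePreserving_homeomorphUnitSphereProd.lintegral_comp_emb
    (Homeomorph.measurableEmbedding _) (fun p => F p.2)
  simp only [homeomorphUnitSphereProd_apply_snd_coe, finrank_euclideanSpace_fin] at h1
  rw [h1]
  have h2 := lintegral_map (μ := μ.toSphere.prod (Measure.volumeIoiPow (N - 1)))
    (f := fun r : Set.Ioi (0 : ℝ) => F r) (g := Prod.snd) (by fun_prop) measurable_snd
  rw [← h2, Measure.map_snd_prod, lintegral_smul_measure, Measure.volumeIoiPow,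
    lintegral_withDensity_eq_lintegral_mul _ (by fun_prop) (by fun_prop)]
  rw [← lintegral_subtype_comap measurableSet_Ioi, sphereArea, Measure.real, ENNReal.ofReal_toReal
    (measure_ne_top _ _)]
  rfl

theorem radialMeasure_eq : radialMeasure N = ENNReal.ofReal (sphereArea N) •
    (volume.restrict (Set.Ioi 0)).withDensity fun r => ENNReal.ofReal (r ^ (N - 1)) := by
  ext s hs
  rw [← lintegral_indicator_one hs, lintegral_radialMeasure (measurable_one.indicator hs),
    Measure.smul_apply, withDensity_apply _ hs, smul_eq_mul]
  congr 1
  rw [← lintegral_indicator hs]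
  congr 1
  ext r
  by_cases hr : r ∈ s <;> simp [hr]

theorem ae_radialMeasure_iff {p : ℝ → Prop} :
    (∀ᵐ r ∂(radialMeasure N), p r) ↔ ∀ᵐ r ∂(volume.restrict (Set.Ioi 0)), p r := by
  rw [radialMeasure_eq, Measure.ae_ennreal_smul_measure_iff
    (by simpa using sphereArea_pos), ae_withDensity_iff (by fun_prop)]
  refine ⟨fun h => ?_, fun h => ?_⟩
  · filter_upwards [h, ae_restrict_mem measurableSet_Ioi] with r h1 h2
    exact h1 (by simpa using pow_pos h2 _)
  · filter_upwards [h] with r h1 _ using h1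

theorem ae_radialMeasure_pos : ∀ᵐ r ∂(radialMeasure N), 0 < r := by
  rw [ae_radialMeasure_iff]
  exact ae_restrict_mem measurableSet_Ioi

theorem integrable_radialMeasure_iff {F : ℝ → ℝ} :
    Integrable F (radialMeasure N) ↔ IntegrableOn (fun r => r ^ (N - 1) * F r) (Set.Ioi 0) := by
  rw [radialMeasure_eq, integrable_smul_measure (by simpa using sphereArea_pos) (by simp),
    integrable_withDensity_iff_integrable_smul' (by fun_prop) (by simp)]
  refine integrable_congr ?_
  filter_upwards [ae_restrict_mem measurableSet_Ioi] with r hr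
  rw [ENNReal.toReal_ofReal (pow_nonneg (le_of_lt hr) _), smul_eq_mul]

theorem integral_radialMeasure (F : ℝ → ℝ) :
    ∫ r, F r ∂(radialMeasure N) = sphereArea N * ∫ r in Set.Ioi 0, r ^ (N - 1) * F r := by
  rw [radialMeasure_eq, integral_smul_measure, integral_withDensity_eq_integral_toReal_smul
    (by fun_prop) (by simp), ENNReal.toReal_ofReal sphereArea_pos.le, smul_eq_mul]
  congr 1
  refine integral_congr_ae ?_
  filter_upwards [ae_restrict_mem measurableSet_Ioi] with r hr
  rw [ENNReal.toReal_ofReal (pow_nonneg (le_of_lt hr) _), smul_eq_mul]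

end QLS

namespace QLS

/-! ### Radial functions as integrals of their derivatives -/

/-- The function on `(0, ∞)` with derivative `v` that vanishes at infinity. -/
noncomputable def tailIntegral (v : ℝ → ℝ) (r : ℝ) : ℝ :=
  if 0 < r then -∫ s in Set.Ioi r, v s else 0

theorem tailIntegral_of_pos (v : ℝ → ℝ) {r : ℝ} (hr : 0 < r) :
    tailIntegral v r = -∫ s in Set.Ioi r, v s := if_pos hr

theorem sq_lintegral_mul_le {α : Type*} [MeasurableSpace α] (μ : Measure α) {f g : α → ℝ≥0∞}
    (hf : AEMeasurable f μ) (hg : AEMeasurable g μ) :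
    (∫⁻ a, f a * g a ∂μ) ^ 2 ≤ (∫⁻ a, f a ^ 2 ∂μ) * ∫⁻ a, g a ^ 2 ∂μ := by
  have h := ENNReal.lintegral_mul_le_Lp_mul_Lq μ Real.HolderConjugate.two_two hf hg
  calc (∫⁻ a, f a * g a ∂μ) ^ 2
      ≤ ((∫⁻ a, f a ^ (2 : ℝ) ∂μ) ^ (1 / (2 : ℝ)) * (∫⁻ a, g a ^ (2 : ℝ) ∂μ) ^ (1 / (2 : ℝ))) ^ 2 := by
        gcongr; exact h
    _ = _ := by
        rw [mul_pow, ← ENNReal.rpow_natCast, ← ENNReal.rpow_natCast (n := 2), ← ENNReal.rpow_mul,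
          ← ENNReal.rpow_mul]
        norm_num

theorem lintegral_Ioi_rpow {a r : ℝ} (ha : 1 < a) (hr : 0 < r) :
    ∫⁻ s in Set.Ioi r, ENNReal.ofReal (s ^ (-a)) = ENNReal.ofReal (r ^ (1 - a) / (a - 1)) := by
  rw [← ofReal_integral_eq_lintegral_ofReal (integrableOn_Ioi_rpow_of_lt (by linarith) hr),
    integral_Ioi_rpow_of_lt (by linarith) hr]
  · congr 1
    rw [show -a + 1 = 1 - a by ring, show 1 - a = -(a - 1) by ring, div_neg, neg_div, neg_neg]
  · filter_upwards [ae_restrict_mem measurableSet_Ioi] with s hs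
    exact Real.rpow_nonneg (hr.le.trans (le_of_lt hs)) _

/-- Weighted Cauchy-Schwarz inequality on a half line. -/
theorem sq_lintegral_Ioi_le {v : ℝ → ℝ} (hv : AEStronglyMeasurable v (volume.restrict (Set.Ioi 0)))
    {b r : ℝ} (hb : 1 < b) (hr : 0 < r) :
    (∫⁻ s in Set.Ioi r, ‖v s‖ₑ) ^ 2
      ≤ (∫⁻ s in Set.Ioi r, ENNReal.ofReal (s ^ b) * ‖v s‖ₑ ^ 2)
        * ENNReal.ofReal (r ^ (1 - b) / (b - 1)) := by
  have hv' : AEStronglyMeasurable v (volume.restrict (Set.Ioi r)) :=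
    hv.mono_set (Set.Ioi_subset_Ioi hr.le)
  have h1 : ∫⁻ s in Set.Ioi r, ‖v s‖ₑ = ∫⁻ s in Set.Ioi r,
      (ENNReal.ofReal (s ^ (b / 2)) * ‖v s‖ₑ) * ENNReal.ofReal (s ^ (-(b / 2))) := by
    refine setLIntegral_congr_fun measurableSet_Ioi fun s hs => ?_
    have hs0 : 0 < s := hr.trans hs
    rw [mul_right_comm, ← ENNReal.ofReal_mul (by positivity), ← Real.rpow_add hs0]
    simp
  rw [h1]
  have hpow : ∀ a : ℝ, AEMeasurable (fun s : ℝ => ENNReal.ofReal (s ^ a))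
    (volume.restrict (Set.Ioi r)) := fun a => by fun_prop
  refine (sq_lintegral_mul_le _ ((hpow _).mul hv'.enorm) (hpow _)).trans (le_of_eq ?_)
  rw [← lintegral_Ioi_rpow hb hr]
  congr 1
  · refine setLIntegral_congr_fun measurableSet_Ioi fun s hs => ?_
    have hs0 : 0 < s := hr.trans hs
    simp only [Pi.mul_apply]
    rw [mul_pow, ← ENNReal.ofReal_pow (by positivity), ← Real.rpow_natCast, ← Real.rpow_mul hs0.le]
    norm_num
  · refine setLIntegral_congr_fun measurableSet_Ioi fun s hs => ?_
    have hs0 : 0 < s := hr.trans hs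
    rw [← ENNReal.ofReal_pow (by positivity), ← Real.rpow_natCast, ← Real.rpow_mul hs0.le]
    norm_num

/-- The constant of the pointwise estimate for radial functions. -/
noncomputable def decayConst (N : ℕ) : ℝ := √(1 / (sphereArea N * ((N : ℝ) - 2)))

theorem decayConst_nonneg {N : ℕ} : 0 ≤ decayConst N := Real.sqrt_nonneg _

variable {N : ℕ} [hN : Fact (3 ≤ N)]

/-- The exponent `(N - 2) / 2` of the decay of radial functions. -/
noncomputable def decay (N : ℕ) : ℝ := ((N : ℝ) - 2) / 2

theorem three_le_cast : (3 : ℝ) ≤ N := by exact_mod_cast hN.out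

theorem decay_pos : 0 < decay N := by
  have := three_le_cast (N := N); unfold decay; linarith

theorem pow_sub_one_eq_rpow (r : ℝ) : r ^ (N - 1) = r ^ ((N : ℝ) - 1) := by
  rw [← Real.rpow_natCast, Nat.cast_sub (by have := hN.out; omega), Nat.cast_one]

theorem volume_restrict_absolutelyContinuous :
    (volume.restrict (Set.Ioi 0) : Measure ℝ) ≪ radialMeasure N := by
  intro s hs
  have : ∀ᵐ r ∂(radialMeasure N), r ∉ s := measure_eq_zero_iff_ae_notMem.1 hs
  exact measure_eq_zero_iff_ae_notMem.2 (ae_radialMeasure_iff.1 this)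

theorem tailIntegral_congr_ae {v w : ℝ → ℝ} (h : v =ᵐ[radialMeasure N] w) :
    tailIntegral v = tailIntegral w := by
  ext r
  by_cases hr : 0 < r
  · rw [tailIntegral_of_pos v hr, tailIntegral_of_pos w hr]
    congr 1
    refine integral_congr_ae ?_
    exact ae_mono (Measure.restrict_mono (Set.Ioi_subset_Ioi hr.le) le_rfl)
      (ae_radialMeasure_iff.1 h)
  · simp [tailIntegral, hr]

theorem lintegral_radialMeasure_ae {F : ℝ → ℝ≥0∞}
    (hF : AEMeasurable F (radialMeasure N)) :
    ∫⁻ r, F r ∂(radialMeasure N)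
      = ENNReal.ofReal (sphereArea N) * ∫⁻ r in Set.Ioi 0, ENNReal.ofReal (r ^ (N - 1)) * F r := by
  rw [lintegral_congr_ae hF.ae_eq_mk, lintegral_radialMeasure hF.measurable_mk]
  congr 1
  refine lintegral_congr_ae ?_
  filter_upwards [ae_radialMeasure_iff.1 hF.ae_eq_mk] with r hr
  rw [hr]

theorem eLpNorm_two_sq {α E : Type*} [MeasurableSpace α] [NormedAddCommGroup E] (v : α → E)
    (μ : Measure α) : eLpNorm v 2 μ ^ 2 = ∫⁻ r, ‖v r‖ₑ ^ 2 ∂μ := by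
  rw [eLpNorm_eq_lintegral_rpow_enorm_toReal (by norm_num) (by norm_num), ← ENNReal.rpow_natCast,
    ← ENNReal.rpow_mul]
  norm_num

theorem eLpNorm_two_sq_radialMeasure {v : ℝ → ℝ}
    (hv : AEStronglyMeasurable v (radialMeasure N)) :
    eLpNorm v 2 (radialMeasure N) ^ 2 = ENNReal.ofReal (sphereArea N)
      * ∫⁻ r in Set.Ioi 0, ENNReal.ofReal (r ^ (N - 1)) * ‖v r‖ₑ ^ 2 := by
  rw [eLpNorm_two_sq, lintegral_radialMeasure_ae (hv.enorm.pow_const 2)]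

/-- Cauchy-Schwarz against the density s^{N-1} of the radial measure. Convergence of ∫_r^∞ s^{1-N}
ds requires N > 2. -/
theorem lintegral_Ioi_enorm_le {v : ℝ → ℝ} (hv : AEStronglyMeasurable v (radialMeasure N))
    {r : ℝ} (hr : 0 < r) :
    ∫⁻ s in Set.Ioi r, ‖v s‖ₑ
      ≤ ENNReal.ofReal (decayConst N * r ^ (-decay N)) * eLpNorm v 2 (radialMeasure N) := by
  have h3 := three_le_cast (N := N)
  have hA := sphereArea_pos (N := N)
  have h1 := sq_lintegral_Ioi_le (hv.mono_ac volume_restrict_absolutelyContinuous)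
    (b := (N : ℝ) - 1) (by linarith) hr
  have h2 : ∫⁻ s in Set.Ioi r, ENNReal.ofReal (s ^ ((N : ℝ) - 1)) * ‖v s‖ₑ ^ 2
      ≤ ENNReal.ofReal (1 / sphereArea N) * eLpNorm v 2 (radialMeasure N) ^ 2 := by
    rw [eLpNorm_two_sq_radialMeasure hv, ← mul_assoc, ← ENNReal.ofReal_mul (by positivity),
      one_div_mul_cancel hA.ne', ENNReal.ofReal_one, one_mul]
    simp_rw [pow_sub_one_eq_rpow]
    exact lintegral_mono_set (Set.Ioi_subset_Ioi hr.le)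
  refine (ENNReal.pow_le_pow_left_iff two_ne_zero).1 ?_
  refine h1.trans ((mul_le_mul_left h2 _).trans (le_of_eq ?_))
  rw [mul_right_comm, ← ENNReal.ofReal_mul (by positivity), mul_pow, ← ENNReal.ofReal_pow
    (mul_nonneg decayConst_nonneg (by positivity)), mul_pow, decayConst, Real.sq_sqrt
    (by have : 0 < (N : ℝ) - 2 := by linarith
        positivity), ← Real.rpow_natCast, ← Real.rpow_mul hr.le]
  congr 2
  rw [show (1 : ℝ) - (N - 1) = -decay N * (2 : ℕ) by unfold decay; push_cast; ring,
    show (N : ℝ) - 1 - 1 = N - 2 by ring]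
  have : (N : ℝ) - 2 ≠ 0 := by linarith
  field_simp

theorem integrableOn_Ioi_of_memLp {v : ℝ → ℝ} (hv : MemLp v 2 (radialMeasure N)) {r : ℝ}
    (hr : 0 < r) : IntegrableOn v (Set.Ioi r) := by
  refine ⟨(hv.1.mono_ac volume_restrict_absolutelyContinuous).mono_set (Set.Ioi_subset_Ioi hr.le), ?_⟩
  exact (lintegral_Ioi_enorm_le hv.1 hr).trans_lt (ENNReal.mul_lt_top ENNReal.ofReal_lt_top hv.2)

theorem enorm_tailIntegral_le (v : ℝ → ℝ) {r : ℝ} (hr : 0 < r) :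
    ‖tailIntegral v r‖ₑ ≤ ∫⁻ s in Set.Ioi r, ‖v s‖ₑ := by
  rw [tailIntegral_of_pos v hr, enorm_neg]
  exact enorm_integral_le_lintegral_enorm _

theorem abs_tailIntegral_le {v : ℝ → ℝ} (hv : MemLp v 2 (radialMeasure N)) {r : ℝ} (hr : 0 < r) :
    |tailIntegral v r|
      ≤ decayConst N * (eLpNorm v 2 (radialMeasure N)).toReal * r ^ (-decay N) := by
  have h := (enorm_tailIntegral_le v hr).trans (lintegral_Ioi_enorm_le hv.1 hr)
  have h2 := ENNReal.toReal_mono (ENNReal.mul_lt_top ENNReal.ofReal_lt_top hv.2).ne h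
  rw [ENNReal.toReal_mul, ENNReal.toReal_ofReal (mul_nonneg decayConst_nonneg (by positivity)),
    toReal_enorm, Real.norm_eq_abs] at h2
  linarith

theorem continuousOn_tailIntegral {v : ℝ → ℝ} (hv : MemLp v 2 (radialMeasure N)) :
    ContinuousOn (tailIntegral v) (Set.Ioi 0) := by
  intro r hr
  have hr : 0 < r := hr
  have h1 := (integrableOn_Ioi_of_memLp hv (half_pos hr)).continuousOn_Ici_primitive_Ioi
  have h2 : ContinuousAt (fun b => -∫ x in Set.Ioi b, v x) r :=
    (h1.continuousAt (Ici_mem_nhds (half_lt_self hr))).neg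
  refine (h2.congr ?_).continuousWithinAt
  filter_upwards [Ioi_mem_nhds hr] with s hs
  rw [tailIntegral_of_pos v hs]

theorem measurable_of_continuousOn_Ioi {F : ℝ → ℝ} (hF : ContinuousOn F (Set.Ioi 0))
    (h0 : ∀ r ≤ 0, F r = 0) : Measurable F := by
  have h := hF.measurable_piecewise (g := fun _ => 0) continuousOn_const measurableSet_Ioi
  convert h using 1
  ext r
  by_cases hr : 0 < r
  · simp [hr]
  · simp [hr, h0 r (not_lt.1 hr)]

theorem measurable_tailIntegral {v : ℝ → ℝ} (hv : MemLp v 2 (radialMeasure N)) :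
    Measurable (tailIntegral v) :=
  measurable_of_continuousOn_Ioi (continuousOn_tailIntegral hv) fun r hr => by
    simp [tailIntegral, not_lt.2 hr]

/-- Hardy's inequality. -/
theorem lintegral_hardy {v : ℝ → ℝ} (hv : MemLp v 2 (radialMeasure N)) :
    ∫⁻ r, ENNReal.ofReal (r ^ (-2 : ℝ)) * ‖tailIntegral v r‖ₑ ^ 2 ∂(radialMeasure N)
      ≤ 4 * eLpNorm v 2 (radialMeasure N) ^ 2 := by
  have h3 := three_le_cast (N := N)
  have hv' := hv.1.mono_ac volume_restrict_absolutelyContinuous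
  have hm := measurable_tailIntegral hv
  rw [eLpNorm_two_sq_radialMeasure hv.1, lintegral_radialMeasure (by fun_prop), mul_left_comm]
  gcongr
  -- The weight exponent N - 3/2 lies strictly between 1 and N - 1. Above 1, Cauchy-Schwarz on (r,
  -- ∞) converges; below N - 1, what remains in r is the power r^{-1/2}, integrable at 0. Tonelli
  -- then restores s^{N-1}, and 1/(N - 5/2) ≤ 2 gives the constant 4.
  let g : ℝ → ℝ≥0∞ := fun s => ENNReal.ofReal (s ^ ((N : ℝ) - 3 / 2)) * ‖v s‖ₑ ^ 2
  have hg : AEMeasurable g (volume.restrict (Set.Ioi 0)) :=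
    AEMeasurable.mul (by fun_prop) (hv'.enorm.pow_const 2)
  calc ∫⁻ r in Set.Ioi 0, ENNReal.ofReal (r ^ (N - 1)) *
        (ENNReal.ofReal (r ^ (-2 : ℝ)) * ‖tailIntegral v r‖ₑ ^ 2)
      ≤ ∫⁻ r in Set.Ioi 0, ∫⁻ s in Set.Ioi 0,
          ENNReal.ofReal (2 * r ^ (-(1 / 2) : ℝ)) * (Set.Ioi r).indicator g s := by
        refine setLIntegral_mono' measurableSet_Ioi fun r hr => ?_
        have hr : 0 < r := hr
        have h1 := sq_lintegral_Ioi_le hv' (b := (N : ℝ) - 3 / 2) (by linarith) hr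
        have h2 : ‖tailIntegral v r‖ₑ ^ 2 ≤ _ :=
          
          le_trans (by gcongr; exact enorm_tailIntegral_le v hr) h1
        rw [lintegral_const_mul'' _ (hg.indicator measurableSet_Ioi),
          lintegral_indicator measurableSet_Ioi, Measure.restrict_restrict measurableSet_Ioi,
          Set.inter_eq_left.2 (Set.Ioi_subset_Ioi hr.le), ← mul_assoc,
          ← ENNReal.ofReal_mul (by positivity)]
        refine (mul_le_mul_right h2 _).trans ?_
        rw [mul_left_comm, mul_comm (ENNReal.ofReal (2 * _)), ← ENNReal.ofReal_mul (by positivity)]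
        refine mul_le_mul_right (ENNReal.ofReal_le_ofReal ?_) _
        rw [pow_sub_one_eq_rpow, ← Real.rpow_add hr, mul_div_assoc', ← Real.rpow_add hr,
          div_le_iff₀ (by linarith), show (N : ℝ) - 1 + -2 + (1 - (N - 3 / 2)) = -(1 / 2) by ring]
        have : 0 < r ^ (-(1 / 2) : ℝ) := by positivity
        nlinarith
    _ = ∫⁻ s in Set.Ioi 0, ∫⁻ r in Set.Ioi 0,
          ENNReal.ofReal (2 * r ^ (-(1 / 2) : ℝ)) * (Set.Ioi r).indicator g s := by
        apply lintegral_lintegral_swap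
        have h1 : AEMeasurable (fun p : ℝ × ℝ => ENNReal.ofReal (2 * p.1 ^ (-(1 / 2) : ℝ)) *
            ({p : ℝ × ℝ | p.1 < p.2}).indicator (fun p => g p.2) p)
            ((volume.restrict (Set.Ioi 0)).prod (volume.restrict (Set.Ioi 0))) := by
          refine AEMeasurable.mul (by fun_prop) (AEMeasurable.indicator ?_ ?_)
          · exact hg.comp_snd
          · exact measurableSet_lt measurable_fst measurable_snd
        exact h1
    _ = ∫⁻ s in Set.Ioi 0, 4 * (ENNReal.ofReal (s ^ (N - 1)) * ‖v s‖ₑ ^ 2) := by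
        refine setLIntegral_congr_fun measurableSet_Ioi fun s hs => ?_
        have hs : 0 < s := hs
        have h1 : ∀ r, ENNReal.ofReal (2 * r ^ (-(1 / 2) : ℝ)) * (Set.Ioi r).indicator g s
            = (Set.Iio s).indicator (fun r => ENNReal.ofReal (2 * r ^ (-(1 / 2) : ℝ))) r * g s := by
          intro r
          by_cases hrs : r < s <;> simp [hrs]
        simp_rw [h1]
        rw [lintegral_mul_const _ (by measurability), lintegral_indicator measurableSet_Iio,
          Measure.restrict_restrict measurableSet_Iio]
        have h2 : Set.Iio s ∩ Set.Ioi 0 = Set.Ioo 0 s := by ext; simp [and_comm]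
        have hint : IntegrableOn (fun r : ℝ => 2 * r ^ (-(1 / 2) : ℝ)) (Set.Ioo 0 s) :=
          ((intervalIntegrable_iff_integrableOn_Ioo_of_le hs.le).1
            (intervalIntegral.intervalIntegrable_rpow' (by norm_num))).const_mul 2
        rw [h2, ← ofReal_integral_eq_lintegral_ofReal hint (by
          filter_upwards [ae_restrict_mem measurableSet_Ioo] with r hr
          have := hr.1
          positivity), integral_const_mul, ← integral_Ioc_eq_integral_Ioo,
          ← intervalIntegral.integral_of_le hs.le, integral_rpow (Or.inl (by norm_num))]
        simp only [g]
        rw [← mul_assoc, ← ENNReal.ofReal_mul (by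
          have := Real.rpow_nonneg hs.le (-(1 / 2) + 1)
          rw [Real.zero_rpow (by norm_num)]; norm_num at this ⊢; positivity), ← mul_assoc,
          show (4 : ℝ≥0∞) = ENNReal.ofReal 4 by simp, ← ENNReal.ofReal_mul (by norm_num)]
        congr 2
        have h5 : s ^ ((N : ℝ) - 1) = s ^ (-(1 / 2) + 1 : ℝ) * s ^ ((N : ℝ) - 3 / 2) := by
          rw [← Real.rpow_add hs]
          congr 1
          ring
        rw [Real.zero_rpow (by norm_num), pow_sub_one_eq_rpow, h5]
        ring
    _ = _ := by
        rw [lintegral_const_mul' _ _ (by norm_num)]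

end QLS

namespace QLS

/-! ### Radial functions and radial vector fields on `ℝ^N` -/

theorem tailIntegral_add {v w : ℝ → ℝ} {r : ℝ} (hv : 0 < r → IntegrableOn v (Set.Ioi r))
    (hw : 0 < r → IntegrableOn w (Set.Ioi r)) :
    tailIntegral (fun s => v s + w s) r = tailIntegral v r + tailIntegral w r := by
  by_cases hr : 0 < r
  · simp only [tailIntegral_of_pos _ hr]
    rw [integral_add (hv hr) (hw hr), neg_add]
  · simp [tailIntegral, hr]

theorem tailIntegral_sub {v w : ℝ → ℝ} {r : ℝ} (hv : 0 < r → IntegrableOn v (Set.Ioi r))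
    (hw : 0 < r → IntegrableOn w (Set.Ioi r)) :
    tailIntegral (fun s => v s - w s) r = tailIntegral v r - tailIntegral w r := by
  by_cases hr : 0 < r
  · simp only [tailIntegral_of_pos _ hr]
    rw [integral_sub (hv hr) (hw hr)]; ring
  · simp [tailIntegral, hr]

theorem tailIntegral_const_mul (c : ℝ) (v : ℝ → ℝ) (r : ℝ) :
    tailIntegral (fun s => c * v s) r = c * tailIntegral v r := by
  by_cases hr : 0 < r
  · simp only [tailIntegral_of_pos _ hr]
    rw [integral_const_mul]; ring
  · simp [tailIntegral, hr]

variable {N : ℕ}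

theorem isFiniteMeasureOnCompacts_aux (K : Set ℝ) (hK : IsCompact K) :
    radialMeasure N K < ⊤ := by
  obtain ⟨b, hb⟩ := hK.bddAbove
  refine (measure_mono fun x hx => ?_).trans_lt (radialMeasure_Iio_lt_top (b + 1))
  exact lt_of_le_of_lt (hb hx) (lt_add_one b)

instance isFiniteMeasureOnCompacts_radialMeasure :
    IsFiniteMeasureOnCompacts (radialMeasure N) :=
  ⟨fun K hK => isFiniteMeasureOnCompacts_aux K hK⟩

theorem eLpNorm_comp_norm {E : Type*} [NormedAddCommGroup E] {F : ℝ → E}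
    (hF : AEStronglyMeasurable F (radialMeasure N)) (p : ℝ≥0∞) :
    eLpNorm (fun x : EuclideanSpace ℝ (Fin N) => F ‖x‖) p volume
      = eLpNorm F p (radialMeasure N) :=
  (eLpNorm_map_measure hF measurable_norm_euclidean.aemeasurable).symm

theorem hasGradientAt_comp_norm {P : ℝ → ℝ} {p' : ℝ} {x : EuclideanSpace ℝ (Fin N)}
    (hP : HasDerivAt P p' ‖x‖) (hx : x ≠ 0) :
    HasGradientAt (fun y : EuclideanSpace ℝ (Fin N) => P ‖y‖) ((p' / ‖x‖) • x) x := by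
  have hx0 : 0 < ‖x‖ := norm_pos_iff.2 hx
  have h1 := ((hasFDerivAt_id x).norm_sq).sqrt (by simpa using hx)
  simp only [id, Real.sqrt_sq (norm_nonneg _)] at h1
  have h2 := hP.comp_hasFDerivAt x h1
  rw [hasGradientAt_iff_hasFDerivAt]
  refine h2.congr_fderiv ?_
  ext y
  simp
  field_simp

/-- The radial function on `ℝ^N` with radial derivative `v` that vanishes at infinity. -/
noncomputable def radialFun (N : ℕ) (v : ℝ → ℝ) (x : EuclideanSpace ℝ (Fin N)) : ℝ :=
  tailIntegral v ‖x‖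

/-- The radial vector field on `ℝ^N` with radial component `v`. -/
noncomputable def radialField (N : ℕ) (v : ℝ → ℝ) (x : EuclideanSpace ℝ (Fin N)) :
    EuclideanSpace ℝ (Fin N) := (v ‖x‖ / ‖x‖) • x

theorem norm_radialField (v : ℝ → ℝ) {x : EuclideanSpace ℝ (Fin N)} (hx : x ≠ 0) :
    ‖radialField N v x‖ = |v ‖x‖| := by
  have hx0 : 0 < ‖x‖ := norm_pos_iff.2 hx
  rw [radialField, norm_smul, Real.norm_eq_abs, abs_div, abs_norm, div_mul_cancel₀ _ hx0.ne']

theorem inner_radialField (v w : ℝ → ℝ) {x : EuclideanSpace ℝ (Fin N)} (hx : x ≠ 0) :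
    inner ℝ (radialField N v x) (radialField N w x) = v ‖x‖ * w ‖x‖ := by
  have hx0 : 0 < ‖x‖ := norm_pos_iff.2 hx
  rw [radialField, radialField, inner_smul_left, inner_smul_right, real_inner_self_eq_norm_sq]
  simp
  field_simp

theorem radialField_sub (v w : ℝ → ℝ) : radialField N (fun r => v r - w r)
    = fun x => radialField N v x - radialField N w x := by
  ext1 x
  simp only [radialField]
  rw [← sub_smul, sub_div]

theorem radialField_congr_ae {v w : ℝ → ℝ} (h : v =ᵐ[radialMeasure N] w) :
    radialField N v =ᵐ[volume] radialField N w := by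
  filter_upwards [ae_comp_norm h] with x hx
  simp only [radialField, hx]

theorem aestronglyMeasurable_comp_norm {E : Type*} [NormedAddCommGroup E] {F : ℝ → E}
    (hF : AEStronglyMeasurable F (radialMeasure N)) :
    AEStronglyMeasurable (fun x : EuclideanSpace ℝ (Fin N) => F ‖x‖) volume :=
  hF.comp_measurable measurable_norm_euclidean

theorem aestronglyMeasurable_radialField {v : ℝ → ℝ}
    (hv : AEStronglyMeasurable v (radialMeasure N)) :
    AEStronglyMeasurable (radialField N v) volume :=
  ((aestronglyMeasurable_comp_norm hv).aemeasurable.div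
    measurable_norm_euclidean.aemeasurable).aestronglyMeasurable.smul aestronglyMeasurable_id

variable [hN : Fact (3 ≤ N)]

theorem ae_ne_zero_euclidean : ∀ᵐ x : EuclideanSpace ℝ (Fin N), x ≠ 0 := by
  simp [ae_iff]

theorem eLpNorm_radialField {v : ℝ → ℝ} (hv : AEStronglyMeasurable v (radialMeasure N))
    (p : ℝ≥0∞) : eLpNorm (radialField N v) p volume = eLpNorm v p (radialMeasure N) := by
  rw [← eLpNorm_comp_norm hv p]
  refine eLpNorm_congr_norm_ae ?_
  filter_upwards [ae_ne_zero_euclidean] with x hx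
  rw [norm_radialField v hx, Real.norm_eq_abs]

theorem memLp_radialField {v : ℝ → ℝ} (hv : MemLp v 2 (radialMeasure N)) :
    MemLp (radialField N v) 2 volume :=
  ⟨aestronglyMeasurable_radialField hv.1, by rw [eLpNorm_radialField hv.1]; exact hv.2⟩

theorem radialFun_sub {v w : ℝ → ℝ} (hv : MemLp v 2 (radialMeasure N))
    (hw : MemLp w 2 (radialMeasure N)) : radialFun N (fun r => v r - w r)
    = fun x => radialFun N v x - radialFun N w x := by
  ext1 x
  exact tailIntegral_sub (fun h => integrableOn_Ioi_of_memLp hv h)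
    (fun h => integrableOn_Ioi_of_memLp hw h)

theorem sobolevExp_toReal : (sobolevExp N).toReal = 2 + 2 / decay N := by
  have h3 := three_le_cast (N := N)
  have : (N : ℝ) - 2 ≠ 0 := by linarith
  have h0 : (0 : ℝ) ≤ 2 * N / ((N : ℝ) - 2) := div_nonneg (by positivity) (by linarith)
  rw [sobolevExp, ENNReal.toReal_ofReal h0, decay]
  field_simp
  ring

theorem one_le_sobolevExp : 1 ≤ sobolevExp N := by
  have h3 := three_le_cast (N := N)
  rw [sobolevExp, ENNReal.one_le_ofReal, one_le_div (by linarith)]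
  linarith

/-- The Sobolev inequality for radial functions. -/
theorem exists_eLpNorm_radialFun_le : ∃ C : ℝ≥0∞, C ≠ ⊤ ∧ ∀ v : ℝ → ℝ,
    MemLp v 2 (radialMeasure N) →
      eLpNorm (radialFun N v) (sobolevExp N) volume ≤ C * eLpNorm v 2 (radialMeasure N) := by
  have hκ := decay_pos (N := N)
  let p : ℝ := 2 + 2 / decay N
  have hp : 0 < p := by positivity
  let D : ℝ≥0∞ := ENNReal.ofReal (decayConst N) ^ (2 / decay N) * 4
  have hD : D ≠ ⊤ := ENNReal.mul_ne_top (ENNReal.rpow_ne_top_of_nonneg (by positivity)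
    ENNReal.ofReal_ne_top) (by norm_num)
  refine ⟨D ^ (1 / p), ENNReal.rpow_ne_top_of_nonneg (by positivity) hD, fun v hv => ?_⟩
  have hm := measurable_tailIntegral hv
  unfold radialFun
  rw [eLpNorm_comp_norm hm.aestronglyMeasurable, eLpNorm_eq_lintegral_rpow_enorm_toReal
    (by simpa using (one_pos.trans_le one_le_sobolevExp).ne') (by simp [sobolevExp]),
    sobolevExp_toReal]
  set A := eLpNorm v 2 (radialMeasure N)
  have key : ∫⁻ r, ‖tailIntegral v r‖ₑ ^ p ∂(radialMeasure N) ≤ D * A ^ p := by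
    calc ∫⁻ r, ‖tailIntegral v r‖ₑ ^ p ∂(radialMeasure N)
        ≤ ∫⁻ r, (ENNReal.ofReal (decayConst N) ^ (2 / decay N) * A ^ (2 / decay N)) *
            (ENNReal.ofReal (r ^ (-2 : ℝ)) * ‖tailIntegral v r‖ₑ ^ 2) ∂(radialMeasure N) := by
          refine lintegral_mono_ae ?_
          filter_upwards [ae_radialMeasure_pos] with r hr
          have h1 := (enorm_tailIntegral_le v hr).trans (lintegral_Ioi_enorm_le hv.1 hr)
          -- The critical exponent is 2 + 2/κ with κ = (N - 2)/2. Raising the decay r^{-κ} to the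
          -- power 2/κ gives exactly the Hardy weight r^{-2}, and the remaining square is handled by
          -- Hardy's inequality.
          have h2 : ‖tailIntegral v r‖ₑ ^ p
              = ‖tailIntegral v r‖ₑ ^ (2 / decay N) * ‖tailIntegral v r‖ₑ ^ 2 := by
            rw [← ENNReal.rpow_natCast, ← ENNReal.rpow_add_of_nonneg _ _ (by positivity)
              (by positivity), add_comm]
            norm_cast
          rw [h2, ← mul_assoc]
          gcongr
          refine (ENNReal.rpow_le_rpow h1 (by positivity)).trans (le_of_eq ?_)
          rw [ENNReal.mul_rpow_of_nonneg _ _ (by positivity), ENNReal.ofReal_mul decayConst_nonneg,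
            ENNReal.mul_rpow_of_nonneg _ _ (by positivity),
            ENNReal.ofReal_rpow_of_pos (p := 2 / decay N) (x := r ^ (-decay N)) (by positivity),
            ← Real.rpow_mul hr.le, show -decay N * (2 / decay N) = -2 by field_simp]
          ring
      _ ≤ (ENNReal.ofReal (decayConst N) ^ (2 / decay N) * A ^ (2 / decay N)) * (4 * A ^ 2) := by
          rw [lintegral_const_mul _ (by fun_prop)]
          gcongr
          exact lintegral_hardy hv
      _ = D * A ^ p := by
          rw [show A ^ p = A ^ (2 / decay N) * A ^ 2 by
            rw [← ENNReal.rpow_natCast, ← ENNReal.rpow_add_of_nonneg _ _ (by positivity)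
              (by positivity), add_comm]
            norm_cast]
          ring
  calc _ ≤ (D * A ^ p) ^ (1 / p) := ENNReal.rpow_le_rpow key (by positivity)
    _ = _ := by
      rw [ENNReal.mul_rpow_of_nonneg _ _ (by positivity), ← ENNReal.rpow_mul,
        mul_one_div_cancel hp.ne', ENNReal.rpow_one]

theorem memLp_radialFun {v : ℝ → ℝ} (hv : MemLp v 2 (radialMeasure N)) :
    MemLp (radialFun N v) (sobolevExp N) volume := by
  obtain ⟨C, hC, h⟩ := exists_eLpNorm_radialFun_le (N := N)
  exact ⟨aestronglyMeasurable_comp_norm (measurable_tailIntegral hv).aestronglyMeasurable,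
    (h v hv).trans_lt (ENNReal.mul_lt_top hC.lt_top hv.2)⟩

end QLS

namespace QLS

/-! ### Weak gradients -/

variable {N : ℕ}

theorem continuous_gradient {φ : EuclideanSpace ℝ (Fin N) → ℝ} (hφ : ContDiff ℝ ∞ φ) :
    Continuous (gradient φ) :=
  (InnerProductSpace.toDual ℝ _).symm.continuous.comp (hφ.continuous_fderiv (by simp))

theorem hasCompactSupport_gradient {φ : EuclideanSpace ℝ (Fin N) → ℝ}
    (hφ : HasCompactSupport φ) : HasCompactSupport (gradient φ) :=
  (hφ.fderiv ℝ).comp_left (g := (InnerProductSpace.toDual ℝ (EuclideanSpace ℝ (Fin N))).symm)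
    (map_zero _)

theorem inner_gradient {φ : EuclideanSpace ℝ (Fin N) → ℝ} (x e : EuclideanSpace ℝ (Fin N)) :
    inner ℝ e (gradient φ x) = fderiv ℝ φ x e := by
  rw [real_inner_comm, gradient, ← InnerProductSpace.toDual_apply_apply, LinearIsometryEquiv.apply_symm_apply]

theorem memLp_gradient {φ : EuclideanSpace ℝ (Fin N) → ℝ} (hφ : IsTestFunction φ) (p : ℝ≥0∞) :
    MemLp (gradient φ) p volume :=
  (continuous_gradient hφ.1).memLp_of_hasCompactSupport (hasCompactSupport_gradient hφ.2)

theorem memLp_testFunction {φ : EuclideanSpace ℝ (Fin N) → ℝ} (hφ : IsTestFunction φ) (p : ℝ≥0∞) :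
    MemLp φ p volume := hφ.1.continuous.memLp_of_hasCompactSupport hφ.2

theorem IsTestFunction.hasWeakGradient {φ : EuclideanSpace ℝ (Fin N) → ℝ}
    (hφ : IsTestFunction φ) : HasWeakGradient φ (gradient φ) := by
  refine ⟨hφ.1.continuous.locallyIntegrable, (continuous_gradient hφ.1).locallyIntegrable,
    fun ψ hψ => ?_⟩
  have hi : ∀ {a b : EuclideanSpace ℝ (Fin N) → ℝ}, IsTestFunction a → IsTestFunction b →
      Integrable (fun x => a x • gradient b x) := fun {a b} ha hb =>
    (ha.1.continuous.smul (continuous_gradient hb.1)).integrable_of_hasCompactSupport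
      (HasCompactSupport.smul_right ha.2)
  refine ext_inner_left ℝ fun e => ?_
  rw [inner_neg_right, ← integral_inner (hi hφ hψ), ← integral_inner (hi hψ hφ)]
  simp_rw [inner_smul_right, inner_gradient]
  have hi' : ∀ {a b : EuclideanSpace ℝ (Fin N) → ℝ}, IsTestFunction a → IsTestFunction b →
      Integrable (fun x => a x * fderiv ℝ b x e) := fun {a b} ha hb => by
    have := (hi ha hb).const_inner (𝕜 := ℝ) e
    simpa only [inner_smul_right, inner_gradient] using this
  rw [integral_mul_fderiv_eq_neg_fderiv_mul_of_integrable]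
  · simp_rw [mul_comm]
  · simp_rw [mul_comm (fderiv ℝ φ _ e)]; exact hi' hψ hφ
  · exact hi' hφ hψ
  · exact (hφ.1.continuous.mul hψ.1.continuous).integrable_of_hasCompactSupport
      (HasCompactSupport.mul_right hφ.2)
  · exact fun x _ => hφ.1.differentiable (by simp) x
  · exact fun x _ => hψ.1.differentiable (by simp) x

theorem HasWeakGradient.congr_ae {u u' : EuclideanSpace ℝ (Fin N) → ℝ}
    {F F' : EuclideanSpace ℝ (Fin N) → EuclideanSpace ℝ (Fin N)} (h : HasWeakGradient u F)
    (hu : u =ᵐ[volume] u') (hF : F =ᵐ[volume] F') : HasWeakGradient u' F' := by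
  refine ⟨(locallyIntegrable_congr hu).1 h.1, (locallyIntegrable_congr hF).1 h.2.1,
    fun ψ hψ => ?_⟩
  rw [← integral_congr_ae (hu.smul (ae_eq_refl (gradient ψ))),
    ← integral_congr_ae ((ae_eq_refl ψ).smul hF)]
  exact h.2.2 ψ hψ

theorem HasWeakGradient.ae_eq {u : EuclideanSpace ℝ (Fin N) → ℝ}
    {F F' : EuclideanSpace ℝ (Fin N) → EuclideanSpace ℝ (Fin N)} (h : HasWeakGradient u F)
    (h' : HasWeakGradient u F') : F =ᵐ[volume] F' := by
  refine ae_eq_of_integral_contDiff_smul_eq h.2.1 h'.2.1 fun g hg hgs => ?_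
  have h1 := h.2.2 g ⟨hg, hgs⟩
  have h2 := h'.2.2 g ⟨hg, hgs⟩
  exact neg_injective (h1.symm.trans h2)

/-- Uniqueness almost everywhere makes the arbitrary choice in `weakGrad` harmless. -/
theorem HasWeakGradient.weakGrad_ae_eq {u : EuclideanSpace ℝ (Fin N) → ℝ}
    {F : EuclideanSpace ℝ (Fin N) → EuclideanSpace ℝ (Fin N)} (h : HasWeakGradient u F) :
    weakGrad u =ᵐ[volume] F := by
  have he : ∃ F, HasWeakGradient u F := ⟨F, h⟩
  have : weakGrad u = he.choose := dif_pos he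
  rw [this]
  exact he.choose_spec.ae_eq h

theorem tendsto_integral_smul_of_eLpNorm {α E : Type*} [MeasurableSpace α] {μ : Measure α}
    [NormedAddCommGroup E] [NormedSpace ℝ E] {p q : ℝ≥0∞} [hpq : p.HolderConjugate q]
    {g : α → ℝ} {F : ℕ → α → E} {F₀ : α → E} (hg : MemLp g p μ) (hF : ∀ n, MemLp (F n) q μ)
    (hF₀ : MemLp F₀ q μ) (h : Tendsto (fun n => eLpNorm (F n - F₀) q μ) atTop (𝓝 0)) :
    Tendsto (fun n => ∫ x, g x • F n x ∂μ) atTop (𝓝 (∫ x, g x • F₀ x ∂μ)) := by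
  refine tendsto_integral_of_L1' _ (hg.1.smul hF₀.1) (Eventually.of_forall fun n => ?_) ?_
  · exact memLp_one_iff_integrable.1 ((hF n).smul hg)
  · have hb : ∀ n, eLpNorm ((fun x => g x • F n x) - fun x => g x • F₀ x) 1 μ
        ≤ eLpNorm g p μ * eLpNorm (F n - F₀) q μ := by
      intro n
      have : ((fun x => g x • F n x) - fun x => g x • F₀ x) = g • (F n - F₀) := by
        ext x; simp [smul_sub]
      rw [this]
      exact eLpNorm_smul_le_mul_eLpNorm ((hF n).sub hF₀).1 hg.1
    refine tendsto_of_tendsto_of_tendsto_of_le_of_le tendsto_const_nhds ?_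
      (fun n => zero_le) hb
    have := ENNReal.Tendsto.const_mul h (Or.inr hg.2.ne)
    simpa using this

/-- Weak gradients are stable under convergence in Lebesgue spaces. -/
theorem hasWeakGradient_of_tendsto {p : ℝ≥0∞} (hp : 1 ≤ p)
    {φ : ℕ → EuclideanSpace ℝ (Fin N) → ℝ} (hφ : ∀ n, IsTestFunction (φ n))
    {u : EuclideanSpace ℝ (Fin N) → ℝ} {F : EuclideanSpace ℝ (Fin N) → EuclideanSpace ℝ (Fin N)}
    (hu : MemLp u p volume) (hF : MemLp F 2 volume)
    (h1 : Tendsto (fun n => eLpNorm (fun x => φ n x - u x) p volume) atTop (𝓝 0))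
    (h2 : Tendsto (fun n => eLpNorm (fun x => gradient (φ n) x - F x) 2 volume) atTop (𝓝 0)) :
    HasWeakGradient u F := by
  refine ⟨hu.locallyIntegrable hp, hF.locallyIntegrable one_le_two, fun ψ hψ => ?_⟩
  have : p.HolderConjugate p.conjExponent := ENNReal.HolderConjugate.conjExponent hp
  have : p.conjExponent.HolderConjugate p := ENNReal.HolderConjugate.symm
  refine ext_inner_left ℝ fun e => ?_
  have hiu : ∀ {a : EuclideanSpace ℝ (Fin N) → ℝ}, MemLp a p volume →
      ∫ x, (inner ℝ e (gradient ψ x)) • a x = inner ℝ e (∫ x, a x • gradient ψ x) := by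
    intro a ha
    have hint : Integrable (fun x => a x • gradient ψ x) :=
      memLp_one_iff_integrable.1 ((memLp_gradient hψ p.conjExponent).smul ha)
    rw [← integral_inner hint]
    simp_rw [inner_smul_right, smul_eq_mul, mul_comm]
  have t1 := tendsto_integral_smul_of_eLpNorm (p := p.conjExponent) (q := p)
    (g := fun x => inner ℝ e (gradient ψ x)) ((memLp_gradient hψ _).const_inner e)
    (fun n => memLp_testFunction (hφ n) p) hu h1
  rw [hiu hu] at t1
  have t2 := tendsto_integral_smul_of_eLpNorm (p := 2) (q := 2) (memLp_testFunction hψ 2)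
    (fun n => memLp_gradient (hφ n) 2) hF h2
  have t3 : Tendsto (fun n => inner ℝ e (-∫ x, ψ x • gradient (φ n) x)) atTop
      (𝓝 (inner ℝ e (-∫ x, ψ x • F x))) := tendsto_const_nhds.inner t2.neg
  refine tendsto_nhds_unique t1 (t3.congr fun n => ?_)
  rw [hiu (memLp_testFunction (hφ n) p), ((hφ n).hasWeakGradient).2.2 ψ hψ]

/-! ### Density of smooth radial functions -/

/-- Smooth functions with compact support in `(0, ∞)`. -/
def IsProfile (ψ : ℝ → ℝ) : Prop :=
  ContDiff ℝ ∞ ψ ∧ HasCompactSupport ψ ∧ tsupport ψ ⊆ Set.Ioi 0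

theorem IsProfile.memLp {ψ : ℝ → ℝ} (h : IsProfile ψ) (p : ℝ≥0∞) :
    MemLp ψ p (radialMeasure N) := h.1.continuous.memLp_of_hasCompactSupport h.2.1

theorem IsProfile.hasDerivAt {ψ : ℝ → ℝ} (h : IsProfile ψ) (r : ℝ) :
    HasDerivAt (fun r => -∫ s in Set.Ioi r, ψ s) (ψ r) r := by
  have hint : Integrable ψ := h.1.continuous.integrable_of_hasCompactSupport h.2.1
  have h1 : (fun r => -∫ s in Set.Ioi r, ψ s)
      = fun r => (∫ s in (0 : ℝ)..r, ψ s) - ∫ s in Set.Ioi 0, ψ s := by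
    ext r
    rw [← intervalIntegral.integral_Ioi_sub_Ioi' hint.integrableOn hint.integrableOn]
    ring
  rw [h1]
  exact (intervalIntegral.integral_hasDerivAt_right (hint.intervalIntegrable)
    (h.1.continuous.stronglyMeasurableAtFilter _ _) h.1.continuous.continuousAt).sub_const _

/-- The smooth radial function with radial derivative `ψ`. -/
noncomputable def smoothRadial (N : ℕ) (ψ : ℝ → ℝ) (x : EuclideanSpace ℝ (Fin N)) : ℝ :=
  -∫ s in Set.Ioi ‖x‖, ψ s

/-- The profile vanishes near 0, so the function is constant near the origin, where the norm is not
smooth. It vanishes for large ‖x‖ because the profile has bounded support. -/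
theorem IsProfile.isRadialTestFunction {ψ : ℝ → ℝ} (h : IsProfile ψ) :
    IsRadialTestFunction (smoothRadial N ψ) := by
  have hd := h.hasDerivAt
  have hsm : ContDiff ℝ ∞ fun r => -∫ s in Set.Ioi r, ψ s := by
    rw [contDiff_infty_iff_deriv]
    refine ⟨fun r => (hd r).differentiableAt, ?_⟩
    rw [show deriv (fun r => -∫ s in Set.Ioi r, ψ s) = ψ from funext fun r => (hd r).deriv]
    exact h.1
  refine ⟨⟨?_, ?_⟩, fun x y hxy => by simp [smoothRadial, hxy]⟩
  · rw [contDiff_iff_contDiffAt]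
    intro x
    by_cases hx : x = 0
    · have h0 : (0 : ℝ) ∉ tsupport ψ := fun h0 => lt_irrefl (0 : ℝ) (h.2.2 h0)
      have h1 : ∀ᶠ r in 𝓝 (0 : ℝ), ψ r = 0 := by
        filter_upwards [(isClosed_tsupport ψ).isOpen_compl.mem_nhds h0] with r hr
        exact image_eq_zero_of_notMem_tsupport hr
      obtain ⟨δ, hδ, hδ2⟩ := Metric.eventually_nhds_iff_ball.1 h1
      have hconst : ∀ r ∈ Metric.ball (0 : ℝ) δ,
          -∫ s in Set.Ioi r, ψ s = -∫ s in Set.Ioi 0, ψ s := by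
        intro r hr
        have hle := (convex_ball (0 : ℝ) δ).norm_image_sub_le_of_norm_hasDerivWithin_le
          (f := fun r => -∫ s in Set.Ioi r, ψ s) (C := 0)
          (fun s _ => (hd s).hasDerivWithinAt) (fun s hs => by rw [hδ2 s hs, norm_zero])
          (Metric.mem_ball_self hδ) hr
        rw [zero_mul] at hle
        exact sub_eq_zero.1 (norm_le_zero_iff.1 hle)
      have hev : smoothRadial N ψ =ᶠ[𝓝 x] fun _ => -∫ s in Set.Ioi 0, ψ s := by
        rw [hx]
        filter_upwards [Metric.ball_mem_nhds (0 : EuclideanSpace ℝ (Fin N)) hδ] with y hy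
        exact hconst _ (by simpa using hy)
      exact contDiffAt_const.congr_of_eventuallyEq hev
    · exact hsm.contDiffAt.comp x (contDiffAt_norm ℝ hx)
  · obtain ⟨b, hb⟩ := h.2.1.isCompact.bddAbove
    refine HasCompactSupport.intro (isCompact_closedBall (0 : EuclideanSpace ℝ (Fin N)) b) ?_
    intro x hx
    have hxb : b < ‖x‖ := by simpa using hx
    rw [smoothRadial, neg_eq_zero]
    refine setIntegral_eq_zero_of_forall_eq_zero fun s hs => ?_
    exact image_eq_zero_of_notMem_tsupport fun hs' => absurd (hb hs') (not_le.2 (hxb.trans hs))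

variable [hN : Fact (3 ≤ N)]

theorem IsProfile.smoothRadial_ae_eq {ψ : ℝ → ℝ} :
    smoothRadial N ψ =ᵐ[volume] radialFun N ψ := by
  filter_upwards [ae_ne_zero_euclidean] with x hx
  rw [radialFun, tailIntegral_of_pos _ (norm_pos_iff.2 hx), smoothRadial]

theorem IsProfile.gradient_ae_eq {ψ : ℝ → ℝ} (h : IsProfile ψ) :
    gradient (smoothRadial N ψ) =ᵐ[volume] radialField N ψ := by
  filter_upwards [ae_ne_zero_euclidean] with x hx
  exact (hasGradientAt_comp_norm (h.hasDerivAt ‖x‖) hx).gradient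

/-- Density through the orthogonal complement: if w is orthogonal to all profiles, the fundamental
lemma of the calculus of variations applied to r^{N-1} w on (0, ∞) gives w = 0. -/
theorem exists_profile_eLpNorm_sub_lt {v : ℝ → ℝ} (hv : MemLp v 2 (radialMeasure N))
    {ε : ℝ≥0∞} (hε : ε ≠ 0) :
    ∃ ψ, IsProfile ψ ∧ eLpNorm (fun r => ψ r - v r) 2 (radialMeasure N) < ε := by
  let K : Submodule ℝ (Lp ℝ 2 (radialMeasure N)) :=
    { carrier := {w | ∃ ψ, IsProfile ψ ∧ w =ᵐ[radialMeasure N] ψ}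
      zero_mem' := ⟨0, ⟨contDiff_const, HasCompactSupport.zero, by simp [tsupport]⟩,
        Lp.coeFn_zero _ _ _⟩
      add_mem' := by
        rintro a b ⟨ψ, hψ, ha⟩ ⟨χ, hχ, hb⟩
        refine ⟨ψ + χ, ⟨hψ.1.add hχ.1, hψ.2.1.add hχ.2.1, ?_⟩, (Lp.coeFn_add a b).trans (ha.add hb)⟩
        exact (tsupport_add ψ χ).trans (Set.union_subset hψ.2.2 hχ.2.2)
      smul_mem' := by
        rintro c a ⟨ψ, hψ, ha⟩
        refine ⟨c • ψ, ⟨contDiff_const.smul hψ.1, hψ.2.1.smul_left, ?_⟩,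
          (Lp.coeFn_smul c a).trans (ha.const_smul c)⟩
        exact (closure_mono (Function.support_const_smul_subset c ψ)).trans hψ.2.2 }
  have hbot : Kᗮ = ⊥ := by
    rw [Submodule.eq_bot_iff]
    intro w hw
    have hwL : MemLp w 2 (radialMeasure N) := Lp.memLp w
    have hloc : LocallyIntegrableOn (fun r => r ^ (N - 1) * w r) (Set.Ioi 0) := by
      refine LocallyIntegrableOn.continuousOn_mul ?_ (by fun_prop) isOpen_Ioi.isLocallyClosed
      rw [locallyIntegrableOn_iff isOpen_Ioi.isLocallyClosed]
      intro k hk hkc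
      rcases k.eq_empty_or_nonempty with rfl | hne
      · exact integrableOn_empty
      · obtain ⟨a, ha, hale⟩ := hkc.exists_isMinOn hne continuousOn_id
        have ha0 : 0 < a := hk ha
        exact (integrableOn_Ioi_of_memLp hwL (half_pos ha0)).mono_set fun x hx =>
          (half_lt_self ha0).trans_le (hale hx)
    have hz := isOpen_Ioi.ae_eq_zero_of_integral_contDiff_smul_eq_zero hloc
      (fun ψ h1 h2 h3 => by
        have hψ : IsProfile ψ := ⟨h1, h2, h3⟩
        have hin := (Submodule.mem_orthogonal K w).1 hw ((hψ.memLp 2).toLp ψ)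
          ⟨ψ, hψ, (hψ.memLp 2).coeFn_toLp⟩
        rw [L2.inner_def, integral_congr_ae (g := fun r => ψ r * w r) (by
          filter_upwards [(hψ.memLp (N := N) 2).coeFn_toLp] with r hr
          rw [hr]; simp [mul_comm]), integral_radialMeasure] at hin
        have h4 := (mul_eq_zero.1 hin).resolve_left sphereArea_pos.ne'
        rw [← h4, ← integral_indicator measurableSet_Ioi]
        congr 1
        ext r
        by_cases hr : 0 < r
        · simp [hr]; ring
        · have : ψ r = 0 := image_eq_zero_of_notMem_tsupport fun hm => hr (h3 hm)
          simp [this, Set.indicator])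
    refine (Lp.eq_zero_iff_ae_eq_zero).2 ?_
    refine ae_radialMeasure_iff.2 ((ae_restrict_iff' measurableSet_Ioi).2 ?_)
    filter_upwards [hz] with r hr hr0
    exact (mul_eq_zero.1 (hr hr0)).resolve_left (pow_pos hr0 _).ne'
  have htop : K.topologicalClosure = ⊤ := K.topologicalClosure_eq_top_iff.2 hbot
  have hmem : hv.toLp v ∈ closure (K : Set (Lp ℝ 2 (radialMeasure N))) := by
    rw [← Submodule.topologicalClosure_coe, htop]; trivial
  obtain ⟨w, ⟨ψ, hψ, hw⟩, hlt⟩ := EMetric.mem_closure_iff.1 hmem ε (pos_iff_ne_zero.2 hε)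
  refine ⟨ψ, hψ, ?_⟩
  rw [edist_comm, Lp.edist_def] at hlt
  rwa [eLpNorm_congr_ae (hw.sub hv.coeFn_toLp)] at hlt

theorem exists_profile_seq {v : ℝ → ℝ} (hv : MemLp v 2 (radialMeasure N)) :
    ∃ ψ : ℕ → ℝ → ℝ, (∀ n, IsProfile (ψ n)) ∧
      Tendsto (fun n => eLpNorm (fun r => ψ n r - v r) 2 (radialMeasure N)) atTop (𝓝 0) := by
  choose ψ h1 h2 using fun n : ℕ => exists_profile_eLpNorm_sub_lt hv
    (ε := ((n : ℝ≥0∞) + 1)⁻¹) (by simp)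
  refine ⟨ψ, h1, tendsto_of_tendsto_of_tendsto_of_le_of_le tendsto_const_nhds ?_
    (fun n => zero_le) fun n => (h2 n).le⟩
  have := (tendsto_add_atTop_iff_nat 1).2 ENNReal.tendsto_inv_nat_nhds_zero
  simpa using this

theorem tendsto_eLpNorm_radialFun {ψ : ℕ → ℝ → ℝ} {v : ℝ → ℝ}
    (hψ : ∀ n, MemLp (ψ n) 2 (radialMeasure N)) (hv : MemLp v 2 (radialMeasure N))
    (h : Tendsto (fun n => eLpNorm (fun r => ψ n r - v r) 2 (radialMeasure N)) atTop (𝓝 0)) :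
    Tendsto (fun n => eLpNorm (fun x => radialFun N (ψ n) x - radialFun N v x) (sobolevExp N)
      volume) atTop (𝓝 0) := by
  obtain ⟨C, hC, hS⟩ := exists_eLpNorm_radialFun_le (N := N)
  refine tendsto_of_tendsto_of_tendsto_of_le_of_le tendsto_const_nhds ?_
    (fun n => zero_le) (fun n => ?_) (h := fun n => C * eLpNorm (fun r => ψ n r - v r) 2 (radialMeasure N))
  · simpa using ENNReal.Tendsto.const_mul h (Or.inr hC)
  · rw [← radialFun_sub (hψ n) hv]
    exact hS _ ((hψ n).sub hv)

/-- Profiles converging to v in L² give radial test functions. Their gradients converge because the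
radial field has the same L² norm as its component, and their values converge by the Sobolev
inequality. -/
theorem memD12r_radialFun {v : ℝ → ℝ} (hv : MemLp v 2 (radialMeasure N)) :
    HasWeakGradient (radialFun N v) (radialField N v) ∧ MemD12r (radialFun N v) := by
  obtain ⟨ψ, hψ, hlim⟩ := exists_profile_seq hv
  have hL := memLp_radialFun hv
  have h1 : Tendsto (fun n => eLpNorm (fun x => smoothRadial N (ψ n) x - radialFun N v x)
      (sobolevExp N) volume) atTop (𝓝 0) := by
    refine (tendsto_eLpNorm_radialFun (fun n => (hψ n).memLp 2) hv hlim).congr fun n => ?_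
    refine eLpNorm_congr_ae ?_
    filter_upwards [IsProfile.smoothRadial_ae_eq (N := N) (ψ := ψ n)] with x hx
    rw [hx]
  have h2 : Tendsto (fun n => eLpNorm (fun x => gradient (smoothRadial N (ψ n)) x
      - radialField N v x) 2 volume) atTop (𝓝 0) := by
    refine hlim.congr fun n => ?_
    rw [← eLpNorm_radialField (v := fun r => ψ n r - v r) (((hψ n).memLp 2).sub hv).1]
    refine eLpNorm_congr_ae ?_
    filter_upwards [(hψ n).gradient_ae_eq (N := N)] with x hx
    rw [hx]
    exact congrFun (radialField_sub (ψ n) v) x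
  have hw : HasWeakGradient (radialFun N v) (radialField N v) :=
    hasWeakGradient_of_tendsto one_le_sobolevExp (fun n => (hψ n).isRadialTestFunction.1) hL
      (memLp_radialField hv) h1 h2
  have hae := hw.weakGrad_ae_eq
  refine ⟨hw, hL, ⟨_, hw⟩, (memLp_congr_ae hae).2 (memLp_radialField hv),
    fun n => smoothRadial N (ψ n), fun n => (hψ n).isRadialTestFunction, ?_, h1⟩
  refine h2.congr fun n => eLpNorm_congr_ae ?_
  filter_upwards [hae] with x hx
  rw [hx]

theorem weakGrad_ae_eq_radialField {v : ℝ → ℝ} (hv : MemLp v 2 (radialMeasure N))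
    {u : EuclideanSpace ℝ (Fin N) → ℝ} (hu : u =ᵐ[volume] radialFun N v) :
    weakGrad u =ᵐ[volume] radialField N v :=
  ((memD12r_radialFun hv).1.congr_ae hu.symm (ae_eq_refl _)).weakGrad_ae_eq

theorem memD12r_of_ae_eq {v : ℝ → ℝ} (hv : MemLp v 2 (radialMeasure N))
    {u : EuclideanSpace ℝ (Fin N) → ℝ} (hu : u =ᵐ[volume] radialFun N v) : MemD12r u := by
  obtain ⟨hw, hD⟩ := memD12r_radialFun hv
  have h1 := weakGrad_ae_eq_radialField hv hu
  have h2 := weakGrad_ae_eq_radialField hv (ae_eq_refl (radialFun N v))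
  obtain ⟨hL, -, hL2, φ, hφ, t1, t2⟩ := hD
  refine ⟨(memLp_congr_ae hu).2 hL, ⟨_, hw.congr_ae hu.symm (ae_eq_refl _)⟩,
    (memLp_congr_ae (h1.trans h2.symm)).2 hL2, φ, hφ, t1.congr fun n => eLpNorm_congr_ae ?_,
    t2.congr fun n => eLpNorm_congr_ae ?_⟩
  · filter_upwards [h1, h2] with x hx hx'
    rw [hx, hx']
  · filter_upwards [hu] with x hx
    rw [hx]

/-- A radial test function is the radial function with some continuous compactly supported radial
derivative. -/
theorem IsRadialTestFunction.exists_radial_derivative {φ : EuclideanSpace ℝ (Fin N) → ℝ}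
    (hφ : IsRadialTestFunction φ) :
    ∃ p : ℝ → ℝ, ContDiff ℝ ∞ p ∧ HasCompactSupport p ∧ (∀ x, φ x = p ‖x‖) ∧
      φ =ᵐ[volume] radialFun N (deriv p) ∧ gradient φ =ᵐ[volume] radialField N (deriv p) := by
  obtain ⟨e, he⟩ := exists_norm_eq (EuclideanSpace ℝ (Fin N)) zero_le_one
  have hsm : ContDiff ℝ ∞ fun r : ℝ => φ (r • e) :=
    hφ.1.1.comp (contDiff_id.smul contDiff_const)
  have hval : ∀ x, φ x = φ (‖x‖ • e) := fun x => hφ.2 _ _ (by simp [norm_smul, he])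
  have hd : ∀ r, HasDerivAt (fun r : ℝ => φ (r • e)) (deriv (fun r : ℝ => φ (r • e)) r) r :=
    fun r => (hsm.differentiable (by simp) r).hasDerivAt
  have hcs : HasCompactSupport fun r : ℝ => φ (r • e) := by
    obtain ⟨b, hb⟩ := hφ.1.2.isCompact.isBounded.exists_norm_le
    refine HasCompactSupport.intro (isCompact_closedBall (0 : ℝ) b) fun r hr => ?_
    refine image_eq_zero_of_notMem_tsupport fun hm => hr ?_
    simpa [norm_smul, he] using hb _ hm
  refine ⟨_, hsm, hcs, hval, ?_, ?_⟩
  · filter_upwards [ae_ne_zero_euclidean] with x hx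
    rw [radialFun, tailIntegral_of_pos _ (norm_pos_iff.2 hx)]
    have hint : Integrable (deriv fun r : ℝ => φ (r • e)) :=
      (hsm.continuous_deriv (by simp)).integrable_of_hasCompactSupport hcs.deriv
    have ht : Tendsto (fun r : ℝ => φ (r • e)) atTop (𝓝 0) :=
      hcs.is_zero_at_infty.mono_left atTop_le_cocompact
    rw [integral_Ioi_of_hasDerivAt_of_tendsto (hd _).continuousAt.continuousWithinAt
      (fun r _ => hd r) hint.integrableOn ht, zero_sub, neg_neg]
    exact hval x
  · filter_upwards [ae_ne_zero_euclidean] with x hx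
    have h1 := hasGradientAt_comp_norm (hd ‖x‖) hx
    rw [show φ = fun y => φ (‖y‖ • e) from funext hval, h1.gradient, ← funext hval]
    rfl

/-- The gradients of the approximating test functions lie in the range of an isometry defined on a
complete space. That range is closed, so the limit is again a radial field. The Sobolev inequality
then identifies the limit of the values. -/
theorem MemD12r.exists_eq_radialFun {u : EuclideanSpace ℝ (Fin N) → ℝ} (hu : MemD12r u) :
    ∃ v, MemLp v 2 (radialMeasure N) ∧ u =ᵐ[volume] radialFun N v := by
  obtain ⟨hL, -, hL2, φ, hφ, t1, t2⟩ := hu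
  choose p hp hpc hval hfun hgrad using fun n => (hφ n).exists_radial_derivative
  have hv : ∀ n, MemLp (deriv (p n)) 2 (radialMeasure N) := fun n =>
    ((hp n).continuous_deriv (by simp)).memLp_of_hasCompactSupport (hpc n).deriv
  let J : Lp ℝ 2 (radialMeasure N) → Lp (EuclideanSpace ℝ (Fin N)) 2 volume := fun w =>
    (memLp_radialField (Lp.memLp w)).toLp _
  have hJ : Isometry J := by
    intro a b
    simp only [J]
    rw [Lp.edist_toLp_toLp, Lp.edist_def]
    have h1 : eLpNorm (radialField N fun r => a r - b r) 2 volume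
        = eLpNorm (fun r => a r - b r) 2 (radialMeasure N) :=
      eLpNorm_radialField ((Lp.memLp a).sub (Lp.memLp b)).1 2
    rw [radialField_sub] at h1
    exact h1
  have hcl : IsClosed (Set.range J) := hJ.isClosedEmbedding.isClosed_range
  have hlim : Tendsto (fun n => J ((hv n).toLp _)) atTop (𝓝 (hL2.toLp _)) := by
    have h1 := (Lp.tendsto_Lp_iff_tendsto_eLpNorm'' (fun n => gradient (φ n))
      (fun n => memLp_gradient (hφ n).1 2) (weakGrad u) hL2).2 t1
    refine h1.congr fun n => ?_
    simp only [J]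
    rw [MemLp.toLp_eq_toLp_iff]
    exact (hgrad n).trans (radialField_congr_ae (hv n).coeFn_toLp.symm)
  obtain ⟨w, hw⟩ := hcl.mem_of_tendsto hlim (Eventually.of_forall fun n => ⟨_, rfl⟩)
  rw [← hw] at hlim
  have hlim2 := (Lp.tendsto_Lp_iff_tendsto_eLpNorm' _ _).1 (hJ.isEmbedding.tendsto_nhds_iff.2 hlim)
  have hlim3 : Tendsto (fun n => eLpNorm (fun r => deriv (p n) r - w r) 2 (radialMeasure N))
      atTop (𝓝 0) := by
    refine hlim2.congr fun n => eLpNorm_congr_ae ?_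
    filter_upwards [(hv n).coeFn_toLp] with r hr
    rw [Pi.sub_apply, hr]
  refine ⟨w, Lp.memLp w, ?_⟩
  have hR := memLp_radialFun (Lp.memLp w)
  have t3 := tendsto_eLpNorm_radialFun hv (Lp.memLp w) hlim3
  have : Fact (1 ≤ sobolevExp N) := ⟨one_le_sobolevExp⟩
  have t4 := (Lp.tendsto_Lp_iff_tendsto_eLpNorm'' φ
      (fun n => memLp_testFunction (hφ n).1 _) u hL).2 t2
  have t5 := (Lp.tendsto_Lp_iff_tendsto_eLpNorm'' φ
      (fun n => memLp_testFunction (hφ n).1 _) _ hR).2 (by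
        refine t3.congr fun n => eLpNorm_congr_ae ?_
        filter_upwards [hfun n] with x hx
        rw [Pi.sub_apply, hx])
  exact (MemLp.toLp_eq_toLp_iff hL hR).1 (tendsto_nhds_unique t4 t5)

end QLS

namespace QLS

/-! ### The Hilbert space of radial functions with finite energy -/

/-- Potentials on `(0, ∞)`, extended by zero, with at most an inverse square singularity. -/
class IsPotential (V : ℝ → ℝ) : Prop where
  continuousOn : ContinuousOn V (Set.Ioi 0)
  nonneg : ∀ r, 0 ≤ V r
  eq_zero : ∀ r ≤ 0, V r = 0
  bound : ∃ C > 0, ∀ r ∈ Set.Ioo (0 : ℝ) 1, V r ≤ C / r ^ 2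

theorem IsPotential.measurable (V : ℝ → ℝ) [h : IsPotential V] : Measurable V :=
  measurable_of_continuousOn_Ioi h.continuousOn h.eq_zero

/-- The measure `V dν` for the radial measure `ν`. -/
noncomputable def potentialMeasure (N : ℕ) (V : ℝ → ℝ) : Measure ℝ :=
  (radialMeasure N).withDensity fun r => ENNReal.ofReal (V r)

theorem integrable_potentialMeasure_iff {N : ℕ} {V : ℝ → ℝ} [hV : IsPotential V] {F : ℝ → ℝ} :
    Integrable F (potentialMeasure N V) ↔ Integrable (fun r => V r * F r) (radialMeasure N) := by
  rw [potentialMeasure, integrable_withDensity_iff_integrable_smul'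
    (IsPotential.measurable V).ennreal_ofReal (by simp)]
  simp_rw [ENNReal.toReal_ofReal (hV.nonneg _), smul_eq_mul]

theorem integral_potentialMeasure {N : ℕ} {V : ℝ → ℝ} [hV : IsPotential V] (F : ℝ → ℝ) :
    ∫ r, F r ∂(potentialMeasure N V) = ∫ r, V r * F r ∂(radialMeasure N) := by
  rw [potentialMeasure, integral_withDensity_eq_integral_toReal_smul
    (IsPotential.measurable V).ennreal_ofReal (by simp)]
  simp_rw [ENNReal.toReal_ofReal (hV.nonneg _), smul_eq_mul]

variable {N : ℕ} [hN : Fact (3 ≤ N)] {V : ℝ → ℝ}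

theorem abs_tailIntegral_sub_le {v w : ℝ → ℝ} (hv : MemLp v 2 (radialMeasure N))
    (hw : MemLp w 2 (radialMeasure N)) {r : ℝ} (hr : 0 < r) :
    |tailIntegral v r - tailIntegral w r| ≤ decayConst N *
      (eLpNorm (fun s => v s - w s) 2 (radialMeasure N)).toReal * r ^ (-decay N) := by
  rw [← tailIntegral_sub (fun h => integrableOn_Ioi_of_memLp hv h)
    (fun h => integrableOn_Ioi_of_memLp hw h)]
  exact abs_tailIntegral_le (hv.sub hw) hr

variable (N V) in
/-- Pairs `(v, w)` with `w` the primitive of `v` vanishing at infinity, as a subspace of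
`L²(ν) × L²(V ν)`. -/
noncomputable def radialSubmodule :
    Submodule ℝ (WithLp 2 (Lp ℝ 2 (radialMeasure N) × Lp ℝ 2 (potentialMeasure N V))) where
  carrier := {z | z.snd =ᵐ[potentialMeasure N V] tailIntegral z.fst}
  zero_mem' := by
    have h1 : tailIntegral (0 : Lp ℝ 2 (radialMeasure N)) = 0 := by
      rw [tailIntegral_congr_ae (Lp.coeFn_zero ℝ 2 (radialMeasure N))]
      ext r
      simp [tailIntegral]
    change (0 : Lp ℝ 2 (potentialMeasure N V)) =ᵐ[potentialMeasure N V] tailIntegral (0 : Lp ℝ 2 (radialMeasure N))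
    rw [h1]
    exact Lp.coeFn_zero _ _ _
  add_mem' := by
    intro a b ha hb
    have h1 : tailIntegral (a.fst + b.fst : Lp ℝ 2 (radialMeasure N))
        = tailIntegral a.fst + tailIntegral b.fst := by
      rw [tailIntegral_congr_ae (Lp.coeFn_add a.fst b.fst)]
      ext r
      exact tailIntegral_add (fun h => integrableOn_Ioi_of_memLp (Lp.memLp _) h)
        (fun h => integrableOn_Ioi_of_memLp (Lp.memLp _) h)
    change (a.snd + b.snd : Lp ℝ 2 (potentialMeasure N V)) =ᵐ[potentialMeasure N V]
      tailIntegral (a.fst + b.fst : Lp ℝ 2 (radialMeasure N))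
    rw [h1]
    have ha' : a.snd =ᵐ[potentialMeasure N V] tailIntegral a.fst := ha
    have hb' : b.snd =ᵐ[potentialMeasure N V] tailIntegral b.fst := hb
    exact (Lp.coeFn_add _ _).trans (ha'.add hb')
  smul_mem' := by
    intro c a ha
    have h1 : tailIntegral (c • a.fst : Lp ℝ 2 (radialMeasure N)) = c • tailIntegral a.fst := by
      rw [tailIntegral_congr_ae (Lp.coeFn_smul c a.fst)]
      ext r
      exact tailIntegral_const_mul c _ r
    change (c • a.snd : Lp ℝ 2 (potentialMeasure N V)) =ᵐ[potentialMeasure N V]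
      tailIntegral (c • a.fst : Lp ℝ 2 (radialMeasure N))
    rw [h1]
    have ha' : a.snd =ᵐ[potentialMeasure N V] tailIntegral a.fst := ha
    exact (Lp.coeFn_smul _ _).trans (ha'.const_smul c)

theorem eLpNorm_two_toReal_eq_norm_sub {α : Type*} [MeasurableSpace α] {μ : Measure α}
    (a b : Lp ℝ 2 μ) : (eLpNorm (fun s => a s - b s) 2 μ).toReal = ‖a - b‖ := by
  rw [Lp.norm_def]
  congr 1
  exact eLpNorm_congr_ae (Lp.coeFn_sub a b).symm

theorem tendsto_tailIntegral_of_tendsto {f : ℕ → Lp ℝ 2 (radialMeasure N)}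
    {g : Lp ℝ 2 (radialMeasure N)} (h : Tendsto f atTop (𝓝 g)) (r : ℝ) :
    Tendsto (fun n => tailIntegral (f n) r) atTop (𝓝 (tailIntegral g r)) := by
  by_cases hr : 0 < r
  · rw [tendsto_iff_dist_tendsto_zero]
    refine squeeze_zero (fun n => dist_nonneg) (fun n =>
      abs_tailIntegral_sub_le (Lp.memLp (f n)) (Lp.memLp g) hr) ?_
    simp_rw [eLpNorm_two_toReal_eq_norm_sub]
    have := ((tendsto_iff_norm_sub_tendsto_zero.1 h).const_mul (decayConst N)).mul_const
      (r ^ (-decay N))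
    simpa using this
  · simp [tailIntegral, hr]

/-- Convergence of the derivatives in L² gives convergence of the primitives at every point, while
convergence in L²(V ν) gives it almost everywhere along a subsequence. The two limits must agree. -/
theorem isClosed_radialSubmodule : IsClosed (radialSubmodule N V :
    Set (WithLp 2 (Lp ℝ 2 (radialMeasure N) × Lp ℝ 2 (potentialMeasure N V)))) := by
  refine IsSeqClosed.isClosed fun z z₀ hz hlim => ?_
  have h1 : Tendsto (fun n => (z n).fst) atTop (𝓝 z₀.fst) :=
    ((WithLp.prod_continuous_ofLp 2 _ _).fst.tendsto z₀).comp hlim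
  have h2 : Tendsto (fun n => (z n).snd) atTop (𝓝 z₀.snd) :=
    ((WithLp.prod_continuous_ofLp 2 _ _).snd.tendsto z₀).comp hlim
  have h3 := tendstoInMeasure_of_tendsto_Lp h2
  obtain ⟨ns, hns, hae⟩ := h3.exists_seq_tendsto_ae
  have hall : ∀ᵐ r ∂(potentialMeasure N V), ∀ n, (z n).snd r = tailIntegral (z n).fst r :=
    ae_all_iff.2 fun n => hz n
  change z₀.snd =ᵐ[potentialMeasure N V] tailIntegral z₀.fst
  filter_upwards [hae, hall] with r hr1 hr2
  have h4 := (tendsto_tailIntegral_of_tendsto h1 r).comp hns.tendsto_atTop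
  refine tendsto_nhds_unique hr1 (h4.congr fun n => ?_)
  exact (hr2 (ns n)).symm

variable (N V) in
/-- The Hilbert space of radial functions with finite energy. -/
def RadialSpace : Type := radialSubmodule N V

noncomputable instance normedAddCommGroup_radialSpace : NormedAddCommGroup (RadialSpace N V) :=
  inferInstanceAs (NormedAddCommGroup (radialSubmodule N V))

noncomputable instance innerProductSpace_radialSpace : InnerProductSpace ℝ (RadialSpace N V) :=
  inferInstanceAs (InnerProductSpace ℝ (radialSubmodule N V))

instance completeSpace_radialSpace : CompleteSpace (RadialSpace N V) :=
  isClosed_radialSubmodule.completeSpace_coe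

/-- The radial derivative. -/
noncomputable def RadialSpace.deriv (u : RadialSpace N V) : ℝ → ℝ := (u.1.fst : Lp ℝ 2 (radialMeasure N))

/-- The radial profile of an element of `RadialSpace N V`. -/
noncomputable def RadialSpace.eval (u : RadialSpace N V) : ℝ → ℝ := tailIntegral u.deriv

namespace RadialSpace

theorem memLp_deriv (u : RadialSpace N V) : MemLp u.deriv 2 (radialMeasure N) := Lp.memLp _

theorem measurable_eval (u : RadialSpace N V) : Measurable u.eval :=
  measurable_tailIntegral u.memLp_deriv

theorem continuousOn_eval (u : RadialSpace N V) : ContinuousOn u.eval (Set.Ioi 0) :=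
  continuousOn_tailIntegral u.memLp_deriv

theorem snd_ae_eq (u : RadialSpace N V) : u.1.snd =ᵐ[potentialMeasure N V] u.eval := u.2

theorem memLp_eval (u : RadialSpace N V) : MemLp u.eval 2 (potentialMeasure N V) :=
  (memLp_congr_ae u.snd_ae_eq).1 (Lp.memLp _)

theorem deriv_add (u w : RadialSpace N V) :
    (u + w).deriv =ᵐ[radialMeasure N] fun r => u.deriv r + w.deriv r := Lp.coeFn_add _ _

theorem deriv_sub (u w : RadialSpace N V) :
    (u - w).deriv =ᵐ[radialMeasure N] fun r => u.deriv r - w.deriv r := Lp.coeFn_sub _ _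

theorem deriv_smul (c : ℝ) (u : RadialSpace N V) :
    (c • u).deriv =ᵐ[radialMeasure N] fun r => c * u.deriv r := Lp.coeFn_smul _ _

theorem eval_add (u w : RadialSpace N V) (r : ℝ) : (u + w).eval r = u.eval r + w.eval r := by
  unfold eval
  rw [tailIntegral_congr_ae (deriv_add u w)]
  exact tailIntegral_add (fun h => integrableOn_Ioi_of_memLp u.memLp_deriv h)
    (fun h => integrableOn_Ioi_of_memLp w.memLp_deriv h)

theorem eval_sub (u w : RadialSpace N V) (r : ℝ) : (u - w).eval r = u.eval r - w.eval r := by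
  unfold eval
  rw [tailIntegral_congr_ae (deriv_sub u w)]
  exact tailIntegral_sub (fun h => integrableOn_Ioi_of_memLp u.memLp_deriv h)
    (fun h => integrableOn_Ioi_of_memLp w.memLp_deriv h)

theorem eval_smul (c : ℝ) (u : RadialSpace N V) (r : ℝ) : (c • u).eval r = c * u.eval r := by
  unfold eval
  rw [tailIntegral_congr_ae (deriv_smul c u)]
  exact tailIntegral_const_mul c _ r

theorem eval_zero (r : ℝ) : (0 : RadialSpace N V).eval r = 0 := by
  have := eval_smul 0 (0 : RadialSpace N V) r
  simpa using this

theorem integrable_deriv_mul (u w : RadialSpace N V) :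
    Integrable (fun r => u.deriv r * w.deriv r) (radialMeasure N) :=
  u.memLp_deriv.integrable_mul w.memLp_deriv

theorem integrable_deriv_sq (u : RadialSpace N V) :
    Integrable (fun r => u.deriv r ^ 2) (radialMeasure N) := u.memLp_deriv.integrable_sq

theorem integrable_eval_sq [IsPotential V] (u : RadialSpace N V) :
    Integrable (fun r => V r * u.eval r ^ 2) (radialMeasure N) :=
  integrable_potentialMeasure_iff.1 u.memLp_eval.integrable_sq

theorem inner_eq [IsPotential V] (u w : RadialSpace N V) :
    inner ℝ u w = ∫ r, u.deriv r * w.deriv r ∂(radialMeasure N)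
      + ∫ r, V r * (u.eval r * w.eval r) ∂(radialMeasure N) := by
  have h0 : inner ℝ u w = inner ℝ (u.1.fst : Lp ℝ 2 (radialMeasure N)) w.1.fst
    + inner ℝ (u.1.snd : Lp ℝ 2 (potentialMeasure N V)) w.1.snd := WithLp.prod_inner_apply u.1 w.1
  rw [h0, L2.inner_def, L2.inner_def,
    ← integral_potentialMeasure (V := V) fun r => u.eval r * w.eval r]
  congr 1
  · refine integral_congr_ae (Eventually.of_forall fun r => ?_)
    simp [RadialSpace.deriv, mul_comm]
  · refine integral_congr_ae ?_
    filter_upwards [u.snd_ae_eq, w.snd_ae_eq] with r h1 h2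
    change inner ℝ (u.1.snd r) (w.1.snd r) = _
    rw [h1, h2]
    simp [mul_comm]

theorem norm_sq_eq [IsPotential V] (u : RadialSpace N V) :
    ‖u‖ ^ 2 = ∫ r, u.deriv r ^ 2 ∂(radialMeasure N)
      + ∫ r, V r * u.eval r ^ 2 ∂(radialMeasure N) := by
  rw [← real_inner_self_eq_norm_sq, inner_eq]
  simp_rw [← sq]

/-- The Dirichlet integral. -/
noncomputable def dirichlet (u : RadialSpace N V) : ℝ := ∫ r, u.deriv r ^ 2 ∂(radialMeasure N)

theorem dirichlet_nonneg (u : RadialSpace N V) : 0 ≤ u.dirichlet :=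
  integral_nonneg fun _ => sq_nonneg _

theorem eLpNorm_deriv (u : RadialSpace N V) :
    (eLpNorm u.deriv 2 (radialMeasure N)).toReal = √u.dirichlet := by
  rw [eq_comm, Real.sqrt_eq_iff_eq_sq u.dirichlet_nonneg ENNReal.toReal_nonneg, ← ENNReal.toReal_pow,
    eLpNorm_two_sq, dirichlet, integral_eq_lintegral_of_nonneg_ae
    (Eventually.of_forall fun _ => sq_nonneg _) (u.memLp_deriv.1.pow 2)]
  congr 1
  refine lintegral_congr fun r => ?_
  rw [← sq_abs, ENNReal.ofReal_pow (abs_nonneg _), ← Real.enorm_eq_ofReal_abs]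

theorem dirichlet_le [hV : IsPotential V] (u : RadialSpace N V) : u.dirichlet ≤ ‖u‖ ^ 2 := by
  rw [norm_sq_eq]
  exact le_add_of_nonneg_right (integral_nonneg fun r => mul_nonneg (hV.nonneg r) (sq_nonneg _))

theorem abs_eval_le_dirichlet (u : RadialSpace N V) {r : ℝ} (hr : 0 < r) :
    |u.eval r| ≤ decayConst N * √u.dirichlet * r ^ (-decay N) := by
  rw [← eLpNorm_deriv]
  exact abs_tailIntegral_le u.memLp_deriv hr

theorem abs_eval_le [IsPotential V] (u : RadialSpace N V) {r : ℝ} (hr : 0 < r) :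
    |u.eval r| ≤ decayConst N * ‖u‖ * r ^ (-decay N) := by
  refine (u.abs_eval_le_dirichlet hr).trans ?_
  have : √u.dirichlet ≤ ‖u‖ := Real.sqrt_le_iff.2 ⟨norm_nonneg _, u.dirichlet_le⟩
  have := decayConst_nonneg (N := N)
  gcongr

end RadialSpace

/-- Hardy's inequality for the potential on the unit ball. -/
theorem exists_hardy (N : ℕ) [Fact (3 ≤ N)] (V : ℝ → ℝ) [hV : IsPotential V] :
    ∃ C > 0, ∀ v : ℝ → ℝ, MemLp v 2 (radialMeasure N) →
      IntegrableOn (fun r => V r * tailIntegral v r ^ 2) (Set.Iio 1) (radialMeasure N) ∧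
      ∫ r in Set.Iio 1, V r * tailIntegral v r ^ 2 ∂(radialMeasure N)
        ≤ C * ((eLpNorm v 2 (radialMeasure N)).toReal) ^ 2 := by
  obtain ⟨C, hC, hb⟩ := hV.bound
  refine ⟨C * 4, by positivity, fun v hv => ?_⟩
  have hmV := IsPotential.measurable V
  have hm := measurable_tailIntegral hv
  have hle : ∫⁻ r in Set.Iio 1, ENNReal.ofReal (V r * tailIntegral v r ^ 2) ∂(radialMeasure N)
      ≤ ENNReal.ofReal C * (4 * eLpNorm v 2 (radialMeasure N) ^ 2) := by
    calc _ ≤ ∫⁻ r in Set.Iio 1, ENNReal.ofReal C *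
          (ENNReal.ofReal (r ^ (-2 : ℝ)) * ‖tailIntegral v r‖ₑ ^ 2) ∂(radialMeasure N) := by
          refine lintegral_mono_ae ?_
          filter_upwards [ae_restrict_mem measurableSet_Iio,
            ae_restrict_of_ae ae_radialMeasure_pos] with r h1 h0
          rw [Real.enorm_eq_ofReal_abs, ← ENNReal.ofReal_pow (abs_nonneg _), sq_abs,
            ← ENNReal.ofReal_mul (by positivity), ← ENNReal.ofReal_mul hC.le]
          refine ENNReal.ofReal_le_ofReal ?_
          rw [← mul_assoc]
          refine mul_le_mul_of_nonneg_right ((hb r ⟨h0, h1⟩).trans (le_of_eq ?_)) (sq_nonneg _)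
          rw [Real.rpow_neg h0.le, div_eq_mul_inv]
          norm_cast
      _ ≤ ∫⁻ r, ENNReal.ofReal C *
          (ENNReal.ofReal (r ^ (-2 : ℝ)) * ‖tailIntegral v r‖ₑ ^ 2) ∂(radialMeasure N) :=
          setLIntegral_le_lintegral _ _
      _ ≤ _ := by
          rw [lintegral_const_mul _ (by fun_prop)]
          gcongr
          exact lintegral_hardy hv
  have htop : ENNReal.ofReal C * (4 * eLpNorm v 2 (radialMeasure N) ^ 2) ≠ ⊤ :=
    ENNReal.mul_ne_top ENNReal.ofReal_ne_top (ENNReal.mul_ne_top (by norm_num)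
      (ENNReal.pow_ne_top hv.2.ne))
  have hnn : ∀ r, 0 ≤ V r * tailIntegral v r ^ 2 := fun r => mul_nonneg (hV.nonneg r) (sq_nonneg _)
  have hmeas : Measurable fun r => V r * tailIntegral v r ^ 2 := by fun_prop
  refine ⟨⟨hmeas.aestronglyMeasurable, ?_⟩, ?_⟩
  · rw [hasFiniteIntegral_iff_ofReal (Eventually.of_forall hnn)]
    exact hle.trans_lt htop.lt_top
  · rw [integral_eq_lintegral_of_nonneg_ae (Eventually.of_forall hnn) hmeas.aestronglyMeasurable]
    refine (ENNReal.toReal_mono htop hle).trans (le_of_eq ?_)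
    simp [ENNReal.toReal_ofReal hC.le]
    ring

theorem RadialSpace.exists_deriv_ae_eq [IsPotential V] {v : ℝ → ℝ}
    (hv : MemLp v 2 (radialMeasure N))
    (hi : Integrable (fun r => V r * tailIntegral v r ^ 2) (radialMeasure N)) :
    ∃ u : RadialSpace N V, u.deriv =ᵐ[radialMeasure N] v ∧ u.eval = tailIntegral v := by
  have hL : MemLp (tailIntegral v) 2 (potentialMeasure N V) :=
    (memLp_two_iff_integrable_sq (measurable_tailIntegral hv).aestronglyMeasurable).2
      (integrable_potentialMeasure_iff.2 hi)
  have hfst : tailIntegral (hv.toLp v) = tailIntegral v := tailIntegral_congr_ae hv.coeFn_toLp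
  let z : WithLp 2 (Lp ℝ 2 (radialMeasure N) × Lp ℝ 2 (potentialMeasure N V)) :=
    WithLp.toLp 2 (hv.toLp v, hL.toLp (tailIntegral v))
  have hz : z ∈ radialSubmodule N V := by
    change hL.toLp (tailIntegral v) =ᵐ[potentialMeasure N V] tailIntegral (hv.toLp v)
    rw [hfst]
    exact hL.coeFn_toLp
  exact ⟨⟨z, hz⟩, hv.coeFn_toLp, hfst⟩

end QLS

namespace QLS

/-! ### The energy functional on the Hilbert space of radial functions -/

/-- Dominated convergence where the domination holds up to small multiples of a sequence with
bounded integrals. -/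
theorem tendsto_integral_zero_of_almost_dominated {α : Type*} [MeasurableSpace α] {μ : Measure α}
    {D W : ℕ → α → ℝ} {C : ℝ} (hD : ∀ n, AEStronglyMeasurable (D n) μ)
    (hD0 : ∀ n, ∀ᵐ x ∂μ, 0 ≤ D n x) (hlim : ∀ᵐ x ∂μ, Tendsto (fun n => D n x) atTop (𝓝 0))
    (hW : ∀ n, Integrable (W n) μ) (hW0 : ∀ n x, 0 ≤ W n x) (hWC : ∀ n, ∫ x, W n x ∂μ ≤ C)
    (hdom : ∀ ε > 0, ∃ ρ : α → ℝ, Integrable ρ μ ∧ ∀ n, ∀ᵐ x ∂μ, D n x ≤ ρ x + ε * W n x) :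
    (∀ n, Integrable (D n) μ) ∧ Tendsto (fun n => ∫ x, D n x ∂μ) atTop (𝓝 0) := by
  have hint : ∀ n, Integrable (D n) μ := by
    intro n
    obtain ⟨ρ, hρ, h⟩ := hdom 1 one_pos
    refine (hρ.add ((hW n).const_mul 1)).mono' (hD n) ?_
    filter_upwards [h n, hD0 n] with x h1 h2
    rw [Real.norm_of_nonneg h2]
    exact h1
  refine ⟨hint, ?_⟩
  rw [Metric.tendsto_atTop]
  intro η hη
  obtain ⟨ρ, hρ, h⟩ := hdom (η / (2 * (|C| + 1))) (by positivity)
  -- Truncation at the integrable bound: min(D, |ρ|) is genuinely dominated, and the excess of D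
  -- over it is at most the small multiple of W.
  have hmin : Tendsto (fun n => ∫ x, min (D n x) |ρ x| ∂μ) atTop (𝓝 (∫ _, (0 : ℝ) ∂μ)) := by
    refine tendsto_integral_of_dominated_convergence (fun x => |ρ x|)
      (fun n => ((hint n).inf hρ.abs).1) hρ.abs (fun n => ?_) ?_
    · filter_upwards [hD0 n] with x hx
      rw [Real.norm_of_nonneg (le_min hx (abs_nonneg _))]
      exact min_le_right _ _
    · filter_upwards [hlim] with x hx
      have := hx.min (tendsto_const_nhds (x := |ρ x|))
      rwa [min_eq_left (abs_nonneg _)] at this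
  rw [integral_zero] at hmin
  obtain ⟨n₀, hn₀⟩ := Metric.tendsto_atTop.1 hmin (η / 2) (by positivity)
  refine ⟨n₀, fun n hn => ?_⟩
  have h1 := hn₀ n hn
  rw [Real.dist_eq, sub_zero] at h1 ⊢
  have h2 : ∫ x, D n x ∂μ ≤ ∫ x, min (D n x) |ρ x| ∂μ
      + η / (2 * (|C| + 1)) * ∫ x, W n x ∂μ := by
    have hi : Integrable (fun x => min (D n x) |ρ x|) μ := (hint n).inf hρ.abs
    rw [← integral_const_mul, ← integral_add hi ((hW n).const_mul _)]
    refine integral_mono_ae (hint n) (hi.add ((hW n).const_mul _)) ?_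
    filter_upwards [h n] with x hx
    have h5 : 0 ≤ η / (2 * (|C| + 1)) * W n x := mul_nonneg (by positivity) (hW0 n x)
    rcases le_total (D n x) |ρ x| with h6 | h6
    · simp only [min_eq_left h6]; linarith
    · simp only [min_eq_right h6]; linarith [le_abs_self (ρ x)]
  have h3 : 0 ≤ ∫ x, D n x ∂μ := integral_nonneg_of_ae (hD0 n)
  rw [abs_of_nonneg h3]
  have h4 : η / (2 * (|C| + 1)) * ∫ x, W n x ∂μ ≤ η / 2 := by
    have : ∫ x, W n x ∂μ ≤ |C| + 1 := (hWC n).trans ((le_abs_self C).trans (by linarith))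
    calc _ ≤ η / (2 * (|C| + 1)) * (|C| + 1) := by gcongr
      _ = η / 2 := by field_simp
  linarith [(abs_lt.1 h1).2]

/-- Nonlinearities `K(r) γ(t)` of subcritical type, with `Γ` a primitive of `γ` that satisfies the
Ambrosetti-Rabinowitz condition with exponent `θ`. -/
structure IsNonlinearity (N : ℕ) (V K γ Γ : ℝ → ℝ) (θ : ℝ) : Prop where
  measurable : Measurable K
  nonneg : ∀ r, 0 ≤ K r
  continuous : Continuous γ
  hasDerivAt : ∀ t, HasDerivAt Γ (γ t) t
  two_lt : 2 < θ
  primitive_nonneg : ∀ t, 0 ≤ θ * Γ t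
  superquadratic : ∀ t, θ * Γ t ≤ γ t * t
  -- Here b is the size of the test function and a majorises |t|. Keeping t and a apart allows γ to
  -- be evaluated at the intermediate points of the mean value theorem. The bounds M r^{-κ} are
  -- those satisfied by bounded sets of radial functions.
  dominated : ∀ M > 0, ∀ ε > 0, ∃ ρ : ℝ → ℝ, Integrable ρ (radialMeasure N) ∧
    ∀ r > 0, ∀ t a b : ℝ, |t| ≤ a → a ≤ M * r ^ (-decay N) → 0 ≤ b → b ≤ M * r ^ (-decay N) →
      K r * |γ t| * b ≤ ρ r + ε * (V r * (a + b) ^ 2)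

variable {N : ℕ} [hN : Fact (3 ≤ N)] {V K γ Γ : ℝ → ℝ} {θ : ℝ} [hV : IsPotential V]

open RadialSpace

theorem RadialSpace.integral_eval_sq_le (u : RadialSpace N V) :
    ∫ r, V r * u.eval r ^ 2 ∂(radialMeasure N) ≤ ‖u‖ ^ 2 := by
  rw [norm_sq_eq]
  exact le_add_of_nonneg_left u.dirichlet_nonneg

theorem RadialSpace.tendsto_eval {u : ℕ → RadialSpace N V} {w : RadialSpace N V}
    (h : Tendsto u atTop (𝓝 w)) (r : ℝ) :
    Tendsto (fun n => (u n).eval r) atTop (𝓝 (w.eval r)) := by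
  by_cases hr : 0 < r
  · rw [tendsto_iff_dist_tendsto_zero]
    have h1 := ((tendsto_iff_norm_sub_tendsto_zero.1 h).const_mul (decayConst N)).mul_const
      (r ^ (-decay N))
    rw [mul_zero, zero_mul] at h1
    refine squeeze_zero (fun n => dist_nonneg) (fun n => ?_) h1
    rw [Real.dist_eq, ← eval_sub]
    exact (u n - w).abs_eval_le hr
  · simp [eval, tailIntegral, hr]

theorem sq_sum_le_two (a b : ℝ) : (|a| + |b|) ^ 2 ≤ 2 * a ^ 2 + 2 * b ^ 2 := by
  nlinarith [sq_nonneg (|a| - |b|), sq_abs a, sq_abs b]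

/-- Evaluation at a point is continuous by the decay estimate, so Riesz represents it. Weak
convergence of derivatives thus implies pointwise convergence of profiles. -/
theorem exists_tailIntegral_eq_inner (r : ℝ) : ∃ y : Lp ℝ 2 (radialMeasure N),
    ∀ x : Lp ℝ 2 (radialMeasure N), tailIntegral x r = inner ℝ x y := by
  let L : Lp ℝ 2 (radialMeasure N) →ₗ[ℝ] ℝ :=
    { toFun := fun x => tailIntegral x r
      map_add' := fun x y => by
        rw [tailIntegral_congr_ae (Lp.coeFn_add x y)]
        exact tailIntegral_add (fun h => integrableOn_Ioi_of_memLp (Lp.memLp _) h)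
          (fun h => integrableOn_Ioi_of_memLp (Lp.memLp _) h)
      map_smul' := fun c x => by
        rw [tailIntegral_congr_ae (Lp.coeFn_smul c x)]
        exact tailIntegral_const_mul c _ r }
  have hL : ∃ C, ∀ x, ‖L x‖ ≤ C * ‖x‖ := by
    by_cases hr : 0 < r
    · refine ⟨decayConst N * r ^ (-decay N), fun x => ?_⟩
      have := abs_tailIntegral_le (Lp.memLp x) hr
      rw [Real.norm_eq_abs, Lp.norm_def]
      change |tailIntegral x r| ≤ _
      linarith
    · exact ⟨0, fun x => by simp [L, tailIntegral, hr]⟩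
  refine ⟨(InnerProductSpace.toDual ℝ _).symm (L.mkContinuousOfExistsBound hL), fun x => ?_⟩
  rw [real_inner_comm, InnerProductSpace.toDual_symm_apply]
  rfl

/-- Bounded sequences have pointwise convergent subsequences. -/
theorem RadialSpace.exists_subseq_tendsto_eval {M : ℝ} {u : ℕ → RadialSpace N V}
    (hu : ∀ n, ‖u n‖ ≤ M) : ∃ (φ : ℕ → ℕ) (U : ℝ → ℝ), StrictMono φ ∧
      ∀ r, Tendsto (fun n => (u (φ n)).eval r) atTop (𝓝 (U r)) := by
  let x : ℕ → Lp ℝ 2 (radialMeasure N) := fun n => (u n).1.fst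
  have hx : ∀ n, ‖x n‖ ≤ M := by
    intro n
    refine le_trans ?_ (hu n)
    rw [Lp.norm_def]
    exact (u n).eLpNorm_deriv.le.trans (Real.sqrt_le_iff.2 ⟨norm_nonneg _, (u n).dirichlet_le⟩)
  have : Fact ((2 : ℝ≥0∞) ≠ ⊤) := ⟨by norm_num⟩
  have : SecondCountableTopology (Lp ℝ 2 (radialMeasure N)) := Lp.SecondCountableTopology
  obtain ⟨f, -, φ, hφ, hf⟩ := WeakDual.isSeqCompact_closedBall ℝ (Lp ℝ 2 (radialMeasure N)) 0 M
    (x := fun n => StrongDual.toWeakDual (InnerProductSpace.toDual ℝ _ (x n))) (fun n => by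
      simpa using hx n)
  choose y hy using fun r => exists_tailIntegral_eq_inner (N := N) r
  refine ⟨φ, fun r => f (y r), hφ, fun r => ?_⟩
  have h1 := ((WeakDual.eval_continuous (y r)).tendsto f).comp hf
  refine h1.congr fun n => ?_
  exact (hy r (x (φ n))).symm

/-! ### The gradient of the superlinear term and its compactness -/

namespace IsNonlinearity

theorem exists_bound (hK : IsNonlinearity N V K γ Γ θ) (M : ℝ) {ε : ℝ} (hε : 0 < ε) :
    ∃ ρ : ℝ → ℝ, Integrable ρ (radialMeasure N) ∧
      ∀ u h : RadialSpace N V, ‖u‖ ≤ M → ‖h‖ ≤ M → ∀ r > 0, K r * |γ (u.eval r)| * |h.eval r|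
        ≤ ρ r + ε * (V r * (|u.eval r| + |h.eval r|) ^ 2) := by
  have hc := decayConst_nonneg (N := N)
  obtain ⟨ρ, hρ, hb⟩ := hK.dominated (decayConst N * |M| + 1) (by positivity) ε hε
  have hle : ∀ u : RadialSpace N V, ‖u‖ ≤ M → ∀ r > 0,
      |u.eval r| ≤ (decayConst N * |M| + 1) * r ^ (-decay N) := by
    intro u hu r hr
    refine (u.abs_eval_le hr).trans ?_
    have h1 : 0 < r ^ (-decay N) := Real.rpow_pos_of_pos hr _
    have h2 : ‖u‖ ≤ |M| := hu.trans (le_abs_self M)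
    gcongr
    nlinarith
  exact ⟨ρ, hρ, fun u h hu hh r hr => hb r hr _ _ _ le_rfl (hle u hu r hr) (abs_nonneg _)
    (hle h hh r hr)⟩

theorem integrable_mul (hK : IsNonlinearity N V K γ Γ θ) (u h : RadialSpace N V) :
    Integrable (fun r => K r * (γ (u.eval r) * h.eval r)) (radialMeasure N) := by
  obtain ⟨ρ, hρ, hb⟩ := hK.exists_bound (max ‖u‖ ‖h‖) one_pos
  have hi : Integrable (fun r => ρ r + 2 * (V r * u.eval r ^ 2) + 2 * (V r * h.eval r ^ 2))
      (radialMeasure N) := (hρ.add (u.integrable_eval_sq.const_mul 2)).add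
        (h.integrable_eval_sq.const_mul 2)
  refine hi.mono' ?_ ?_
  · exact (hK.measurable.mul ((hK.continuous.measurable.comp u.measurable_eval).mul
      h.measurable_eval)).aestronglyMeasurable
  · filter_upwards [ae_radialMeasure_pos] with r hr
    have h1 := hb u h (le_max_left _ _) (le_max_right _ _) r hr
    rw [Real.norm_eq_abs, abs_mul, abs_mul, abs_of_nonneg (hK.nonneg r), ← mul_assoc]
    have h2 := mul_le_mul_of_nonneg_left (sq_sum_le_two (u.eval r) (h.eval r)) (hV.nonneg r)
    linarith

/-- The derivative of the superlinear part of the energy. -/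
noncomputable def form (hK : IsNonlinearity N V K γ Γ θ) (u : RadialSpace N V) :
    RadialSpace N V →ₗ[ℝ] ℝ where
  toFun h := ∫ r, K r * (γ (u.eval r) * h.eval r) ∂(radialMeasure N)
  map_add' h k := by
    rw [← integral_add (hK.integrable_mul u h) (hK.integrable_mul u k)]
    simp_rw [eval_add, mul_add]
  map_smul' c h := by
    simp_rw [eval_smul, RingHom.id_apply, smul_eq_mul, ← integral_const_mul]
    congr 1
    ext r
    ring

theorem exists_form_le (hK : IsNonlinearity N V K γ Γ θ) (M : ℝ) :
    ∃ C, ∀ u h : RadialSpace N V, ‖u‖ ≤ M → ‖h‖ ≤ M →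
      ∫ r, K r * |γ (u.eval r)| * |h.eval r| ∂(radialMeasure N) ≤ C := by
  obtain ⟨ρ, hρ, hb⟩ := hK.exists_bound M one_pos
  refine ⟨∫ r, ρ r ∂(radialMeasure N) + 2 * M ^ 2 + 2 * M ^ 2, fun u h hu hh => ?_⟩
  have hle : ∀ u : RadialSpace N V, ‖u‖ ≤ M →
      ∫ r, V r * u.eval r ^ 2 ∂(radialMeasure N) ≤ M ^ 2 := fun u hu =>
    u.integral_eval_sq_le.trans (pow_le_pow_left₀ (norm_nonneg _) hu 2)
  have hi : Integrable (fun r => ρ r + 2 * (V r * u.eval r ^ 2) + 2 * (V r * h.eval r ^ 2))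
      (radialMeasure N) := (hρ.add (u.integrable_eval_sq.const_mul 2)).add
        (h.integrable_eval_sq.const_mul 2)
  have hi2 := (hK.integrable_mul u h).abs
  calc _ ≤ ∫ r, ρ r + 2 * (V r * u.eval r ^ 2) + 2 * (V r * h.eval r ^ 2) ∂(radialMeasure N) := by
        refine integral_mono_of_nonneg ?_ hi ?_
        · exact Eventually.of_forall fun r => mul_nonneg (mul_nonneg (hK.nonneg r) (abs_nonneg _))
            (abs_nonneg _)
        · filter_upwards [ae_radialMeasure_pos] with r hr
          have h1 := hb u h hu hh r hr
          have h2 := mul_le_mul_of_nonneg_left (sq_sum_le_two (u.eval r) (h.eval r)) (hV.nonneg r)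
          linarith
    _ ≤ _ := by
        have hi1 : Integrable (fun r => ρ r + 2 * (V r * u.eval r ^ 2)) (radialMeasure N) :=
          hρ.add (u.integrable_eval_sq.const_mul 2)
        rw [integral_add hi1 (h.integrable_eval_sq.const_mul 2),
          integral_add hρ (u.integrable_eval_sq.const_mul 2), integral_const_mul, integral_const_mul]
        linarith [hle u hu, hle h hh]

theorem abs_form_le (hK : IsNonlinearity N V K γ Γ θ) (u h : RadialSpace N V) :
    |hK.form u h| ≤ ∫ r, K r * |γ (u.eval r)| * |h.eval r| ∂(radialMeasure N) := by
  refine (abs_integral_le_integral_abs).trans (le_of_eq ?_)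
  congr 1
  ext r
  rw [abs_mul, abs_mul, abs_of_nonneg (hK.nonneg r), ← mul_assoc]

theorem exists_form_bound (hK : IsNonlinearity N V K γ Γ θ) (u : RadialSpace N V) :
    ∃ C, ∀ h, ‖hK.form u h‖ ≤ C * ‖h‖ := by
  obtain ⟨C, hC⟩ := hK.exists_form_le (max ‖u‖ 1) (V := V)
  refine ⟨C, fun h => ?_⟩
  by_cases hh : h = 0
  · simp [hh]
  · have hpos : 0 < ‖h‖ := norm_pos_iff.2 hh
    have h1 := (hK.abs_form_le u (‖h‖⁻¹ • h)).trans (hC u _ (le_max_left _ _) (by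
      rw [norm_smul, norm_inv, norm_norm, inv_mul_cancel₀ hpos.ne']; exact le_max_right _ _))
    rw [map_smul, smul_eq_mul, abs_mul, abs_inv, abs_norm, inv_mul_le_iff₀ hpos] at h1
    rw [Real.norm_eq_abs]
    linarith

/-- The gradient of the superlinear part of the energy. -/
noncomputable def grad (hK : IsNonlinearity N V K γ Γ θ) (u : RadialSpace N V) : RadialSpace N V :=
  (InnerProductSpace.toDual ℝ (RadialSpace N V)).symm
    ((hK.form u).mkContinuousOfExistsBound (hK.exists_form_bound u))

theorem inner_grad (hK : IsNonlinearity N V K γ Γ θ) (u h : RadialSpace N V) :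
    inner ℝ (hK.grad u) h = ∫ r, K r * (γ (u.eval r) * h.eval r) ∂(radialMeasure N) := by
  rw [grad, InnerProductSpace.toDual_symm_apply]
  rfl

/-- Both continuity and compactness of the gradient come from this. Only pointwise convergence to a
common limit is needed, since the domination of K |γ(u)| |h| is uniform over bounded sets of u and
h. -/
theorem tendsto_grad_sub (hK : IsNonlinearity N V K γ Γ θ) {M : ℝ} {u w : ℕ → RadialSpace N V}
    (hu : ∀ n, ‖u n‖ ≤ M) (hw : ∀ n, ‖w n‖ ≤ M) {U : ℝ → ℝ}
    (hlu : ∀ r, Tendsto (fun n => (u n).eval r) atTop (𝓝 (U r)))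
    (hlw : ∀ r, Tendsto (fun n => (w n).eval r) atTop (𝓝 (U r))) :
    Tendsto (fun n => hK.grad (u n) - hK.grad (w n)) atTop (𝓝 0) := by
  -- Testing against the normalised difference turns the norm into an integral. When the difference
  -- is 0 the inverse is 0 by convention, and so is `h n`.
  let h : ℕ → RadialSpace N V := fun n =>
    ‖hK.grad (u n) - hK.grad (w n)‖⁻¹ • (hK.grad (u n) - hK.grad (w n))
  have hh : ∀ n, ‖h n‖ ≤ 1 := by
    intro n
    simp only [h, norm_smul, norm_inv, norm_norm]
    exact inv_mul_le_one
  have hM : ∀ n, ‖h n‖ ≤ max M 1 := fun n => (hh n).trans (le_max_right _ _)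
  have hu' : ∀ n, ‖u n‖ ≤ max M 1 := fun n => (hu n).trans (le_max_left _ _)
  have hw' : ∀ n, ‖w n‖ ≤ max M 1 := fun n => (hw n).trans (le_max_left _ _)
  let D : ℕ → ℝ → ℝ := fun n r =>
    K r * |γ ((u n).eval r) - γ ((w n).eval r)| * |(h n).eval r|
  let W : ℕ → ℝ → ℝ := fun n r => 2 * (V r * (u n).eval r ^ 2) + 2 * (V r * (w n).eval r ^ 2)
    + 4 * (V r * (h n).eval r ^ 2)
  have hkey := tendsto_integral_zero_of_almost_dominated (μ := radialMeasure N) (D := D) (W := W)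
    (C := 8 * (max M 1) ^ 2) (fun n => by
      have h1 := hK.continuous.measurable.comp (u n).measurable_eval
      have h2 := hK.continuous.measurable.comp (w n).measurable_eval
      have h3 := (h n).measurable_eval
      exact ((hK.measurable.mul (h1.sub h2).abs).mul h3.abs).aestronglyMeasurable)
    (fun n => Eventually.of_forall fun r => mul_nonneg (mul_nonneg (hK.nonneg r) (abs_nonneg _))
      (abs_nonneg _))
    (by
      filter_upwards [ae_radialMeasure_pos] with r hr
      have h1 : Tendsto (fun n => |γ ((u n).eval r) - γ ((w n).eval r)|) atTop (𝓝 0) := by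
        have := (((hK.continuous.tendsto _).comp (hlu r)).sub
          ((hK.continuous.tendsto _).comp (hlw r))).abs
        simpa using this
      have h2 := (h1.const_mul (K r)).mul_const (decayConst N * 1 * r ^ (-decay N))
      rw [mul_zero, zero_mul] at h2
      refine squeeze_zero (fun n => mul_nonneg (mul_nonneg (hK.nonneg r) (abs_nonneg _))
        (abs_nonneg _)) (fun n => ?_) h2
      refine mul_le_mul_of_nonneg_left (((h n).abs_eval_le hr).trans ?_)
        (mul_nonneg (hK.nonneg r) (abs_nonneg _))
      have := decayConst_nonneg (N := N)
      gcongr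
      exact hh n)
    (fun n => (((u n).integrable_eval_sq.const_mul 2).add
      ((w n).integrable_eval_sq.const_mul 2)).add ((h n).integrable_eval_sq.const_mul 4))
    (fun n r => by
      have := hV.nonneg r
      positivity)
    (fun n => by
      simp only [W]
      have hi1 : Integrable (fun r => 2 * (V r * (u n).eval r ^ 2)
          + 2 * (V r * (w n).eval r ^ 2)) (radialMeasure N) :=
        ((u n).integrable_eval_sq.const_mul 2).add ((w n).integrable_eval_sq.const_mul 2)
      rw [integral_add hi1 ((h n).integrable_eval_sq.const_mul 4),
        integral_add ((u n).integrable_eval_sq.const_mul 2)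
          ((w n).integrable_eval_sq.const_mul 2)]
      simp_rw [integral_const_mul]
      have hle : ∀ u : RadialSpace N V, ‖u‖ ≤ max M 1 →
          ∫ r, V r * u.eval r ^ 2 ∂(radialMeasure N) ≤ (max M 1) ^ 2 := fun u hu =>
        u.integral_eval_sq_le.trans (pow_le_pow_left₀ (norm_nonneg _) hu 2)
      linarith [hle _ (hu' n), hle _ (hw' n), hle _ (hM n)])
    (fun ε hε => by
      obtain ⟨ρ, hρ, hb⟩ := hK.exists_bound (V := V) (max M 1) hε
      refine ⟨fun r => 2 * ρ r, hρ.const_mul 2, fun n => ?_⟩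
      filter_upwards [ae_radialMeasure_pos] with r hr
      have h1 := hb (u n) (h n) (hu' n) (hM n) r hr
      have h2 := hb (w n) (h n) (hw' n) (hM n) r hr
      have h3 : D n r ≤ K r * |γ ((u n).eval r)| * |(h n).eval r|
          + K r * |γ ((w n).eval r)| * |(h n).eval r| := by
        simp only [D]
        rw [← add_mul, ← mul_add]
        exact mul_le_mul_of_nonneg_right (mul_le_mul_of_nonneg_left (abs_sub _ _) (hK.nonneg r))
          (abs_nonneg _)
      have h4 := mul_le_mul_of_nonneg_left
        (sq_sum_le_two ((u n).eval r) ((h n).eval r)) (hV.nonneg r)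
      have h5 := mul_le_mul_of_nonneg_left
        (sq_sum_le_two ((w n).eval r) ((h n).eval r)) (hV.nonneg r)
      simp only [W]
      nlinarith)
  refine squeeze_zero_norm (fun n => ?_) hkey.2
  have h1 : ‖hK.grad (u n) - hK.grad (w n)‖ = inner ℝ (hK.grad (u n) - hK.grad (w n)) (h n) := by
    simp only [h, inner_smul_right, real_inner_self_eq_norm_sq]
    by_cases hz : ‖hK.grad (u n) - hK.grad (w n)‖ = 0
    · simp [hz]
    · field_simp
  rw [h1, inner_sub_left, hK.inner_grad, hK.inner_grad,
    ← integral_sub (hK.integrable_mul _ _) (hK.integrable_mul _ _)]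
  refine integral_mono_ae ((hK.integrable_mul _ _).sub (hK.integrable_mul _ _)) (hkey.1 n) ?_
  refine Eventually.of_forall fun r => ?_
  simp only [D]
  rw [← mul_sub, ← sub_mul, mul_assoc, ← abs_mul]
  exact mul_le_mul_of_nonneg_left (le_abs_self _) (hK.nonneg r)

theorem continuous_grad (hK : IsNonlinearity N V K γ Γ θ) :
    Continuous (hK.grad : RadialSpace N V → RadialSpace N V) := by
  rw [continuous_iff_seqContinuous]
  intro u w hlim
  obtain ⟨M, hM⟩ := (Metric.isBounded_range_of_tendsto u hlim).exists_norm_le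
  have h1 := hK.tendsto_grad_sub (M := max M ‖w‖) (u := u) (w := fun _ => w)
    (fun n => (hM _ ⟨n, rfl⟩).trans (le_max_left _ _)) (fun n => le_max_right _ _)
    (U := w.eval) (tendsto_eval hlim) (fun r => tendsto_const_nhds)
  have h2 := h1.add_const (hK.grad w)
  simp only [sub_add_cancel, zero_add] at h2
  exact h2

/-- Along a pointwise convergent subsequence, failure of the Cauchy property would give two further
subsequences with the same pointwise limit whose gradients stay apart. -/
theorem exists_subseq_cauchySeq_grad (hK : IsNonlinearity N V K γ Γ θ) {M : ℝ}
    {u : ℕ → RadialSpace N V} (hu : ∀ n, ‖u n‖ ≤ M) :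
    ∃ φ : ℕ → ℕ, StrictMono φ ∧ CauchySeq fun n => hK.grad (u (φ n)) := by
  obtain ⟨φ, U, hφ, hU⟩ := exists_subseq_tendsto_eval hu
  refine ⟨φ, hφ, ?_⟩
  by_contra hcon
  rw [Metric.cauchySeq_iff] at hcon
  push Not at hcon
  obtain ⟨ε, hε, hne⟩ := hcon
  choose m hm n hn hd using hne
  have hmt : Tendsto m atTop atTop := tendsto_atTop_mono hm tendsto_id
  have hnt : Tendsto n atTop atTop := tendsto_atTop_mono hn tendsto_id
  have h1 := hK.tendsto_grad_sub (M := M) (u := fun k => u (φ (m k))) (w := fun k => u (φ (n k)))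
    (fun k => hu _) (fun k => hu _) (fun r => (hU r).comp hmt) (fun r => (hU r).comp hnt)
  obtain ⟨k, hk⟩ := (Metric.tendsto_atTop.1 h1 ε hε)
  have h2 := hk k le_rfl
  rw [dist_zero_right, ← dist_eq_norm] at h2
  exact absurd (hd k) (not_le.2 h2)

end IsNonlinearity

end QLS

namespace QLS

set_option linter.unusedSectionVars false

/-! ### The energy and the mountain pass -/

theorem exists_bound_of_le_on_ball {E : Type*} [NormedAddCommGroup E] [NormedSpace ℝ E]
    {L : E →ₗ[ℝ] ℝ} {C : ℝ} (h : ∀ x, ‖x‖ ≤ 1 → |L x| ≤ C) : ∃ C, ∀ x, ‖L x‖ ≤ C * ‖x‖ := by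
  refine ⟨C, fun x => ?_⟩
  by_cases hx : x = 0
  · simp [hx]
  · have hpos : 0 < ‖x‖ := norm_pos_iff.2 hx
    have h1 := h (‖x‖⁻¹ • x) (by rw [norm_smul, norm_inv, norm_norm, inv_mul_cancel₀ hpos.ne'])
    rw [map_smul, smul_eq_mul, abs_mul, abs_inv, abs_norm, inv_mul_le_iff₀ hpos] at h1
    rw [Real.norm_eq_abs]
    linarith

variable {N : ℕ} [hN : Fact (3 ≤ N)] {V K γ Γ : ℝ → ℝ} {θ : ℝ} [hV : IsPotential V]

/-! ### The quasilinear term and its gradient -/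

namespace RadialSpace

theorem integrable_phi_sub_mul (u w h : RadialSpace N V) :
    Integrable (fun r => V r * ((phi (u.eval r) - phi (w.eval r)) * h.eval r))
      (radialMeasure N) := by
  have hi : Integrable (fun r => V r * (u - w).eval r ^ 2 + V r * h.eval r ^ 2)
    (radialMeasure N) := (u - w).integrable_eval_sq.add h.integrable_eval_sq
  refine hi.mono' ?_ (Eventually.of_forall fun r => ?_)
  · have h1 := continuous_phi.measurable.comp u.measurable_eval
    have h2 := continuous_phi.measurable.comp w.measurable_eval
    exact ((IsPotential.measurable V).mul ((h1.sub h2).mul h.measurable_eval)).aestronglyMeasurable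
  · rw [Real.norm_eq_abs, abs_mul, abs_of_nonneg (hV.nonneg r), abs_mul, ← mul_add, eval_sub]
    refine mul_le_mul_of_nonneg_left ?_ (hV.nonneg r)
    have h1 := abs_phi_sub_le (u.eval r) (w.eval r)
    have h2 := abs_nonneg (h.eval r)
    rw [← sq_abs (u.eval r - w.eval r), ← sq_abs (h.eval r)]
    nlinarith [sq_nonneg (|u.eval r - w.eval r| - |h.eval r|), abs_nonneg (u.eval r - w.eval r)]

theorem integrable_phi_mul (u h : RadialSpace N V) :
    Integrable (fun r => V r * (phi (u.eval r) * h.eval r)) (radialMeasure N) := by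
  simpa [eval_zero, phi_zero] using integrable_phi_sub_mul u 0 h

theorem integrable_change_sq (u : RadialSpace N V) :
    Integrable (fun r => V r * change (u.eval r) ^ 2) (radialMeasure N) := by
  refine u.integrable_eval_sq.mono' ?_ (Eventually.of_forall fun r => ?_)
  · exact ((IsPotential.measurable V).mul
      ((continuous_change.measurable.comp u.measurable_eval).pow_const 2)).aestronglyMeasurable
  · rw [Real.norm_of_nonneg (mul_nonneg (hV.nonneg r) (sq_nonneg _))]
    exact mul_le_mul_of_nonneg_left (change_sq_le_sq _) (hV.nonneg r)

/-- The inequality 2ab ≤ a² + b² inside the integrals, with φ 1-Lipschitz. Taking h to be the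
difference of the gradients gives 2‖h‖² ≤ ‖u - w‖² + ‖h‖², so the gradient is 1-Lipschitz. -/
theorem integral_mul_phi_sub_le (u w h : RadialSpace N V) :
    2 * (∫ r, (u - w).deriv r * h.deriv r ∂(radialMeasure N)
      + ∫ r, V r * ((phi (u.eval r) - phi (w.eval r)) * h.eval r) ∂(radialMeasure N))
      ≤ ‖u - w‖ ^ 2 + ‖h‖ ^ 2 := by
  have h1 : 2 * ∫ r, (u - w).deriv r * h.deriv r ∂(radialMeasure N)
      ≤ ∫ r, (u - w).deriv r ^ 2 ∂(radialMeasure N) + ∫ r, h.deriv r ^ 2 ∂(radialMeasure N) := by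
    rw [← integral_const_mul, ← integral_add (u - w).integrable_deriv_sq h.integrable_deriv_sq]
    refine integral_mono (((u - w).integrable_deriv_mul h).const_mul 2)
      ((u - w).integrable_deriv_sq.add h.integrable_deriv_sq) fun r => ?_
    change 2 * ((u - w).deriv r * h.deriv r) ≤ (u - w).deriv r ^ 2 + h.deriv r ^ 2
    nlinarith [sq_nonneg ((u - w).deriv r - h.deriv r)]
  have h2 : 2 * ∫ r, V r * ((phi (u.eval r) - phi (w.eval r)) * h.eval r) ∂(radialMeasure N)
      ≤ ∫ r, V r * (u - w).eval r ^ 2 ∂(radialMeasure N)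
        + ∫ r, V r * h.eval r ^ 2 ∂(radialMeasure N) := by
    rw [← integral_const_mul, ← integral_add (u - w).integrable_eval_sq h.integrable_eval_sq]
    refine integral_mono ((u.integrable_phi_sub_mul w h).const_mul 2)
      ((u - w).integrable_eval_sq.add h.integrable_eval_sq) fun r => ?_
    change 2 * (V r * ((phi (u.eval r) - phi (w.eval r)) * h.eval r))
      ≤ V r * (u - w).eval r ^ 2 + V r * h.eval r ^ 2
    rw [← mul_add, mul_left_comm, eval_sub]
    refine mul_le_mul_of_nonneg_left ?_ (hV.nonneg r)
    have h1 := abs_phi_sub_le (u.eval r) (w.eval r)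
    have h2 := le_abs_self ((phi (u.eval r) - phi (w.eval r)) * h.eval r)
    rw [abs_mul] at h2
    rw [← sq_abs (u.eval r - w.eval r), ← sq_abs (h.eval r)]
    nlinarith [sq_nonneg (|u.eval r - w.eval r| - |h.eval r|), abs_nonneg (h.eval r)]
  rw [norm_sq_eq, norm_sq_eq]
  linarith

/-- The derivative of the quasilinear part of the energy. -/
noncomputable def quasiForm (u : RadialSpace N V) : RadialSpace N V →ₗ[ℝ] ℝ where
  toFun h := ∫ r, u.deriv r * h.deriv r ∂(radialMeasure N)
    + ∫ r, V r * (phi (u.eval r) * h.eval r) ∂(radialMeasure N)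
  map_add' h k := by
    have h1 : ∫ r, u.deriv r * (h + k).deriv r ∂(radialMeasure N)
        = ∫ r, u.deriv r * h.deriv r ∂(radialMeasure N)
          + ∫ r, u.deriv r * k.deriv r ∂(radialMeasure N) := by
      rw [← integral_add (u.integrable_deriv_mul h) (u.integrable_deriv_mul k)]
      refine integral_congr_ae ?_
      filter_upwards [deriv_add h k] with r hr
      rw [hr, mul_add]
    rw [h1]
    simp_rw [eval_add, mul_add]
    rw [integral_add (u.integrable_phi_mul h) (u.integrable_phi_mul k)]
    ring
  map_smul' c h := by
    have h1 : ∫ r, u.deriv r * (c • h).deriv r ∂(radialMeasure N)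
        = c * ∫ r, u.deriv r * h.deriv r ∂(radialMeasure N) := by
      rw [← integral_const_mul]
      refine integral_congr_ae ?_
      filter_upwards [deriv_smul c h] with r hr
      rw [hr]
      ring
    rw [h1]
    simp_rw [eval_smul, RingHom.id_apply, smul_eq_mul, mul_add, ← integral_const_mul]
    congr 2
    ext r
    ring

theorem quasiForm_apply (u h : RadialSpace N V) :
    u.quasiForm h = ∫ r, u.deriv r * h.deriv r ∂(radialMeasure N)
      + ∫ r, V r * (phi (u.eval r) * h.eval r) ∂(radialMeasure N) := rfl

theorem quasiForm_sub (u w h : RadialSpace N V) :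
    u.quasiForm h - w.quasiForm h = ∫ r, (u - w).deriv r * h.deriv r ∂(radialMeasure N)
      + ∫ r, V r * ((phi (u.eval r) - phi (w.eval r)) * h.eval r) ∂(radialMeasure N) := by
  have h1 : ∫ r, (u - w).deriv r * h.deriv r ∂(radialMeasure N)
      = ∫ r, u.deriv r * h.deriv r ∂(radialMeasure N)
        - ∫ r, w.deriv r * h.deriv r ∂(radialMeasure N) := by
    rw [← integral_sub (u.integrable_deriv_mul h) (w.integrable_deriv_mul h)]
    refine integral_congr_ae ?_
    filter_upwards [deriv_sub u w] with r hr
    rw [hr, sub_mul]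
  rw [h1]
  simp_rw [sub_mul, mul_sub]
  rw [integral_sub (u.integrable_phi_mul h) (w.integrable_phi_mul h), quasiForm_apply,
    quasiForm_apply]
  ring

theorem quasiForm_sub_le (u w h : RadialSpace N V) :
    2 * (u.quasiForm h - w.quasiForm h) ≤ ‖u - w‖ ^ 2 + ‖h‖ ^ 2 := by
  rw [quasiForm_sub]
  exact integral_mul_phi_sub_le u w h

theorem quasiForm_zero (h : RadialSpace N V) : (0 : RadialSpace N V).quasiForm h = 0 := by
  have h1 : ∫ r, (0 : RadialSpace N V).deriv r * h.deriv r ∂(radialMeasure N) = 0 := by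
    have h2 := deriv_smul 0 (0 : RadialSpace N V)
    rw [smul_zero] at h2
    refine (integral_congr_ae (g := fun _ => 0) ?_).trans (integral_zero _ _)
    filter_upwards [h2] with r hr
    rw [hr]
    simp
  rw [quasiForm_apply, h1]
  simp [eval_zero, phi_zero]

theorem exists_quasiForm_bound (u : RadialSpace N V) : ∃ C, ∀ h, ‖u.quasiForm h‖ ≤ C * ‖h‖ := by
  refine exists_bound_of_le_on_ball (C := ‖u‖ ^ 2 + 1) fun h hh => ?_
  have h1 := quasiForm_sub_le u 0 h
  have h2 := quasiForm_sub_le u 0 (-h)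
  rw [quasiForm_zero, sub_zero, sub_zero] at h1 h2
  rw [map_neg, norm_neg] at h2
  have h3 : ‖h‖ ^ 2 ≤ 1 := pow_le_one₀ (norm_nonneg _) hh
  rw [abs_le]
  constructor <;> nlinarith [sq_nonneg ‖u‖]

/-- The gradient of the quasilinear part of the energy. -/
noncomputable def quasiGrad (u : RadialSpace N V) : RadialSpace N V :=
  (InnerProductSpace.toDual ℝ (RadialSpace N V)).symm
    (u.quasiForm.mkContinuousOfExistsBound u.exists_quasiForm_bound)

theorem inner_quasiGrad (u h : RadialSpace N V) : inner ℝ u.quasiGrad h = u.quasiForm h := by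
  rw [quasiGrad, InnerProductSpace.toDual_symm_apply]
  rfl

theorem continuous_quasiGrad : Continuous (quasiGrad : RadialSpace N V → RadialSpace N V) := by
  refine (LipschitzWith.of_dist_le_mul (K := 1) fun u w => ?_).continuous
  rw [NNReal.coe_one, one_mul, dist_eq_norm, dist_eq_norm]
  have h1 := quasiForm_sub_le u w (u.quasiGrad - w.quasiGrad)
  rw [← inner_quasiGrad, ← inner_quasiGrad, ← inner_sub_left, real_inner_self_eq_norm_sq] at h1
  exact le_of_sq_le_sq (by linarith) (norm_nonneg _)

theorem integral_eval_sq_eq (u : RadialSpace N V) :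
    ∫ r, V r * u.eval r ^ 2 ∂(radialMeasure N)
      = ∫ r in Set.Iio 1, V r * u.eval r ^ 2 ∂(radialMeasure N)
        + ∫ r in Set.Ici 1, V r * u.eval r ^ 2 ∂(radialMeasure N) := by
  rw [← Set.compl_Iio]
  exact (integral_add_compl measurableSet_Iio u.integrable_eval_sq).symm

theorem abs_eval_le_of_one_le (u : RadialSpace N V) {r : ℝ} (hr : 1 ≤ r) :
    |u.eval r| ≤ decayConst N * √u.dirichlet := by
  refine (u.abs_eval_le_dirichlet (by linarith)).trans ?_
  have := decayConst_nonneg (N := N)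
  have h1 : r ^ (-decay N) ≤ 1 := Real.rpow_le_one_of_one_le_of_nonpos hr
    (by linarith [decay_pos (N := N)])
  exact mul_le_of_le_one_right (by positivity) h1

variable (N V) in
-- By Hardy, only the part of the potential term outside the unit ball is not controlled by the
-- Dirichlet integral.
theorem exists_norm_sq_le : ∃ C > 0, ∀ u : RadialSpace N V,
    ‖u‖ ^ 2 ≤ C * u.dirichlet + ∫ r in Set.Ici 1, V r * u.eval r ^ 2 ∂(radialMeasure N) := by
  obtain ⟨C, hC, h⟩ := exists_hardy N V
  refine ⟨1 + C, by positivity, fun u => ?_⟩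
  have h1 := (h u.deriv u.memLp_deriv).2
  rw [u.eLpNorm_deriv, Real.sq_sqrt u.dirichlet_nonneg] at h1
  rw [norm_sq_eq, integral_eval_sq_eq]
  change u.dirichlet + (∫ r in Set.Iio 1, V r * tailIntegral u.deriv r ^ 2 ∂(radialMeasure N)
    + _) ≤ _
  linarith

/-- Inside the unit ball the Dirichlet integral suffices. Outside it, u and w are bounded by a
multiple of M, so the slopes of φ between their values are bounded below. -/
theorem quasiGrad_strong_mono (M : ℝ) : ∃ C > 0, ∀ u w : RadialSpace N V, ‖u‖ ≤ M → ‖w‖ ≤ M →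
    ‖u - w‖ ^ 2 ≤ C * inner ℝ (u.quasiGrad - w.quasiGrad) (u - w) := by
  obtain ⟨C, hC, h⟩ := exists_norm_sq_le N V
  refine ⟨C + (1 + 2 * (decayConst N * M) ^ 2) ^ 2, by positivity, fun u w hu hw => ?_⟩
  have hc := decayConst_nonneg (N := N)
  have hle : ∀ u : RadialSpace N V, ‖u‖ ≤ M → ∀ r, 1 ≤ r → |u.eval r| ≤ decayConst N * M := by
    intro u hu r hr
    refine (u.abs_eval_le_of_one_le hr).trans ?_
    gcongr
    exact (Real.sqrt_le_iff.2 ⟨norm_nonneg _, u.dirichlet_le⟩).trans hu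
  rw [inner_sub_left, inner_quasiGrad, inner_quasiGrad, quasiForm_sub]
  have h1 : ∫ r, (u - w).deriv r * (u - w).deriv r ∂(radialMeasure N) = (u - w).dirichlet := by
    simp_rw [← sq]
    rfl
  rw [h1]
  have hi := u.integrable_phi_sub_mul w (u - w)
  have hnn : ∀ r, 0 ≤ V r * ((phi (u.eval r) - phi (w.eval r)) * (u - w).eval r) := fun r => by
    rw [eval_sub]
    exact mul_nonneg (hV.nonneg r) (phi_sub_mul_sub_nonneg _ _)
  set J := ∫ r, V r * ((phi (u.eval r) - phi (w.eval r)) * (u - w).eval r) ∂(radialMeasure N)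
    with hJ
  have hJ0 : 0 ≤ J := integral_nonneg hnn
  have h2 : ∫ r in Set.Ici 1, V r * (u - w).eval r ^ 2 ∂(radialMeasure N)
      ≤ (1 + 2 * (decayConst N * M) ^ 2) ^ 2 * J := by
    calc _ ≤ ∫ r in Set.Ici 1, (1 + 2 * (decayConst N * M) ^ 2) ^ 2 *
          (V r * ((phi (u.eval r) - phi (w.eval r)) * (u - w).eval r)) ∂(radialMeasure N) := by
          refine setIntegral_mono_on (u - w).integrable_eval_sq.integrableOn
            (hi.const_mul _).integrableOn measurableSet_Ici fun r hr => ?_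
          rw [mul_left_comm]
          refine mul_le_mul_of_nonneg_left ?_ (hV.nonneg r)
          rw [eval_sub]
          exact sq_sub_le_of_abs_le (hle u hu r hr) (hle w hw r hr)
      _ ≤ _ := by
          rw [integral_const_mul]
          refine mul_le_mul_of_nonneg_left ?_ (by positivity)
          exact setIntegral_le_integral hi (Eventually.of_forall hnn)
  have h3 := h (u - w)
  have h4 := (u - w).dirichlet_nonneg
  have h5 : 0 ≤ (1 + 2 * (decayConst N * M) ^ 2) ^ 2 * (u - w).dirichlet := by positivity
  nlinarith [mul_nonneg hC.le hJ0]

/-- The integral of `V f(u)²`. -/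
noncomputable def orlicz (u : RadialSpace N V) : ℝ :=
  ∫ r, V r * change (u.eval r) ^ 2 ∂(radialMeasure N)

theorem orlicz_nonneg (u : RadialSpace N V) : 0 ≤ u.orlicz :=
  integral_nonneg fun r => mul_nonneg (hV.nonneg r) (sq_nonneg _)

variable (N V) in
-- For r ≥ 1 the values are bounded by a multiple of the square root of the Dirichlet integral, so
-- u² ≤ (1 + 2c² dirichlet) f(u)² there. This is where the factor 1 + dirichlet arises.
theorem exists_norm_sq_le_orlicz : ∃ C ≥ 1, ∀ u : RadialSpace N V,
    ‖u‖ ^ 2 ≤ C * (1 + u.dirichlet) * (u.dirichlet + u.orlicz) := by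
  obtain ⟨C, hC, h⟩ := exists_norm_sq_le N V
  have hc := decayConst_nonneg (N := N)
  refine ⟨1 + C + 2 * decayConst N ^ 2, by nlinarith [sq_nonneg (decayConst N)], fun u => ?_⟩
  have hA := u.dirichlet_nonneg
  have hB := u.orlicz_nonneg
  have h2 : ∫ r in Set.Ici 1, V r * u.eval r ^ 2 ∂(radialMeasure N)
      ≤ (1 + 2 * (decayConst N * √u.dirichlet) ^ 2) * u.orlicz := by
    calc _ ≤ ∫ r in Set.Ici 1, (1 + 2 * (decayConst N * √u.dirichlet) ^ 2) *
          (V r * change (u.eval r) ^ 2) ∂(radialMeasure N) := by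
          refine setIntegral_mono_on u.integrable_eval_sq.integrableOn
            (u.integrable_change_sq.const_mul _).integrableOn measurableSet_Ici fun r hr => ?_
          rw [mul_left_comm]
          refine mul_le_mul_of_nonneg_left ?_ (hV.nonneg r)
          exact sq_le_of_abs_le (u.abs_eval_le_of_one_le hr)
      _ ≤ _ := by
          rw [integral_const_mul]
          refine mul_le_mul_of_nonneg_left ?_ (by positivity)
          exact setIntegral_le_integral u.integrable_change_sq
            (Eventually.of_forall fun r => mul_nonneg (hV.nonneg r) (sq_nonneg _))
  rw [mul_pow, Real.sq_sqrt hA] at h2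
  have h3 := h u
  have h4 := sq_nonneg (decayConst N)
  have h5 := mul_nonneg hA hB
  have h6 := mul_nonneg hC.le hA
  have h7 := mul_nonneg hC.le hB
  have h8 := mul_nonneg h4 hA
  have h9 := mul_nonneg h4 hB
  have h10 := mul_nonneg hC.le h5
  have h11 := mul_nonneg h4 h5
  have h12 := mul_nonneg hC.le (mul_nonneg hA hA)
  have h13 := mul_nonneg h4 (mul_nonneg hA hA)
  nlinarith [mul_nonneg hA hA]

end RadialSpace

open RadialSpace

namespace IsNonlinearity

theorem primitive_zero (hK : IsNonlinearity N V K γ Γ θ) : Γ 0 = 0 := by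
  have h1 := hK.primitive_nonneg 0
  have h2 := hK.superquadratic 0
  have h3 := hK.two_lt
  rw [mul_zero] at h2
  have h4 : θ * Γ 0 = 0 := le_antisymm h2 h1
  exact (mul_eq_zero.1 h4).resolve_left (by linarith)

theorem nonneg_primitive (hK : IsNonlinearity N V K γ Γ θ) (t : ℝ) : 0 ≤ Γ t :=
  nonneg_of_mul_nonneg_right (hK.primitive_nonneg t) (by linarith [hK.two_lt])

theorem continuous_primitive (hK : IsNonlinearity N V K γ Γ θ) : Continuous Γ :=
  continuous_iff_continuousAt.2 fun t => (hK.hasDerivAt t).continuousAt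

theorem primitive_le (hK : IsNonlinearity N V K γ Γ θ) (t : ℝ) : Γ t ≤ γ t * t := by
  have h1 := hK.superquadratic t
  have h2 := hK.nonneg_primitive t
  nlinarith [hK.two_lt]

theorem integrable_primitive (hK : IsNonlinearity N V K γ Γ θ) (u : RadialSpace N V) :
    Integrable (fun r => K r * Γ (u.eval r)) (radialMeasure N) := by
  refine (hK.integrable_mul u u).mono' ?_ (Eventually.of_forall fun r => ?_)
  · exact (hK.measurable.mul
      (hK.continuous_primitive.measurable.comp u.measurable_eval)).aestronglyMeasurable
  · rw [Real.norm_of_nonneg (mul_nonneg (hK.nonneg r) (hK.nonneg_primitive _))]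
    exact mul_le_mul_of_nonneg_left (hK.primitive_le _) (hK.nonneg r)

/-- The integral of `K Γ(u)`. -/
noncomputable def potential (_ : IsNonlinearity N V K γ Γ θ) (u : RadialSpace N V) : ℝ :=
  ∫ r, K r * Γ (u.eval r) ∂(radialMeasure N)

/-- The energy of a radial function. -/
noncomputable def radialEnergy (hK : IsNonlinearity N V K γ Γ θ) (u : RadialSpace N V) : ℝ :=
  1 / 2 * u.dirichlet + 1 / 2 * u.orlicz - hK.potential u

end IsNonlinearity

namespace RadialSpace

theorem dirichlet_add (u h : RadialSpace N V) :
    (u + h).dirichlet = u.dirichlet + 2 * ∫ r, u.deriv r * h.deriv r ∂(radialMeasure N)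
      + h.dirichlet := by
  have hi : Integrable (fun r => u.deriv r ^ 2 + 2 * (u.deriv r * h.deriv r)) (radialMeasure N) :=
    u.integrable_deriv_sq.add ((u.integrable_deriv_mul h).const_mul 2)
  unfold dirichlet
  rw [← integral_const_mul, ← integral_add u.integrable_deriv_sq
    ((u.integrable_deriv_mul h).const_mul 2), ← integral_add hi h.integrable_deriv_sq]
  refine integral_congr_ae ?_
  filter_upwards [deriv_add u h] with r hr
  rw [hr]
  ring

/-- The Dirichlet part has the exact quadratic remainder, and the Orlicz part is handled pointwise
by `abs_changeSq_sub_le`. -/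
theorem abs_quasi_sub_le (u h : RadialSpace N V) :
    |1 / 2 * (u + h).dirichlet + 1 / 2 * (u + h).orlicz
      - (1 / 2 * u.dirichlet + 1 / 2 * u.orlicz) - u.quasiForm h| ≤ ‖h‖ ^ 2 := by
  have hi1 := (u + h).integrable_change_sq
  have hi2 := u.integrable_change_sq
  have hi3 := (u.integrable_phi_mul h).const_mul 2
  have h1 : (u + h).orlicz - u.orlicz
      - 2 * ∫ r, V r * (phi (u.eval r) * h.eval r) ∂(radialMeasure N)
      = ∫ r, V r * (change (u.eval r + h.eval r) ^ 2 - change (u.eval r) ^ 2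
        - 2 * (phi (u.eval r) * h.eval r)) ∂(radialMeasure N) := by
    have hi12 : Integrable (fun r => V r * change ((u + h).eval r) ^ 2
      - V r * change (u.eval r) ^ 2) (radialMeasure N) := hi1.sub hi2
    unfold orlicz
    rw [← integral_const_mul, ← integral_sub hi1 hi2, ← integral_sub hi12 hi3]
    congr 1
    ext r
    rw [eval_add]
    ring
  have h2 : |∫ r, V r * (change (u.eval r + h.eval r) ^ 2 - change (u.eval r) ^ 2
        - 2 * (phi (u.eval r) * h.eval r)) ∂(radialMeasure N)|
      ≤ 2 * ∫ r, V r * h.eval r ^ 2 ∂(radialMeasure N) := by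
    rw [← integral_const_mul]
    refine norm_integral_le_of_norm_le (G := ℝ) (h.integrable_eval_sq.const_mul 2)
      (Eventually.of_forall fun r => ?_)
    rw [Real.norm_eq_abs, abs_mul, abs_of_nonneg (hV.nonneg r)]
    linarith [mul_le_mul_of_nonneg_left (abs_changeSq_sub_le (u.eval r) (h.eval r)) (hV.nonneg r)]
  rw [← h1] at h2
  rw [dirichlet_add, quasiForm_apply, norm_sq_eq]
  have h3 := h.dirichlet_nonneg
  have h4 : ∫ r, h.deriv r ^ 2 ∂(radialMeasure N) = h.dirichlet := rfl
  rw [h4]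
  rw [abs_le] at h2 ⊢
  constructor <;> linarith

end RadialSpace

namespace IsNonlinearity

theorem exists_intermediate (hK : IsNonlinearity N V K γ Γ θ) (a b : ℝ) :
    ∃ t, |t - a| ≤ |b| ∧ Γ (a + b) - Γ a = γ t * b := by
  rcases lt_trichotomy b 0 with hb | hb | hb
  · obtain ⟨t, ht, he⟩ := exists_hasDerivAt_eq_slope Γ γ (show a + b < a by linarith)
      hK.continuous_primitive.continuousOn fun t _ => hK.hasDerivAt t
    refine ⟨t, ?_, ?_⟩
    · rw [abs_of_neg hb, abs_le]
      constructor <;> linarith [ht.1, ht.2]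
    · rw [he]
      field_simp [hb.ne]
      ring
  · exact ⟨a, by simp, by simp [hb]⟩
  · obtain ⟨t, ht, he⟩ := exists_hasDerivAt_eq_slope Γ γ (show a < a + b by linarith)
      hK.continuous_primitive.continuousOn fun t _ => hK.hasDerivAt t
    refine ⟨t, ?_, ?_⟩
    · rw [abs_of_pos hb, abs_le]
      constructor <;> linarith [ht.1, ht.2]
    · rw [he]
      field_simp [hb.ne']
      ring

/-- A sequence h_n → 0 contradicting differentiability is divided by its norm. The mean value
theorem writes the quotient as K (γ(ξ_n) - γ(u)) k_n with ‖k_n‖ = 1, which tends to 0 pointwise and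
is almost dominated. -/
theorem hasFDerivAt_potential (hK : IsNonlinearity N V K γ Γ θ) (u : RadialSpace N V) :
    HasFDerivAt hK.potential (innerSL ℝ (hK.grad u)) u := by
  rw [hasFDerivAt_iff_isLittleO_nhds_zero, Asymptotics.isLittleO_iff]
  intro c hc
  by_contra hcon
  obtain ⟨h, hlim, hne⟩ := exists_seq_forall_of_frequently (not_eventually.1 hcon)
  have hh0 : ∀ n, 0 < ‖h n‖ := fun n => by
    rw [norm_pos_iff]
    intro h0
    refine hne n ?_
    simp [h0]
  choose ξ hξ hξΓ using hK.exists_intermediate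
  obtain ⟨M₁, hM₁⟩ := (Metric.isBounded_range_of_tendsto h hlim).exists_norm_le
  let k : ℕ → RadialSpace N V := fun n => ‖h n‖⁻¹ • h n
  have hk : ∀ n, ‖k n‖ = 1 := fun n => by
    simp only [k]
    rw [norm_smul, norm_inv, norm_norm, inv_mul_cancel₀ (hh0 n).ne']
  have hkr : ∀ n r, |(k n).eval r| = ‖h n‖⁻¹ * |(h n).eval r| := fun n r => by
    simp only [k]
    rw [eval_smul, abs_mul, abs_inv, abs_norm]
  have hdec := decayConst_nonneg (N := N)
  let D : ℕ → ℝ → ℝ := fun n r => K r * (|Γ (u.eval r + (h n).eval r) - Γ (u.eval r)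
    - γ (u.eval r) * (h n).eval r| * ‖h n‖⁻¹)
  have hD : ∀ n r, D n r = K r * |γ (ξ (u.eval r) ((h n).eval r)) - γ (u.eval r)|
      * |(k n).eval r| := fun n r => by
    simp only [D]
    rw [hξΓ, ← sub_mul, abs_mul, hkr]
    ring
  let W : ℕ → ℝ → ℝ := fun n r => 4 * (V r * u.eval r ^ 2) + 8 * (V r * (h n).eval r ^ 2)
    + 8 * (V r * (k n).eval r ^ 2)
  set M := max (‖u‖ + M₁) 1 with hM
  have hM1 : 0 ≤ M₁ := (norm_nonneg _).trans (hM₁ _ ⟨0, rfl⟩)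
  have hMu : ‖u‖ ≤ M := (le_add_of_nonneg_right hM1).trans (le_max_left _ _)
  have hMh : ∀ n, ‖h n‖ ≤ M := fun n => (hM₁ _ ⟨n, rfl⟩).trans
    ((le_add_of_nonneg_left (norm_nonneg u)).trans (le_max_left _ _))
  have hMk : ∀ n, ‖k n‖ ≤ M := fun n => (hk n).le.trans (le_max_right _ _)
  have hkey := tendsto_integral_zero_of_almost_dominated (μ := radialMeasure N) (D := D) (W := W)
    (C := 20 * M ^ 2) (fun n => by
      have h1 := u.measurable_eval
      have h2 := (h n).measurable_eval
      have h3 := hK.continuous.measurable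
      have h4 := hK.continuous_primitive.measurable
      have h5 := hK.measurable
      have h6 : Measurable (D n) := by fun_prop
      exact h6.aestronglyMeasurable)
    (fun n => Eventually.of_forall fun r => mul_nonneg (hK.nonneg r)
      (mul_nonneg (abs_nonneg _) (inv_nonneg.2 (norm_nonneg _))))
    (by
      filter_upwards [ae_radialMeasure_pos] with r hr
      have h0 : Tendsto (fun n => (h n).eval r) atTop (𝓝 0) := by
        simpa [eval_zero] using tendsto_eval hlim r
      have hξ' : Tendsto (fun n => ξ (u.eval r) ((h n).eval r)) atTop (𝓝 (u.eval r)) := by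
        rw [tendsto_iff_norm_sub_tendsto_zero]
        exact squeeze_zero (fun n => norm_nonneg _) (fun n => hξ _ _) (by simpa using h0.abs)
      have h1 : Tendsto (fun n => |γ (ξ (u.eval r) ((h n).eval r)) - γ (u.eval r)|) atTop
          (𝓝 0) := by
        simpa using (((hK.continuous.tendsto _).comp hξ').sub_const (γ (u.eval r))).abs
      have h2 := (h1.const_mul (K r)).mul_const (decayConst N * 1 * r ^ (-decay N))
      rw [mul_zero, zero_mul] at h2
      simp_rw [hD]
      refine squeeze_zero (fun n => mul_nonneg (mul_nonneg (hK.nonneg r) (abs_nonneg _))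
        (abs_nonneg _)) (fun n => ?_) h2
      refine mul_le_mul_of_nonneg_left (((k n).abs_eval_le hr).trans ?_)
        (mul_nonneg (hK.nonneg r) (abs_nonneg _))
      rw [hk n])
    (fun n => ((u.integrable_eval_sq.const_mul 4).add
      ((h n).integrable_eval_sq.const_mul 8)).add ((k n).integrable_eval_sq.const_mul 8))
    (fun n r => by
      have := hV.nonneg r
      positivity)
    (fun n => by
      simp only [W]
      have hi1 : Integrable (fun r => 4 * (V r * u.eval r ^ 2)
          + 8 * (V r * (h n).eval r ^ 2)) (radialMeasure N) :=
        (u.integrable_eval_sq.const_mul 4).add ((h n).integrable_eval_sq.const_mul 8)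
      rw [integral_add hi1 ((k n).integrable_eval_sq.const_mul 8),
        integral_add (u.integrable_eval_sq.const_mul 4)
          ((h n).integrable_eval_sq.const_mul 8)]
      simp_rw [integral_const_mul]
      have hle : ∀ u : RadialSpace N V, ‖u‖ ≤ M →
          ∫ r, V r * u.eval r ^ 2 ∂(radialMeasure N) ≤ M ^ 2 := fun u hu =>
        u.integral_eval_sq_le.trans (pow_le_pow_left₀ (norm_nonneg _) hu 2)
      linarith [hle _ hMu, hle _ (hMh n), hle _ (hMk n)])
    (fun ε hε => by
      obtain ⟨ρ, hρ, hb⟩ := hK.dominated (2 * decayConst N * M + 1) (by positivity) ε hε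
      refine ⟨fun r => 2 * ρ r, hρ.const_mul 2, fun n => ?_⟩
      filter_upwards [ae_radialMeasure_pos] with r hr
      rw [hD]
      -- This majorises both u and the intermediate point, so the domination applies to the two
      -- terms with the same `a`.
      set a := |u.eval r| + |(h n).eval r| with ha
      set t := ξ (u.eval r) ((h n).eval r) with ht
      have hrp : 0 < r ^ (-decay N) := Real.rpow_pos_of_pos hr _
      have hle : ∀ u : RadialSpace N V, ‖u‖ ≤ M →
          |u.eval r| ≤ decayConst N * M * r ^ (-decay N) := fun u hu =>
        (u.abs_eval_le hr).trans (by gcongr)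
      have hta : |t| ≤ a := by
        have h1 := hξ (u.eval r) ((h n).eval r)
        rw [← ht] at h1
        calc |t| = |u.eval r + (t - u.eval r)| := by ring_nf
          _ ≤ |u.eval r| + |t - u.eval r| := abs_add_le _ _
          _ ≤ a := by rw [ha]; linarith
      have hale : a ≤ (2 * decayConst N * M + 1) * r ^ (-decay N) := by
        have h1 := hle u hMu
        have h2 := hle _ (hMh n)
        nlinarith
      have hble : |(k n).eval r| ≤ (2 * decayConst N * M + 1) * r ^ (-decay N) := by
        have h1 := hle _ (hMk n)
        have h2 : 0 ≤ decayConst N * M * r ^ (-decay N) := (abs_nonneg _).trans h1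
        nlinarith
      have h1 := hb r hr t a _ hta hale (abs_nonneg _) hble
      have h2 := hb r hr (u.eval r) a _ (le_add_of_nonneg_right (abs_nonneg _)) hale
        (abs_nonneg _) hble
      have h3 : K r * |γ t - γ (u.eval r)| * |(k n).eval r| ≤ K r * |γ t| * |(k n).eval r|
          + K r * |γ (u.eval r)| * |(k n).eval r| := by
        rw [← add_mul, ← mul_add]
        exact mul_le_mul_of_nonneg_right (mul_le_mul_of_nonneg_left (abs_sub _ _) (hK.nonneg r))
          (abs_nonneg _)
      have h4 : V r * (a + |(k n).eval r|) ^ 2 ≤ W n r / 2 := by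
        have h5 : (a + |(k n).eval r|) ^ 2 ≤ 2 * u.eval r ^ 2 + 4 * (h n).eval r ^ 2
            + 4 * (k n).eval r ^ 2 := by
          rw [ha, ← sq_abs (u.eval r), ← sq_abs ((h n).eval r), ← sq_abs ((k n).eval r)]
          nlinarith [sq_nonneg (|u.eval r| - (|(h n).eval r| + |(k n).eval r|)),
            sq_nonneg (|(h n).eval r| - |(k n).eval r|)]
        have h6 := mul_le_mul_of_nonneg_left h5 (hV.nonneg r)
        simp only [W]
        linarith
      nlinarith)
  obtain ⟨n, hn⟩ := (hkey.2.eventually (gt_mem_nhds hc)).exists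
  refine hne n ?_
  have h1 : hK.potential (u + h n) - hK.potential u - (innerSL ℝ) (hK.grad u) (h n)
      = ∫ r, K r * (Γ (u.eval r + (h n).eval r) - Γ (u.eval r)
        - γ (u.eval r) * (h n).eval r) ∂(radialMeasure N) := by
    have hi : Integrable (fun r => K r * Γ ((u + h n).eval r) - K r * Γ (u.eval r))
      (radialMeasure N) := (hK.integrable_primitive (u + h n)).sub (hK.integrable_primitive u)
    rw [innerSL_apply_apply, hK.inner_grad]
    unfold potential
    rw [← integral_sub (hK.integrable_primitive (u + h n)) (hK.integrable_primitive u),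
      ← integral_sub hi (hK.integrable_mul u (h n))]
    congr 1
    ext r
    rw [eval_add]
    ring
  rw [h1]
  calc _ ≤ ∫ r, ‖h n‖ * D n r ∂(radialMeasure N) := by
        refine norm_integral_le_of_norm_le ((hkey.1 n).const_mul _)
          (Eventually.of_forall fun r => le_of_eq ?_)
        have := (hh0 n).ne'
        simp only [D]
        rw [Real.norm_eq_abs, abs_mul, abs_of_nonneg (hK.nonneg r)]
        field_simp
    _ ≤ c * ‖h n‖ := by
        rw [integral_const_mul, mul_comm]
        exact mul_le_mul_of_nonneg_right hn.le (norm_nonneg _)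

theorem hasFDerivAt_radialEnergy (hK : IsNonlinearity N V K γ Γ θ) (u : RadialSpace N V) :
    HasFDerivAt hK.radialEnergy (innerSL ℝ (u.quasiGrad - hK.grad u)) u := by
  have h1 : HasFDerivAt (fun u : RadialSpace N V => 1 / 2 * u.dirichlet + 1 / 2 * u.orlicz)
      (innerSL ℝ u.quasiGrad) u := by
    rw [hasFDerivAt_iff_isLittleO_nhds_zero]
    refine Asymptotics.IsBigO.trans_isLittleO (g := fun h : RadialSpace N V => ‖h‖ ^ 2)
      (k := fun h : RadialSpace N V => h) ?_ ?_
    · refine Asymptotics.IsBigO.of_bound 1 (Eventually.of_forall fun h => ?_)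
      rw [innerSL_apply_apply, inner_quasiGrad, one_mul, Real.norm_of_nonneg (sq_nonneg ‖h‖)]
      exact abs_quasi_sub_le u h
    · exact Asymptotics.isLittleO_norm_pow_id one_lt_two
  have h2 := h1.sub (hK.hasFDerivAt_potential u)
  rw [← map_sub] at h2
  exact h2

end IsNonlinearity

end QLS

/-! ### Mountain pass geometry and boundedness of Palais-Smale sequences -/

namespace QLS

set_option linter.unusedSectionVars false

variable {N : ℕ} [hN : Fact (3 ≤ N)] {V K γ Γ : ℝ → ℝ} {θ : ℝ} [hV : IsPotential V]

open RadialSpace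

namespace RadialSpace

theorem dirichlet_smul (c : ℝ) (u : RadialSpace N V) :
    (c • u).dirichlet = c ^ 2 * u.dirichlet := by
  unfold dirichlet
  rw [← integral_const_mul]
  refine integral_congr_ae ?_
  filter_upwards [deriv_smul c u] with r hr
  rw [hr]
  ring

theorem orlicz_le (u : RadialSpace N V) : u.orlicz ≤ ∫ r, V r * u.eval r ^ 2 ∂(radialMeasure N) :=
  integral_mono u.integrable_change_sq u.integrable_eval_sq fun r =>
    mul_le_mul_of_nonneg_left (change_sq_le_sq _) (hV.nonneg r)

theorem dirichlet_add_orlicz_le (u : RadialSpace N V) : u.dirichlet + u.orlicz ≤ ‖u‖ ^ 2 := by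
  have := u.orlicz_le
  rw [norm_sq_eq]
  exact add_le_add_right this _

end RadialSpace

namespace IsNonlinearity

/-- Scaling of the primitive under the Ambrosetti-Rabinowitz condition. -/
theorem primitive_scaling (hK : IsNonlinearity N V K γ Γ θ) (t : ℝ) {a b : ℝ} (ha : 0 < a)
    (hab : a ≤ b) : a ^ (-θ) * Γ (a * t) ≤ b ^ (-θ) * Γ (b * t) := by
  have hd : ∀ s > 0, HasDerivAt (fun s : ℝ => s ^ (-θ) * Γ (s * t))
      (-θ * s ^ (-θ - 1) * Γ (s * t) + s ^ (-θ) * (γ (s * t) * t)) s := by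
    intro s hs
    have h1 := Real.hasDerivAt_rpow_const (x := s) (p := -θ) (Or.inl hs.ne')
    have h2 := (hK.hasDerivAt (s * t)).comp s ((hasDerivAt_id' s).mul_const t)
    refine (h1.mul h2).congr_deriv ?_
    simp
  have hm : MonotoneOn (fun s : ℝ => s ^ (-θ) * Γ (s * t)) (Set.Ioi 0) := by
    refine monotoneOn_of_deriv_nonneg (convex_Ioi 0)
      (fun s hs => (hd s hs).continuousAt.continuousWithinAt)
      (fun s hs => (hd s (interior_subset hs)).differentiableAt.differentiableWithinAt) ?_
    intro s hs
    have hs' : 0 < s := interior_subset hs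
    rw [(hd s hs').deriv]
    have h3 : s ^ (-θ) = s ^ (-θ - 1) * s := by
      rw [← Real.rpow_add_one hs'.ne']
      ring_nf
    have h4 : 0 ≤ s ^ (-θ - 1) * (γ (s * t) * (s * t) - θ * Γ (s * t)) :=
      mul_nonneg (Real.rpow_nonneg hs'.le _) (sub_nonneg.2 (hK.superquadratic _))
    rw [h3]
    linarith
  exact hm ha (ha.trans_le hab) hab

theorem primitive_mul_le (hK : IsNonlinearity N V K γ Γ θ) (t : ℝ) {a : ℝ} (ha : 0 < a)
    (ha1 : a ≤ 1) : Γ (a * t) ≤ a ^ θ * Γ t := by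
  have h := hK.primitive_scaling t ha ha1
  rw [Real.one_rpow, one_mul, one_mul, Real.rpow_neg ha.le] at h
  rwa [inv_mul_le_iff₀ (Real.rpow_pos_of_pos ha _)] at h

theorem le_primitive_mul (hK : IsNonlinearity N V K γ Γ θ) (t : ℝ) {a : ℝ} (ha1 : 1 ≤ a) :
    a ^ θ * Γ t ≤ Γ (a * t) := by
  have ha : 0 < a := by linarith
  have h := hK.primitive_scaling t one_pos ha1
  rw [Real.one_rpow, one_mul, one_mul, Real.rpow_neg ha.le] at h
  rwa [le_inv_mul_iff₀ (Real.rpow_pos_of_pos ha _)] at h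

/-- The superlinear term is bounded on the unit ball, and Γ(a t) ≤ a^θ Γ(t) for 0 < a ≤ 1 carries
this bound to small norms with a factor ‖u‖^θ. -/
theorem exists_potential_le (hK : IsNonlinearity N V K γ Γ θ) :
    ∃ C > 0, ∀ u : RadialSpace N V, ‖u‖ ≤ 1 → hK.potential u ≤ C * ‖u‖ ^ θ := by
  obtain ⟨C, hC⟩ := hK.exists_form_le (V := V) 1
  have hb : ∀ u : RadialSpace N V, ‖u‖ ≤ 1 → hK.potential u ≤ C := by
    intro u hu
    refine le_trans ?_ (hC u u hu hu)
    refine integral_mono (hK.integrable_primitive u) ?_ fun r => ?_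
    · refine (hK.integrable_mul u u).abs.congr (Eventually.of_forall fun r => ?_)
      change |K r * (γ (u.eval r) * u.eval r)| = _
      rw [abs_mul, abs_mul, abs_of_nonneg (hK.nonneg r), ← mul_assoc]
    · change K r * Γ (u.eval r) ≤ _
      rw [mul_assoc, ← abs_mul]
      exact mul_le_mul_of_nonneg_left ((hK.primitive_le _).trans (le_abs_self _)) (hK.nonneg r)
  refine ⟨|C| + 1, by positivity, fun u hu => ?_⟩
  by_cases hu0 : u = 0
  · have : hK.potential u = 0 := by
      simp [potential, hu0, eval_zero, hK.primitive_zero]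
    rw [this]
    positivity
  have hpos : 0 < ‖u‖ := norm_pos_iff.2 hu0
  have h1 := hb (‖u‖⁻¹ • u) (by rw [norm_smul, norm_inv, norm_norm, inv_mul_cancel₀ hpos.ne'])
  have h2 : hK.potential u ≤ ‖u‖ ^ θ * hK.potential (‖u‖⁻¹ • u) := by
    unfold potential
    rw [← integral_const_mul]
    refine integral_mono (hK.integrable_primitive u)
      ((hK.integrable_primitive _).const_mul _) fun r => ?_
    change K r * Γ (u.eval r) ≤ ‖u‖ ^ θ * (K r * Γ ((‖u‖⁻¹ • u).eval r))
    rw [eval_smul, mul_left_comm]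
    refine mul_le_mul_of_nonneg_left ?_ (hK.nonneg r)
    have := hK.primitive_mul_le (‖u‖⁻¹ * u.eval r) hpos hu
    rwa [mul_inv_cancel_left₀ hpos.ne'] at this
  have h3 : hK.potential (‖u‖⁻¹ • u) ≤ |C| + 1 := h1.trans ((le_abs_self C).trans (by linarith))
  have h4 : 0 < ‖u‖ ^ θ := Real.rpow_pos_of_pos hpos _
  nlinarith

theorem inner_quasiGrad_self_le (u : RadialSpace N V) :
    inner ℝ u.quasiGrad u ≤ u.dirichlet + u.orlicz := by
  rw [inner_quasiGrad, quasiForm_apply]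
  simp_rw [← sq]
  refine add_le_add_right ?_ _
  refine integral_mono (u.integrable_phi_mul u) u.integrable_change_sq fun r => ?_
  exact mul_le_mul_of_nonneg_left (phi_mul_le_change_sq _) (hV.nonneg r)

theorem potential_le_inner (hK : IsNonlinearity N V K γ Γ θ) (u : RadialSpace N V) :
    θ * hK.potential u ≤ inner ℝ (hK.grad u) u := by
  rw [hK.inner_grad]
  unfold potential
  rw [← integral_const_mul]
  refine integral_mono ((hK.integrable_primitive u).const_mul _) (hK.integrable_mul u u)
    fun r => ?_
  change θ * (K r * Γ (u.eval r)) ≤ K r * (γ (u.eval r) * u.eval r)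
  rw [mul_left_comm]
  exact mul_le_mul_of_nonneg_left (hK.superquadratic _) (hK.nonneg r)

/-- In θ I(u) - ⟨I'(u), u⟩ the superlinear terms have a favourable sign, leaving at least (θ/2 - 1)
Y with Y = dirichlet + orlicz. Since ‖u‖ ≤ C(1 + Y), a small enough gradient can be absorbed. -/
theorem palais_smale_bounded (hK : IsNonlinearity N V K γ Γ θ) (c : ℝ) :
    ∃ ε > 0, ∃ M, ∀ u : RadialSpace N V, hK.radialEnergy u ≤ c →
      ‖u.quasiGrad - hK.grad u‖ ≤ ε → ‖u‖ ≤ M := by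
  obtain ⟨C, hC, h⟩ := exists_norm_sq_le_orlicz N V
  have hθ := hK.two_lt
  -- This δ satisfies θδ = θ/2 - 1. With gradient tolerance δ/C the error is at most δ(1 + Y), less
  -- than what θδY can absorb because θ > 2.
  obtain ⟨δ, hδ, hδθ⟩ : ∃ δ > 0, θ * (1 / 2 - δ) = 1 :=
    ⟨1 / 2 - 1 / θ, by rw [gt_iff_lt, sub_pos]; exact one_div_lt_one_div_of_lt two_pos hθ, by
      field_simp; ring⟩
  refine ⟨δ / C, by positivity, C * (2 + 2 * (|c| / δ)), fun u hu hε => ?_⟩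
  have hA := u.dirichlet_nonneg
  have hB := u.orlicz_nonneg
  set Y := u.dirichlet + u.orlicz with hY
  have hn : ‖u‖ ≤ C * (1 + Y) := by
    refine le_of_sq_le_sq ((h u).trans ?_) (by positivity)
    have h1 : (1 + u.dirichlet) * Y ≤ (1 + Y) ^ 2 := by nlinarith
    have h2 : C * ((1 + u.dirichlet) * Y) ≤ C * (1 + Y) ^ 2 :=
      mul_le_mul_of_nonneg_left h1 (by linarith)
    have h3 : 0 ≤ (C - 1) * (C * (1 + Y) ^ 2) := by
      refine mul_nonneg (by linarith) (by positivity)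
    nlinarith
  have h1 := inner_quasiGrad_self_le u
  have h2 := hK.potential_le_inner u
  have h3 : inner ℝ (u.quasiGrad - hK.grad u) u ≥ -(δ / C * ‖u‖) := by
    have := abs_real_inner_le_norm (u.quasiGrad - hK.grad u) u
    have h4 : ‖u.quasiGrad - hK.grad u‖ * ‖u‖ ≤ δ / C * ‖u‖ :=
      mul_le_mul_of_nonneg_right hε (norm_nonneg _)
    linarith [(abs_le.1 this).1]
  rw [inner_sub_left] at h3
  have h5 : δ / C * ‖u‖ ≤ δ * (1 + Y) := by
    rw [div_mul_eq_mul_div, div_le_iff₀ (by linarith)]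
    nlinarith
  unfold radialEnergy at hu
  have h6 : 1 / 2 * Y - hK.potential u ≤ c := by rw [hY]; linarith
  have h7 : δ * Y ≤ 2 * |c| + δ * 1 := by
    have h8 : θ * (δ * Y) ≤ θ * |c| + δ * (1 + Y) := by
      have h9 : θ * (1 / 2 * Y - hK.potential u) ≤ θ * |c| :=
        mul_le_mul_of_nonneg_left (h6.trans (le_abs_self c)) (by linarith)
      have h10 : θ * (1 / 2 * Y) = θ * (δ * Y) + Y := by
        linear_combination Y * hδθ
      linarith
    have h11 : 0 ≤ δ * Y := by positivity
    have h12 := abs_nonneg c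
    nlinarith
  refine hn.trans ?_
  have h8 : Y ≤ 2 * (|c| / δ) + 1 := by
    rw [← mul_le_mul_iff_right₀ hδ]
    have : δ * (2 * (|c| / δ) + 1) = 2 * |c| + δ * 1 := by field_simp
    rw [this]
    exact h7
  have hC0 : 0 ≤ C := by linarith
  nlinarith

/-- For small norms dirichlet + orlicz is at least a multiple of ‖u‖², while the superlinear term is
at most a multiple of ‖u‖^θ with θ > 2. -/
theorem exists_sphere_bound (hK : IsNonlinearity N V K γ Γ θ) :
    ∃ ρ > 0, ∃ a > 0, ∀ u : RadialSpace N V, ‖u‖ = ρ → a ≤ hK.radialEnergy u := by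
  obtain ⟨C, hC, h⟩ := exists_norm_sq_le_orlicz N V
  obtain ⟨P, hP, hP'⟩ := hK.exists_potential_le (V := V)
  have hθ := hK.two_lt
  have hlim : Tendsto (fun ρ : ℝ => P * ρ ^ (θ - 2)) (𝓝 0) (𝓝 0) := by
    have h1 := (Real.continuousAt_rpow_const 0 (θ - 2) (Or.inr (by linarith))).tendsto
    rw [Real.zero_rpow (by linarith)] at h1
    simpa using h1.const_mul P
  -- If the Dirichlet integral is at most 1, the quadratic part is at least ρ²/(4C). Half of it is
  -- spent on the superlinear term.
  have hC8 : 0 < 1 / (8 * C) := by positivity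
  obtain ⟨δ, hδ, hd⟩ := Metric.eventually_nhds_iff.1 (hlim.eventually (gt_mem_nhds hC8))
  set ρ := min (δ / 2) 1 with hρ
  have hρ0 : 0 < ρ := by positivity
  have hρ1 : ρ ≤ 1 := min_le_right _ _
  have hρd := hd (y := ρ) (by
    rw [Real.dist_eq, sub_zero, abs_of_pos hρ0]
    exact (min_le_left _ _).trans_lt (by linarith))
  refine ⟨ρ, hρ0, 1 / (8 * C) * ρ ^ 2, by positivity, fun u hu => ?_⟩
  have h1 := h u
  have h2 := hP' u (by rw [hu]; exact hρ1)
  have hA := u.dirichlet_nonneg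
  have hB := u.orlicz_nonneg
  have hA1 : u.dirichlet ≤ 1 := by
    have := u.dirichlet_add_orlicz_le
    rw [hu] at this
    nlinarith
  rw [hu] at h1 h2
  have h3 : ρ ^ θ = ρ ^ (θ - 2) * ρ ^ 2 := by
    rw [← Real.rpow_natCast, ← Real.rpow_add hρ0]
    norm_num
  have h4 : hK.potential u ≤ 1 / (8 * C) * ρ ^ 2 := by
    rw [h3, ← mul_assoc] at h2
    exact h2.trans (mul_le_mul_of_nonneg_right hρd.le (sq_nonneg _))
  have h5 : 1 / (8 * C) * ρ ^ 2 ≤ 1 / 4 * (u.dirichlet + u.orlicz) := by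
    rw [div_mul_eq_mul_div, div_le_iff₀ (by positivity)]
    have h6 : C * (1 + u.dirichlet) * (u.dirichlet + u.orlicz)
        ≤ C * 2 * (u.dirichlet + u.orlicz) := by
      gcongr
      linarith
    linarith
  unfold radialEnergy
  linarith

/-- Along the ray through w the quadratic part is at most t² ‖w‖², while the superlinear term grows
at least like t^θ. -/
theorem exists_nonpos_energy (hK : IsNonlinearity N V K γ Γ θ) {w : RadialSpace N V}
    (hw : 0 < hK.potential w) (ρ : ℝ) :
    ∃ e : RadialSpace N V, ρ ≤ ‖e‖ ∧ hK.radialEnergy e ≤ 0 := by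
  have hθ := hK.two_lt
  have hw0 : 0 < ‖w‖ := by
    rw [norm_pos_iff]
    rintro rfl
    simp [potential, eval_zero, hK.primitive_zero] at hw
  have hlim : Tendsto (fun t : ℝ => t ^ (θ - 2) * hK.potential w) atTop atTop :=
    (tendsto_rpow_atTop (by linarith)).atTop_mul_const hw
  obtain ⟨t, ht1, ht2, ht3⟩ := ((hlim.eventually_ge_atTop (‖w‖ ^ 2)).and
    ((eventually_ge_atTop (1 : ℝ)).and (eventually_ge_atTop (ρ / ‖w‖)))).exists
  have ht0 : 0 < t := by linarith
  refine ⟨t • w, ?_, ?_⟩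
  · rw [norm_smul, Real.norm_of_nonneg ht0.le]
    rwa [div_le_iff₀ hw0] at ht3
  · have h1 := (t • w).dirichlet_add_orlicz_le
    rw [norm_smul, Real.norm_of_nonneg ht0.le, mul_pow] at h1
    have h2 : t ^ θ * hK.potential w ≤ hK.potential (t • w) := by
      unfold potential
      rw [← integral_const_mul]
      refine integral_mono ((hK.integrable_primitive w).const_mul _)
        (hK.integrable_primitive _) fun r => ?_
      change t ^ θ * (K r * Γ (w.eval r)) ≤ K r * Γ ((t • w).eval r)
      rw [eval_smul, mul_left_comm]
      exact mul_le_mul_of_nonneg_left (hK.le_primitive_mul _ ht2) (hK.nonneg r)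
    have h3 : t ^ θ = t ^ 2 * t ^ (θ - 2) := by
      rw [← Real.rpow_natCast, ← Real.rpow_add ht0]
      norm_num
    rw [h3, mul_assoc] at h2
    have h4 := mul_le_mul_of_nonneg_left ht1 (sq_nonneg t)
    have h5 := (t • w).dirichlet_nonneg
    have h6 := (t • w).orlicz_nonneg
    unfold radialEnergy
    linarith

theorem exists_critical_of_potential_pos (hK : IsNonlinearity N V K γ Γ θ)
    {w : RadialSpace N V} (hw : 0 < hK.potential w) :
    ∃ u : RadialSpace N V, u ≠ 0 ∧ u.quasiGrad = hK.grad u := by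
  obtain ⟨ρ, hρ, a, ha, hs⟩ := hK.exists_sphere_bound (V := V)
  obtain ⟨e, hρe, he⟩ := hK.exists_nonpos_energy hw ρ
  have h0 : hK.radialEnergy (0 : RadialSpace N V) = 0 := by
    have h1 := dirichlet_add_orlicz_le (0 : RadialSpace N V)
    have h2 := dirichlet_nonneg (0 : RadialSpace N V)
    have h3 := orlicz_nonneg (0 : RadialSpace N V)
    rw [norm_zero] at h1
    have h4 : hK.potential (0 : RadialSpace N V) = 0 := by
      simp [potential, eval_zero, hK.primitive_zero]
    unfold radialEnergy
    rw [h4]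
    linarith
  obtain ⟨u, hu, hpos⟩ := exists_critical_point_of_mountain_pass continuous_quasiGrad
    hK.continuous_grad hK.hasFDerivAt_radialEnergy quasiGrad_strong_mono
    (fun M u hu => hK.exists_subseq_cauchySeq_grad hu) hK.palais_smale_bounded hρ ha h0.le he
    hρe hs
  refine ⟨u, ?_, hu⟩
  rintro rfl
  exact hpos.ne' h0

end IsNonlinearity

/-- Integrability of V u² is automatic for functions vanishing outside a ball: Hardy covers the unit
ball and continuity covers the compact annulus. This makes test functions available. -/
theorem RadialSpace.exists_of_tailIntegral_eq_zero {v : ℝ → ℝ} (hv : MemLp v 2 (radialMeasure N))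
    {R : ℝ} (h0 : ∀ r, R ≤ r → tailIntegral v r = 0) :
    ∃ w : RadialSpace N V, w.deriv =ᵐ[radialMeasure N] v ∧ w.eval = tailIntegral v := by
  refine RadialSpace.exists_deriv_ae_eq hv ?_
  obtain ⟨C, -, h⟩ := exists_hardy N V
  have h1 := (h v hv).1
  have h2 : IntegrableOn (fun r => V r * tailIntegral v r ^ 2) (Set.Icc 1 R)
      (radialMeasure N) := by
    refine ContinuousOn.integrableOn_compact isCompact_Icc ?_
    have hs : Set.Icc (1 : ℝ) R ⊆ Set.Ioi 0 := fun r hr => lt_of_lt_of_le one_pos hr.1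
    exact (hV.continuousOn.mono hs).mul (((continuousOn_tailIntegral hv).mono hs).pow 2)
  have h4 : IntegrableOn (fun r => V r * tailIntegral v r ^ 2) (Set.Ioi R)
      (radialMeasure N) := by
    refine integrableOn_zero.congr_fun (fun r hr => ?_) measurableSet_Ioi
    simp [h0 r (le_of_lt hr)]
  rw [← integrableOn_univ]
  refine ((h1.union h2).union h4).mono_set fun r _ => ?_
  rcases lt_or_ge r 1 with h | h
  · exact Or.inl (Or.inl h)
  · rcases le_or_gt r R with h' | h'
    · exact Or.inl (Or.inr ⟨h, h'⟩)
    · exact Or.inr h'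

/-- A compactly supported radial function that is constant on a ball. -/
theorem exists_eval_eq_const (N : ℕ) [Fact (3 ≤ N)] (V : ℝ → ℝ) [hV : IsPotential V] (c : ℝ) :
    ∃ w : RadialSpace N V, ∀ r ∈ Set.Ioo (0 : ℝ) 2, w.eval r = c := by
  let v : ℝ → ℝ := (Set.Ioc (2 : ℝ) 3).indicator fun _ => -c
  have hv : MemLp v 2 (radialMeasure N) := by
    refine memLp_indicator_const 2 measurableSet_Ioc _ (Or.inr ?_)
    exact ((measure_mono (Set.Ioc_subset_Icc_self)).trans_lt isCompact_Icc.measure_lt_top).ne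
  have h3 : ∀ r, 3 ≤ r → tailIntegral v r = 0 := by
    intro r hr
    rw [tailIntegral_of_pos _ (by linarith), neg_eq_zero]
    refine setIntegral_eq_zero_of_forall_eq_zero fun s hs => ?_
    exact Set.indicator_of_notMem (fun h => absurd (hr.trans_lt hs) (not_lt.2 h.2)) _
  obtain ⟨w, -, hw⟩ := RadialSpace.exists_of_tailIntegral_eq_zero (V := V) hv h3
  refine ⟨w, fun r hr => ?_⟩
  rw [hw, tailIntegral_of_pos _ hr.1, setIntegral_indicator measurableSet_Ioc,
    show Set.Ioi r ∩ Set.Ioc 2 3 = Set.Ioc 2 3 from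
      Set.inter_eq_right.2 fun s hs => hr.2.trans hs.1]
  simp
  norm_num

/-- A cut-off function equal to t on (0, 2) makes the superlinear term positive, since K > 0 and
Γ(t) > 0 there. -/
theorem IsNonlinearity.exists_critical (hK : IsNonlinearity N V K γ Γ θ) (hpos : ∀ r > 0, 0 < K r)
    {t : ℝ} (ht : 0 < Γ t) : ∃ u : RadialSpace N V, u ≠ 0 ∧ u.quasiGrad = hK.grad u := by
  obtain ⟨w, hw⟩ := exists_eval_eq_const N V t
  refine hK.exists_critical_of_potential_pos (w := w) ?_
  refine (integral_pos_iff_support_of_nonneg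
    (fun r => mul_nonneg (hK.nonneg r) (hK.nonneg_primitive _)) (hK.integrable_primitive w)).2 ?_
  refine lt_of_lt_of_le ?_ (measure_mono (s := Set.Ioo 0 2) fun r hr => ?_)
  · rw [pos_iff_ne_zero]
    intro h0
    have h1 := (ae_radialMeasure_iff (N := N) (p := fun r => r ∉ Set.Ioo (0 : ℝ) 2)).1 (by
      rw [ae_iff]
      simp only [not_not]
      exact h0)
    rw [ae_restrict_iff' measurableSet_Ioi, ae_iff] at h1
    have h2 : Set.Ioo (0 : ℝ) 2 ⊆ {a | ¬(a ∈ Set.Ioi (0 : ℝ) → a ∉ Set.Ioo (0 : ℝ) 2)} :=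
      fun r hr h => h hr.1 hr
    have h3 := measure_mono_null h2 h1
    simp at h3
  · exact (mul_pos (hpos r hr.1) (by rw [hw r hr]; exact ht)).ne'

end QLS

namespace QLS

set_option linter.unusedSectionVars false

/-! ### Subcritical nonlinearities -/

/-- The domination of `K γ` on the set `S` of radii, as required of an `IsNonlinearity`. -/
def IsDominatedOn (N : ℕ) (V K γ : ℝ → ℝ) (M ε : ℝ) (S : Set ℝ) : Prop :=
  ∃ ρ : ℝ → ℝ, (∀ r, 0 ≤ ρ r) ∧ Integrable ρ (radialMeasure N) ∧
    ∀ r ∈ S, ∀ t a b : ℝ, |t| ≤ a → a ≤ M * r ^ (-decay N) → 0 ≤ b → b ≤ M * r ^ (-decay N) →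
      K r * |γ t| * b ≤ ρ r + ε * (V r * (a + b) ^ 2)

theorem IsDominatedOn.union {N : ℕ} {V K γ : ℝ → ℝ} {M ε : ℝ} {S T : Set ℝ}
    (hS : IsDominatedOn N V K γ M ε S) (hT : IsDominatedOn N V K γ M ε T) :
    IsDominatedOn N V K γ M ε (S ∪ T) := by
  obtain ⟨ρ, h0, hi, h⟩ := hS
  obtain ⟨ρ', h0', hi', h'⟩ := hT
  refine ⟨fun r => ρ r + ρ' r, fun r => add_nonneg (h0 r) (h0' r), hi.add hi', ?_⟩
  rintro r (hr | hr) t a b h1 h2 h3 h4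
  · linarith [h r hr t a b h1 h2 h3 h4, h0' r]
  · linarith [h' r hr t a b h1 h2 h3 h4, h0 r]

variable {N : ℕ} [hN : Fact (3 ≤ N)] {V K γ Γ : ℝ → ℝ} {θ : ℝ} [hV : IsPotential V]

theorem integrable_indicator_rpow_Ioo {s R : ℝ} (hs : 0 < s + N) (hR : 0 < R) :
    Integrable ((Set.Ioo 0 R).indicator fun r : ℝ => r ^ s) (radialMeasure N) := by
  rw [integrable_radialMeasure_iff]
  have h1 : IntegrableOn (fun r : ℝ => r ^ (s + N - 1)) (Set.Ioo 0 R) := by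
    rw [intervalIntegral.integrableOn_Ioo_rpow_iff hR]
    linarith
  have h2 := ((integrable_indicator_iff measurableSet_Ioo).2 h1).integrableOn (s := Set.Ioi 0)
  refine h2.congr_fun (fun r hr => ?_) measurableSet_Ioi
  by_cases h : r ∈ Set.Ioo 0 R
  · rw [Set.indicator_of_mem h, Set.indicator_of_mem h, pow_sub_one_eq_rpow,
      ← Real.rpow_add hr]
    ring_nf
  · rw [Set.indicator_of_notMem h, Set.indicator_of_notMem h, mul_zero]

theorem integrable_indicator_rpow_Ioi {s R : ℝ} (hs : s + N < 0) (hR : 0 < R) :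
    Integrable ((Set.Ioi R).indicator fun r : ℝ => r ^ s) (radialMeasure N) := by
  rw [integrable_radialMeasure_iff]
  have h1 : IntegrableOn (fun r : ℝ => r ^ (s + N - 1)) (Set.Ioi R) :=
    integrableOn_Ioi_rpow_of_lt (by linarith) hR
  have h2 := ((integrable_indicator_iff measurableSet_Ioi).2 h1).integrableOn (s := Set.Ioi 0)
  refine h2.congr_fun (fun r hr => ?_) measurableSet_Ioi
  by_cases h : r ∈ Set.Ioi R
  · rw [Set.indicator_of_mem h, Set.indicator_of_mem h, pow_sub_one_eq_rpow,
      ← Real.rpow_add hr]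
    ring_nf
  · rw [Set.indicator_of_notMem h, Set.indicator_of_notMem h, mul_zero]

/-- On a compact annulus K, γ(t) and b are all bounded, so a constant serves as ρ. -/
theorem isDominatedOn_Icc (hK : ContinuousOn K (Set.Ioi 0)) (hγ : Continuous γ) {M ε : ℝ}
    (hM : 0 < M) (hε : 0 < ε) {R₀ R : ℝ} (hR₀ : 0 < R₀) :
    IsDominatedOn N V K γ M ε (Set.Icc R₀ R) := by
  have hκ := decay_pos (N := N)
  obtain ⟨A, hA⟩ := isCompact_Icc.exists_bound_of_continuousOn
    (hK.mono fun r (hr : r ∈ Set.Icc R₀ R) => hR₀.trans_le hr.1)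
  set L := M * R₀ ^ (-decay N) with hL
  have hL0 : 0 < L := by positivity
  obtain ⟨B, hB⟩ := (isCompact_Icc (a := -L) (b := L)).exists_bound_of_continuousOn
    hγ.continuousOn
  refine ⟨(Set.Icc R₀ R).indicator fun _ => |A| * |B| * L, fun r => ?_, ?_, ?_⟩
  · exact Set.indicator_nonneg (fun _ _ => by positivity) _
  · rw [integrable_indicator_iff measurableSet_Icc]
    exact integrableOn_const (isCompact_Icc.measure_lt_top.ne)
  · intro r hr t a b h1 h2 h3 h4
    rw [Set.indicator_of_mem hr]
    have hr0 : 0 < r := hR₀.trans_le hr.1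
    have h5 : M * r ^ (-decay N) ≤ L := by
      refine mul_le_mul_of_nonneg_left ?_ hM.le
      exact Real.rpow_le_rpow_of_nonpos hR₀ hr.1 (by linarith)
    have h6 : |γ t| ≤ |B| := (hB t (abs_le.1 (h1.trans (h2.trans h5)))).trans (le_abs_self B)
    have h7 : K r ≤ |A| := (le_abs_self _).trans ((hA r hr).trans (le_abs_self A))
    have h8 : K r * |γ t| * b ≤ |A| * |B| * L := by
      have : K r * |γ t| ≤ |A| * |B| := mul_le_mul h7 h6 (abs_nonneg _) (abs_nonneg _)
      exact mul_le_mul this (h4.trans h5) h3 (by positivity)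
    have h9 : 0 ≤ ε * (V r * (a + b) ^ 2) := by
      have := hV.nonneg r
      positivity
    linarith

/-- A bound on `|f|^{q-1} f'`. -/
theorem rpow_change_div_sqrt_le {q p : ℝ} (hq : 1 ≤ q) (hqp : q ≤ p) (hp : 2 ≤ p) (t : ℝ) :
    |change t| ^ (q - 1) / √(1 + 2 * change t ^ 2) ≤ (1 + 4 * |t|) ^ ((p - 2) / 2) := by
  have hs1 := one_le_sqrt_aux (change t)
  have hs0 := sqrt_change_pos t
  have hs2 := sqrt_change_sq t
  have hsc := abs_change_le_sqrt t
  set s := √(1 + 2 * change t ^ 2)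
  calc |change t| ^ (q - 1) / s ≤ s ^ (q - 1) / s := by
        gcongr
    _ = s ^ (q - 2) := by
        rw [div_eq_iff hs0.ne', ← Real.rpow_add_one hs0.ne']
        ring_nf
    _ ≤ s ^ (p - 2) := Real.rpow_le_rpow_of_exponent_le hs1 (by linarith)
    _ = (s ^ 2) ^ ((p - 2) / 2) := by
        rw [← Real.rpow_natCast, ← Real.rpow_mul hs0.le]
        congr 1
        push_cast
        ring
    _ ≤ _ := by
        have h1 := change_sq_le_two_mul_abs t
        refine Real.rpow_le_rpow (sq_nonneg _) ?_ (by linarith)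
        rw [hs2]
        linarith

/-- Near the origin the term with ε is not needed. V^{β₀} costs r^{-2β₀}, γ(t) costs at most
r^{-κ(p-2)/2} with p = max(q₁, 2), and b costs r^{-κ}, where κ = `decay N`. The product is a single
power of r, integrable by `hs`. -/
theorem isDominatedOn_Ioo {C q₁ α₀ β₀ Λ R : ℝ} (hC : 0 ≤ C) (hβ : 0 ≤ β₀) (hR : 0 < R)
    (hR1 : R ≤ 1) (hq : 1 ≤ q₁) (hK0 : ∀ r, 0 ≤ K r)
    (hK : ∀ r ∈ Set.Ioo 0 R, K r ≤ Λ * (r ^ α₀ * V r ^ β₀))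
    (hγ : ∀ t, |γ t| ≤ C * (|change t| ^ (q₁ - 1) / √(1 + 2 * change t ^ 2)))
    (hs : ∀ p : ℝ, p = q₁ ∨ p = 2 → 0 < α₀ - 2 * β₀ - decay N * p / 2 + N)
    {M ε : ℝ} (hM : 0 < M) (hε : 0 < ε) : IsDominatedOn N V K γ M ε (Set.Ioo 0 R) := by
  obtain ⟨CV, hCV, hVb⟩ := hV.bound
  have hκ := decay_pos (N := N)
  set p := max q₁ 2 with hp
  have hp' := hs p (max_choice q₁ 2)
  have hp2 : 2 ≤ p := le_max_right _ _
  set C₁ := |Λ| * CV ^ β₀ * (C * (1 + 4 * M) ^ ((p - 2) / 2)) * M with hC₁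
  have hC₁0 : 0 ≤ C₁ := by positivity
  refine ⟨fun r => C₁ * (Set.Ioo 0 R).indicator
    (fun r => r ^ (α₀ - 2 * β₀ - decay N * p / 2)) r, fun r => ?_, ?_, ?_⟩
  · refine mul_nonneg hC₁0 (Set.indicator_nonneg (fun r hr => ?_) _)
    exact Real.rpow_nonneg hr.1.le _
  · exact (integrable_indicator_rpow_Ioo hp' hR).const_mul _
  · intro r hr t a b h1 h2 h3 h4
    have hr0 := hr.1
    beta_reduce
    rw [Set.indicator_of_mem hr]
    have h5 : K r ≤ |Λ| * CV ^ β₀ * r ^ (α₀ - 2 * β₀) := by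
      have hVr : V r ^ β₀ ≤ CV ^ β₀ * r ^ (-2 * β₀) := by
        have h6 := Real.rpow_le_rpow (hV.nonneg r) (hVb r ⟨hr0, hr.2.trans_le hR1⟩) hβ
        refine h6.trans (le_of_eq ?_)
        rw [Real.rpow_mul hr0.le, ← Real.mul_rpow hCV.le (Real.rpow_nonneg hr0.le _),
          Real.rpow_neg hr0.le, div_eq_mul_inv]
        norm_cast
      calc K r ≤ Λ * (r ^ α₀ * V r ^ β₀) := hK r hr
        _ ≤ |Λ| * (r ^ α₀ * V r ^ β₀) := by
            refine mul_le_mul_of_nonneg_right (le_abs_self _) ?_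
            exact mul_nonneg (Real.rpow_nonneg hr0.le _) (Real.rpow_nonneg (hV.nonneg r) _)
        _ ≤ |Λ| * (r ^ α₀ * (CV ^ β₀ * r ^ (-2 * β₀))) := by gcongr
        _ = |Λ| * CV ^ β₀ * (r ^ α₀ * r ^ (-2 * β₀)) := by ring
        _ = _ := by
            rw [← Real.rpow_add hr0]
            ring_nf
    have hrκ : 1 ≤ r ^ (-decay N) := Real.one_le_rpow_of_pos_of_le_one_of_nonpos hr0
      (hr.2.le.trans hR1) (by linarith)
    have h6 : |γ t| ≤ C * (1 + 4 * M) ^ ((p - 2) / 2) * r ^ (-decay N * ((p - 2) / 2)) := by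
      refine (hγ t).trans ?_
      rw [mul_assoc]
      refine mul_le_mul_of_nonneg_left ?_ hC
      refine (rpow_change_div_sqrt_le hq (le_max_left _ _) hp2 t).trans ?_
      rw [Real.rpow_mul hr0.le, ← Real.mul_rpow (by positivity) (by positivity)]
      refine Real.rpow_le_rpow (by positivity) ?_ (by linarith)
      have := h1.trans h2
      linarith
    have h7 : K r * |γ t| * b ≤ C₁ * r ^ (α₀ - 2 * β₀ - decay N * p / 2) := by
      calc K r * |γ t| * b ≤ (|Λ| * CV ^ β₀ * r ^ (α₀ - 2 * β₀))
            * (C * (1 + 4 * M) ^ ((p - 2) / 2) * r ^ (-decay N * ((p - 2) / 2)))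
            * (M * r ^ (-decay N)) := by
            have := hK0 r
            gcongr
        _ = C₁ * (r ^ (α₀ - 2 * β₀) * r ^ (-decay N * ((p - 2) / 2)) * r ^ (-decay N)) := by
            rw [hC₁]
            ring
        _ = _ := by
            rw [← Real.rpow_add hr0, ← Real.rpow_add hr0]
            ring_nf
    have h9 : 0 ≤ ε * (V r * (a + b) ^ 2) := by
      have := hV.nonneg r
      positivity
    linarith

/-- At infinity V has no upper bound, so V^β is kept together with z^{2β} as (V z²)^β, where z = a +
b. The remaining power z^{q₂-2β} decays, and Young's inequality splits the product into V z² and an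
integrable power. -/
theorem isDominatedOn_Ioi {C q₂ α β Λ R₂ : ℝ} (hC : 0 ≤ C) (hβ : 0 ≤ β) (hβ1 : β ≤ 1)
    (hq1 : 1 < q₂) (hq : 2 * β < q₂) (hK0 : ∀ r, 0 ≤ K r)
    (hK : ∀ r ∈ Set.Ioi R₂, K r ≤ Λ * (r ^ α * V r ^ β))
    (hγ : ∀ t, |γ t| ≤ C * |t| ^ (q₂ - 1)) (hs : α + N - 2 * β < decay N * q₂)
    {M ε : ℝ} (hM : 0 < M) (hε : 0 < ε) : ∃ R, IsDominatedOn N V K γ M ε (Set.Ioi R) := by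
  have hκ := decay_pos (N := N)
  have hκN : decay N = ((N : ℝ) - 2) / 2 := rfl
  -- The surplus decay 2δ is halved: one δ makes r^{-N-δ} integrable at infinity, the other gives
  -- the factor r^{-δ} that becomes small. Substituting κ = (N - 2)/2 shows that `hs` is exactly δ >
  -- 0.
  obtain ⟨δ, hδ⟩ : ∃ δ, 2 * δ = decay N * (q₂ - 2 * β) - α - N * (1 - β) := ⟨_, by
    rw [mul_div_cancel₀ _ (two_ne_zero' ℝ)]⟩
  have hδ0 : 0 < δ := by
    rw [hκN] at hs hδ
    nlinarith
  set C₃ := |Λ| * C * (2 * M) ^ (q₂ - 2 * β) with hC₃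
  have hC₃0 : 0 ≤ C₃ := by positivity
  have hlim : Tendsto (fun r : ℝ => C₃ * r ^ (-δ)) atTop (𝓝 0) := by
    simpa using (tendsto_rpow_neg_atTop hδ0).const_mul C₃
  obtain ⟨R, hR⟩ := eventually_atTop.1 (hlim.eventually (gt_mem_nhds hε))
  set R' := max (max R R₂) 1 with hR'
  have hR'1 : 1 ≤ R' := le_max_right _ _
  refine ⟨R', fun r => ε * (Set.Ioi R').indicator (fun r => r ^ (-N - δ)) r, fun r => ?_, ?_, ?_⟩
  · refine mul_nonneg hε.le (Set.indicator_nonneg (fun r hr => ?_) _)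
    have hr : R' < r := hr
    exact Real.rpow_nonneg (by linarith) _
  · exact (integrable_indicator_rpow_Ioi (by linarith) (by linarith)).const_mul _
  · intro r hr t a b h1 h2 h3 h4
    beta_reduce
    rw [Set.indicator_of_mem hr]
    have hr' : R' < r := hr
    have hr1 : 1 < r := by linarith
    have hr0 : 0 < r := by linarith
    have hrR : R ≤ r := ((le_max_left _ _).trans (le_max_left _ _)).trans hr'.le
    have hrR₂ : R₂ < r := ((le_max_right _ _).trans (le_max_left _ _)).trans_lt hr'
    have ha : 0 ≤ a := (abs_nonneg t).trans h1
    set z := a + b with hz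
    have hz0 : 0 ≤ z := add_nonneg ha h3
    have hzM : z ≤ 2 * M * r ^ (-decay N) := by linarith
    have hV0 := hV.nonneg r
    set X := V r * z ^ 2 with hX
    have hX0 : 0 ≤ X := by positivity
    have h5 : K r * |γ t| * b ≤ |Λ| * C * (r ^ α * V r ^ β * z ^ q₂) := by
      have h6 : |γ t| ≤ C * z ^ (q₂ - 1) := by
        refine (hγ t).trans (mul_le_mul_of_nonneg_left ?_ hC)
        exact Real.rpow_le_rpow (abs_nonneg _) (by linarith) (by linarith)
      have h7 : K r ≤ |Λ| * (r ^ α * V r ^ β) := by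
        refine (hK r hrR₂).trans (mul_le_mul_of_nonneg_right (le_abs_self _) ?_)
        positivity
      calc K r * |γ t| * b ≤ (|Λ| * (r ^ α * V r ^ β)) * (C * z ^ (q₂ - 1)) * z := by
            have := hK0 r
            gcongr
            linarith
        _ = |Λ| * C * (r ^ α * V r ^ β * (z ^ (q₂ - 1) * z)) := by ring
        _ = _ := by
            have : z ^ (q₂ - 1) * z = z ^ q₂ := by
              have := Real.rpow_add_of_nonneg hz0 (show 0 ≤ q₂ - 1 by linarith) zero_le_one
              rw [Real.rpow_one] at this
              rw [← this]
              ring_nf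
            rw [this]
    have h8 : r ^ α * V r ^ β * z ^ q₂
        ≤ (2 * M) ^ (q₂ - 2 * β) * (X ^ β * r ^ (α - decay N * (q₂ - 2 * β))) := by
      have h9 : z ^ q₂ = z ^ (2 * β) * z ^ (q₂ - 2 * β) := by
        rw [← Real.rpow_add_of_nonneg hz0 (by linarith) (by linarith)]
        ring_nf
      have h10 : V r ^ β * z ^ (2 * β) = X ^ β := by
        rw [hX, Real.mul_rpow hV0 (sq_nonneg z), Real.rpow_mul hz0]
        norm_cast
      have h11 : z ^ (q₂ - 2 * β)
          ≤ (2 * M) ^ (q₂ - 2 * β) * r ^ (-decay N * (q₂ - 2 * β)) := by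
        rw [Real.rpow_mul hr0.le, ← Real.mul_rpow (by positivity) (by positivity)]
        exact Real.rpow_le_rpow hz0 hzM (by linarith)
      calc r ^ α * V r ^ β * z ^ q₂ = r ^ α * X ^ β * z ^ (q₂ - 2 * β) := by
            rw [h9, ← h10]
            ring
        _ ≤ r ^ α * X ^ β * ((2 * M) ^ (q₂ - 2 * β) * r ^ (-decay N * (q₂ - 2 * β))) := by
            gcongr
        _ = (2 * M) ^ (q₂ - 2 * β) * (X ^ β * (r ^ α * r ^ (-decay N * (q₂ - 2 * β)))) := by ring
        _ = _ := by
            rw [← Real.rpow_add hr0]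
            ring_nf
    have h12 : X ^ β * r ^ (α - decay N * (q₂ - 2 * β)) ≤ r ^ (-δ) * (X + r ^ (-N - δ)) := by
      -- Weighted arithmetic-geometric mean inequality with weights β and 1 - β. The weights are
      -- then dropped, being at most 1.
      have h13 := Real.geom_mean_le_arith_mean2_weighted hβ (show 0 ≤ 1 - β by linarith) hX0
        (show 0 ≤ r ^ (-N - δ) from Real.rpow_nonneg hr0.le _) (by ring)
      have hY0 : 0 ≤ r ^ (-N - δ) := Real.rpow_nonneg hr0.le _
      have h14 : X ^ β * (r ^ (-N - δ)) ^ (1 - β) ≤ X + r ^ (-N - δ) :=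
        h13.trans (by nlinarith)
      have h15 : r ^ (α - decay N * (q₂ - 2 * β))
          ≤ (r ^ (-N - δ)) ^ (1 - β) * r ^ (-δ) := by
        rw [← Real.rpow_mul hr0.le, ← Real.rpow_add hr0]
        refine Real.rpow_le_rpow_of_exponent_le hr1.le ?_
        nlinarith
      calc _ ≤ X ^ β * ((r ^ (-N - δ)) ^ (1 - β) * r ^ (-δ)) := by gcongr
        _ = r ^ (-δ) * (X ^ β * (r ^ (-N - δ)) ^ (1 - β)) := by ring
        _ ≤ _ := by gcongr
    have h16 : C₃ * r ^ (-δ) ≤ ε := (hR r hrR).le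
    calc K r * |γ t| * b ≤ |Λ| * C * ((2 * M) ^ (q₂ - 2 * β)
          * (r ^ (-δ) * (X + r ^ (-N - δ)))) := by
          refine h5.trans (mul_le_mul_of_nonneg_left (h8.trans ?_) (by positivity))
          gcongr
      _ = C₃ * r ^ (-δ) * (X + r ^ (-N - δ)) := by rw [hC₃]; ring
      _ ≤ ε * (X + r ^ (-N - δ)) := by gcongr
      _ = _ := by ring

theorem primitive_hasDerivAt {g : ℝ → ℝ} (hg : Continuous g) (t : ℝ) :
    HasDerivAt (primitive g) (g t) t :=
  intervalIntegral.integral_hasDerivAt_right (hg.intervalIntegrable _ _)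
    hg.stronglyMeasurable.stronglyMeasurableAtFilter hg.continuousAt

/-- The exponent q₁ is used near the origin and q₂ near infinity, each by taking the corresponding
entry of the minimum. The region in between needs only continuity. -/
theorem isNonlinearity_of_growth {g : ℝ → ℝ} {q₁ q₂ R₁ α₀ β₀ R₂ αi βi : ℝ}
    (hKc : ContinuousOn K (Set.Ioi 0)) (hK0 : ∀ r, 0 ≤ K r) (hKz : ∀ r ≤ 0, K r = 0)
    (hg : Continuous g) (hθ : 2 < θ)
    (hg1 : ∀ t, 0 ≤ 2 * θ * primitive g t ∧ 2 * θ * primitive g t ≤ g t * t)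
    (hgq : HypGrowth g q₁ q₂) (hR₁ : 0 < R₁) (hβ₀ : 0 ≤ β₀) (hα₀ : alphaStar N β₀ < α₀)
    (hK₀ : RatioBounded V K (Set.Ioo 0 R₁) α₀ β₀)
    (hq₁ : max 1 (2 * β₀) < q₁) (hq₁' : q₁ < qZeroStar N α₀ β₀)
    (hβi : 0 ≤ βi) (hβi' : βi ≤ 1) (hKi : RatioBounded V K (Set.Ioi R₂) αi βi)
    (hq₂ : max 1 (max (2 * βi) (qInftyStar N αi βi)) < q₂) :
    IsNonlinearity N V K (fun t => g (change t) * (1 / √(1 + 2 * change t ^ 2)))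
      (fun t => primitive g (change t)) θ where
  measurable := measurable_of_continuousOn_Ioi hKc hKz
  nonneg := hK0
  continuous := by
    have h1 := continuous_change
    refine (hg.comp h1).mul (continuous_const.div (by fun_prop) fun t => (sqrt_change_pos t).ne')
  hasDerivAt t := (primitive_hasDerivAt hg (change t)).comp t (change_hasDerivAt t)
  two_lt := hθ
  primitive_nonneg t := by
    have := (hg1 (change t)).1
    linarith
  superquadratic t := by
    have h1 := hg1 (change t)
    by_cases hf : change t = 0
    · have ht : t = 0 := strictMono_change.injective (hf.trans change_zero.symm)
      have h2 := h1.2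
      rw [hf, mul_zero] at h2
      simp only [ht, change_zero, mul_zero]
      linarith
    -- Multiplying f² ≤ 2 f f' t by g(f) f ≥ 0 and cancelling f² gives g(f) f ≤ 2 γ(t) t, so the
    -- constant 2θ for g becomes θ for γ.
    · have h2 := change_sq_le_two_phi_mul t
      have hf2 : 0 < change t ^ 2 := by positivity
      have h3 : 0 ≤ g (change t) * change t := h1.1.trans h1.2
      have h4 := mul_le_mul_of_nonneg_left h2 h3
      have h5 : g (change t) * change t * (2 * (phi t * t))
          = 2 * (g (change t) * (1 / √(1 + 2 * change t ^ 2)) * t) * change t ^ 2 := by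
        rw [phi]
        ring
      rw [h5] at h4
      have h6 := le_of_mul_le_mul_right h4 hf2
      change θ * primitive g (change t) ≤ g (change t) * (1 / √(1 + 2 * change t ^ 2)) * t
      linarith [h1.2]
  dominated M hM ε hε := by
    obtain ⟨C, hC, hgC⟩ := hgq
    obtain ⟨Λ₀, hΛ₀⟩ := hK₀
    obtain ⟨Λi, hΛi⟩ := hKi
    have hN3 := three_le_cast (N := N)
    have hκN : decay N = ((N : ℝ) - 2) / 2 := rfl
    have hq₁1 : 1 < q₁ := (le_max_left _ _).trans_lt hq₁
    have hq₂1 : 1 < q₂ := (le_max_left _ _).trans_lt hq₂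
    have hq₂2 : 2 * βi < q₂ := ((le_max_left _ _).trans (le_max_right _ _)).trans_lt hq₂
    have hq₂3 : qInftyStar N αi βi < q₂ :=
      ((le_max_right _ _).trans (le_max_right _ _)).trans_lt hq₂
    set γ : ℝ → ℝ := fun t => g (change t) * (1 / √(1 + 2 * change t ^ 2)) with hγ
    have hγc : Continuous γ := by
      have h1 := continuous_change
      refine (hg.comp h1).mul
        (continuous_const.div (by fun_prop) fun t => (sqrt_change_pos t).ne')
    have hγa : ∀ t, |γ t| = |g (change t)| / √(1 + 2 * change t ^ 2) := fun t => by
      rw [hγ]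
      simp only []
      rw [abs_mul, abs_of_pos (one_div_pos.2 (sqrt_change_pos t)), mul_one_div]
    have h0 : IsDominatedOn N V K γ M ε (Set.Ioo 0 (min R₁ 1)) := by
      refine isDominatedOn_Ioo (q₁ := q₁) (α₀ := α₀) (β₀ := β₀) (Λ := Λ₀) hC.le hβ₀
        (lt_min hR₁ one_pos) (min_le_right _ _) hq₁1.le hK0
        (fun r hr => hΛ₀ r ⟨hr.1, hr.2.trans_le (min_le_left _ _)⟩) (fun t => ?_) ?_ hM hε
      · rw [hγa, ← mul_div_assoc]
        refine div_le_div_of_nonneg_right ((hgC _).trans ?_) (sqrt_change_pos t).le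
        exact mul_le_mul_of_nonneg_left (min_le_left _ _) hC.le
      · have h1 := (le_max_left _ _).trans_lt hα₀
        have h2 := (le_max_right _ _).trans_lt hα₀
        rw [qZeroStar, lt_div_iff₀ (by linarith)] at hq₁'
        -- The case p = q₁ follows from q₁ < q₀* and the second branch of α*, the case p = 2 from
        -- the first branch.
        rintro p (rfl | rfl)
        · rw [hκN]
          nlinarith
        · rw [hκN]
          nlinarith
    obtain ⟨R, hR⟩ := isDominatedOn_Ioi (N := N) (V := V) (K := K) (γ := γ) (q₂ := q₂) (α := αi)
      (β := βi) (Λ := Λi) (R₂ := R₂) hC.le hβi hβi' hq₂1 hq₂2 hK0 hΛi (fun t => by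
        rw [hγa]
        refine (div_le_self (abs_nonneg _) (one_le_sqrt_aux _)).trans ((hgC _).trans ?_)
        refine mul_le_mul_of_nonneg_left ((min_le_right _ _).trans ?_) hC.le
        exact Real.rpow_le_rpow (abs_nonneg _) (abs_change_le t) (by linarith)) (by
        rw [qInftyStar, ← mul_div_assoc, div_lt_iff₀ (by linarith)] at hq₂3
        rw [hκN]
        linarith) hM hε
    obtain ⟨ρ, -, hρ, h⟩ := (h0.union (isDominatedOn_Icc hKc hγc hM hε
      (R₀ := min R₁ 1) (R := R) (lt_min hR₁ one_pos))).union hR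
    refine ⟨ρ, hρ, fun r hr => h r ?_⟩
    rcases lt_or_ge r (min R₁ 1) with h1 | h1
    · exact Or.inl (Or.inl ⟨hr, h1⟩)
    · rcases le_or_gt r R with h2 | h2
      · exact Or.inl (Or.inr ⟨h1, h2⟩)
      · exact Or.inr h2

/-! ### Truncation of the nonlinearity at zero -/

theorem HypGrowth.zero {g : ℝ → ℝ} {q₁ q₂ : ℝ} (h : HypGrowth g q₁ q₂) (hq₁ : 1 < q₁) :
    g 0 = 0 := by
  obtain ⟨C, hC, hb⟩ := h
  have h1 := hb 0
  rw [abs_zero, Real.zero_rpow (by linarith)] at h1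
  have h2 : C * min 0 ((0 : ℝ) ^ (q₂ - 1)) ≤ 0 :=
    mul_nonpos_of_nonneg_of_nonpos hC.le (min_le_left _ _)
  exact abs_eq_zero.1 (le_antisymm (h1.trans h2) (abs_nonneg _))

theorem HypGrowth.comp_max {g : ℝ → ℝ} {q₁ q₂ : ℝ} (h : HypGrowth g q₁ q₂) (hq₁ : 1 ≤ q₁)
    (hq₂ : 1 ≤ q₂) : HypGrowth (fun t => g (max t 0)) q₁ q₂ := by
  obtain ⟨C, hC, hb⟩ := h
  refine ⟨C, hC, fun t => (hb _).trans (mul_le_mul_of_nonneg_left ?_ hC.le)⟩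
  have h1 : |max t 0| ≤ |t| := by
    rw [abs_of_nonneg (le_max_right _ _)]
    exact max_le (le_abs_self t) (abs_nonneg t)
  exact min_le_min (Real.rpow_le_rpow (abs_nonneg _) h1 (by linarith))
    (Real.rpow_le_rpow (abs_nonneg _) h1 (by linarith))

theorem primitive_comp_max {g : ℝ → ℝ} (h0 : g 0 = 0) (t : ℝ) :
    primitive (fun t => g (max t 0)) t = primitive g (max t 0) := by
  rcases le_total 0 t with h | h
  · rw [max_eq_left h]
    refine intervalIntegral.integral_congr fun s hs => ?_
    rw [Set.uIcc_of_le h] at hs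
    simp only [max_eq_left hs.1]
  · rw [max_eq_right h]
    unfold primitive
    rw [intervalIntegral.integral_same]
    refine (intervalIntegral.integral_congr (g := fun _ => 0) fun s hs => ?_).trans (by simp)
    rw [Set.uIcc_of_ge h] at hs
    simp only [max_eq_right hs.2, h0]

theorem superquadratic_comp_max {g : ℝ → ℝ} (h0 : g 0 = 0)
    (hg1 : ∀ t, 0 ≤ 2 * θ * primitive g t ∧ 2 * θ * primitive g t ≤ g t * t) (t : ℝ) :
    0 ≤ 2 * θ * primitive (fun t => g (max t 0)) t ∧
      2 * θ * primitive (fun t => g (max t 0)) t ≤ g (max t 0) * t := by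
  rw [primitive_comp_max h0]
  refine ⟨(hg1 _).1, (hg1 _).2.trans ?_⟩
  rcases le_total 0 t with h | h
  · rw [max_eq_left h]
  · rw [max_eq_right h, h0, zero_mul, zero_mul]

end QLS

namespace QLS

set_option linter.unusedSectionVars false

/-! ### Regularity and sign of critical points -/

/-- Lebesgue differentiation: almost everywhere z is the derivative of its primitive, which is
identically zero. -/
theorem ae_eq_zero_of_intervalIntegral {z : ℝ → ℝ}
    (hz : ∀ b > 0, IntervalIntegrable z volume 0 b) (h : ∀ b > 0, ∫ s in (0 : ℝ)..b, z s = 0) :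
    ∀ᵐ s ∂(volume.restrict (Set.Ioi 0)), z s = 0 := by
  rw [ae_restrict_iff' measurableSet_Ioi]
  have h1 : ∀ n : ℕ, ∀ᵐ x : ℝ, x ∈ Set.uIcc (0 : ℝ) (n + 1) → ∀ c ∈ Set.uIcc (0 : ℝ) (n + 1),
      HasDerivAt (fun x => ∫ y in c..x, z y) (z x) x := fun n =>
    (hz (n + 1) (by positivity)).ae_hasDerivAt_integral
  filter_upwards [ae_all_iff.2 h1] with x hx hx0
  obtain ⟨n, hn⟩ := exists_nat_ge x
  have h2 := hx n (by
    rw [Set.uIcc_of_le (by positivity)]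
    exact ⟨le_of_lt hx0, by linarith⟩) 0 Set.left_mem_uIcc
  refine h2.unique ((hasDerivAt_const x (0 : ℝ)).congr_of_eventuallyEq ?_)
  filter_upwards [lt_mem_nhds hx0] with y hy
  exact h y hy

theorem setIntegral_Ioc_eq_indicator (F : ℝ → ℝ) (a : ℝ) :
    ∫ r in Set.Ioc 0 a, F r = ∫ r in Set.Ioi 0, (Set.Ioc 0 a).indicator F r := by
  rw [setIntegral_indicator measurableSet_Ioc, Set.inter_eq_right.2 Set.Ioc_subset_Ioi_self]

theorem hasDerivAt_tailIntegral {v : ℝ → ℝ} (hv : ∀ r > 0, IntegrableOn v (Set.Ioi r))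
    (hc : ContinuousOn v (Set.Ioi 0)) {r : ℝ} (hr : 0 < r) :
    HasDerivAt (tailIntegral v) (v r) r := by
  have hr2 : 0 < r / 2 := by positivity
  have h1 : HasDerivAt (fun x => (∫ s in (r / 2)..x, v s) - ∫ s in Set.Ioi (r / 2), v s)
      (v r) r := by
    refine (intervalIntegral.integral_hasDerivAt_right ?_ ?_
      (hc.continuousAt (Ioi_mem_nhds hr))).sub_const _
    · rw [intervalIntegrable_iff_integrableOn_Ioc_of_le (by linarith)]
      exact (hv _ hr2).mono_set Set.Ioc_subset_Ioi_self
    · exact hc.stronglyMeasurableAtFilter isOpen_Ioi r hr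
  refine h1.congr_of_eventuallyEq ?_
  filter_upwards [lt_mem_nhds (show r / 2 < r by linarith)] with x hx
  have hx0 : 0 < x := hr2.trans hx
  rw [tailIntegral_of_pos _ hx0, intervalIntegral.integral_of_le hx.le,
    ← Set.Ioc_union_Ioi_eq_Ioi hx.le, setIntegral_union (by
      rw [Set.disjoint_left]
      exact fun s hs hs' => absurd hs.2 (not_le.2 hs')) measurableSet_Ioi
      ((hv _ hr2).mono_set Set.Ioc_subset_Ioi_self) (hv _ hx0)]
  ring

variable {N : ℕ} [hN : Fact (3 ≤ N)] {V K γ Γ : ℝ → ℝ} {θ : ℝ} [hV : IsPotential V]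

open RadialSpace

variable (N V) in
/-- The radial functions `r ↦ -(a - r)⁺`. -/
theorem RadialSpace.exists_truncated_affine {a : ℝ} (ha : 0 < a) :
    ∃ w : RadialSpace N V, w.deriv =ᵐ[radialMeasure N] (Set.Ioc 0 a).indicator (fun _ => 1) ∧
      ∀ r > 0, w.eval r = -(max (a - r) 0) := by
  have hv : MemLp ((Set.Ioc 0 a).indicator fun _ => (1 : ℝ)) 2 (radialMeasure N) := by
    refine memLp_indicator_const 2 measurableSet_Ioc _ (Or.inr ?_)
    exact ((measure_mono (Set.Ioc_subset_Icc_self)).trans_lt isCompact_Icc.measure_lt_top).ne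
  have h3 : ∀ r > 0, tailIntegral ((Set.Ioc 0 a).indicator fun _ => (1 : ℝ)) r
      = -(max (a - r) 0) := by
    intro r hr
    rw [tailIntegral_of_pos _ hr, setIntegral_indicator measurableSet_Ioc,
      show Set.Ioi r ∩ Set.Ioc 0 a = Set.Ioc r a from Set.ext fun s =>
        ⟨fun h => ⟨h.1, h.2.2⟩, fun h => ⟨h.1, hr.trans h.1, h.2⟩⟩]
    simp [Measure.real, ENNReal.toReal_ofReal']
  obtain ⟨w, hw, hw'⟩ := RadialSpace.exists_of_tailIntegral_eq_zero (V := V) hv (R := a)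
    (fun r hr => by
      rw [h3 r (ha.trans_le hr), max_eq_right (by linarith), neg_zero])
  exact ⟨w, hw, fun r hr => by rw [hw', h3 r hr]⟩

theorem IsNonlinearity.weak_eq (hK : IsNonlinearity N V K γ Γ θ) {u : RadialSpace N V}
    (hu : u.quasiGrad = hK.grad u) (h : RadialSpace N V) :
    ∫ r, u.deriv r * h.deriv r ∂(radialMeasure N)
      + ∫ r, V r * (phi (u.eval r) * h.eval r) ∂(radialMeasure N)
      = ∫ r, K r * (γ (u.eval r) * h.eval r) ∂(radialMeasure N) := by
  rw [← quasiForm_apply, ← inner_quasiGrad, hu, hK.inner_grad]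

/-- Critical points are twice continuously differentiable off the origin. -/
theorem IsNonlinearity.exists_hasDerivAt (hK : IsNonlinearity N V K γ Γ θ)
    (hKc : ContinuousOn K (Set.Ioi 0)) {u : RadialSpace N V} (hu : u.quasiGrad = hK.grad u) :
    ∃ v : ℝ → ℝ, u.deriv =ᵐ[radialMeasure N] v ∧ (∀ r > 0, HasDerivAt u.eval (v r) r) ∧
      ∀ r > 0, HasDerivAt v (V r * phi (u.eval r) - K r * γ (u.eval r) - (N - 1) / r * v r) r := by
  -- The radial equation in divergence form is (r^{N-1} u')' = P.
  set P : ℝ → ℝ := fun r => r ^ (N - 1) * (V r * phi (u.eval r) - K r * γ (u.eval r)) with hP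
  have hPc : ContinuousOn P (Set.Ioi 0) := by
    refine ContinuousOn.mul (by fun_prop) (ContinuousOn.sub ?_ ?_)
    · exact hV.continuousOn.mul (continuous_phi.comp_continuousOn u.continuousOn_eval)
    · exact hKc.mul (hK.continuous.comp_continuousOn u.continuousOn_eval)
  have hPm : Measurable P := by
    have h1 := continuous_phi.measurable
    have h2 := hK.continuous.measurable
    have h3 := u.measurable_eval
    have h4 := hK.measurable
    have h5 := IsPotential.measurable V
    fun_prop
  have hPT : ∀ h : RadialSpace N V, IntegrableOn (fun r => P r * h.eval r) (Set.Ioi 0) ∧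
      sphereArea N * ∫ r in Set.Ioi 0, P r * h.eval r
        = -∫ r, u.deriv r * h.deriv r ∂(radialMeasure N) := by
    intro h
    have h1 := (u.integrable_phi_mul h).sub (hK.integrable_mul u h)
    have heq : ∀ r, r ^ (N - 1) * (V r * (phi (u.eval r) * h.eval r)
        - K r * (γ (u.eval r) * h.eval r)) = P r * h.eval r := fun r => by
      simp only [hP]
      ring
    constructor
    · rw [integrable_radialMeasure_iff] at h1
      exact h1.congr_fun (fun r _ => heq r) measurableSet_Ioi
    · have h2 := hK.weak_eq hu h
      rw [← setIntegral_congr_fun measurableSet_Ioi fun r _ => heq r,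
        ← integral_radialMeasure (fun r => V r * (phi (u.eval r) * h.eval r)
        - K r * (γ (u.eval r) * h.eval r)),
        integral_sub (u.integrable_phi_mul h) (hK.integrable_mul u h)]
      linarith
  have hPi : ∀ a > 0, IntervalIntegrable P volume 0 a := by
    intro a ha
    -- The value a + 1 makes the test function at least 1 in absolute value on (0, a], so
    -- integrability of P w gives integrability of P up to the origin.
    obtain ⟨w, -, hw⟩ := RadialSpace.exists_truncated_affine N V (show 0 < a + 1 by linarith)
    rw [intervalIntegrable_iff_integrableOn_Ioc_of_le ha.le]
    refine Integrable.mono ((hPT w).1.mono_set Set.Ioc_subset_Ioi_self) hPm.aestronglyMeasurable ?_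
    filter_upwards [ae_restrict_mem measurableSet_Ioc] with r hr
    have h1 : 1 ≤ a + 1 - r := by linarith [hr.2]
    rw [hw r hr.1, norm_mul (P r), norm_neg, max_eq_left (by linarith),
      Real.norm_of_nonneg (show 0 ≤ a + 1 - r by linarith)]
    exact le_mul_of_one_le_right (norm_nonneg _) h1
  set Q : ℝ → ℝ := fun r => ∫ s in (0 : ℝ)..r, P s with hQ
  have hQd : ∀ r > 0, HasDerivAt Q (P r) r := fun r hr =>
    intervalIntegral.integral_hasDerivAt_right (hPi r hr)
      (hPc.stronglyMeasurableAtFilter isOpen_Ioi r hr) (hPc.continuousAt (Ioi_mem_nhds hr))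
  have hQc : ∀ a > 0, ContinuousOn Q (Set.uIcc 0 a) := fun a ha =>
    intervalIntegral.continuousOn_primitive_interval
      ((intervalIntegrable_iff').1 (hPi a ha))
  have hui : ∀ a > 0, IntervalIntegrable (fun r => r ^ (N - 1) * u.deriv r) volume 0 a := by
    intro a ha
    obtain ⟨w, hw, -⟩ := RadialSpace.exists_truncated_affine N V ha
    have h1 := u.integrable_deriv_mul w
    rw [integrable_congr (hw.mono fun r hr => congrArg (u.deriv r * ·) hr),
      integrable_radialMeasure_iff] at h1
    rw [intervalIntegrable_iff_integrableOn_Ioc_of_le ha.le]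
    refine (h1.mono_set Set.Ioc_subset_Ioi_self).congr_fun (fun r hr => ?_) measurableSet_Ioc
    simp [Set.indicator_of_mem hr]
  -- Testing with -(a - r)⁺, whose derivative is the indicator of (0, a], gives the equation
  -- integrated twice. Since a is arbitrary, r^{N-1} u' = Q almost everywhere.
  have hzero : ∀ a > 0, ∫ r in (0 : ℝ)..a, (r ^ (N - 1) * u.deriv r - Q r) = 0 := by
    intro a ha
    obtain ⟨w, hw, hw'⟩ := RadialSpace.exists_truncated_affine N V ha
    have h1 : ∫ r, u.deriv r * w.deriv r ∂(radialMeasure N)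
        = sphereArea N * ∫ r in (0 : ℝ)..a, r ^ (N - 1) * u.deriv r := by
      rw [integral_congr_ae (hw.mono fun r hr => congrArg (u.deriv r * ·) hr),
        integral_radialMeasure, intervalIntegral.integral_of_le ha.le]
      congr 1
      rw [setIntegral_Ioc_eq_indicator]
      refine setIntegral_congr_fun measurableSet_Ioi fun r _ => ?_
      by_cases h : r ∈ Set.Ioc 0 a
      · simp [Set.indicator_of_mem h]
      · simp [Set.indicator_of_notMem h]
    have h2 : ∫ r in Set.Ioi 0, P r * w.eval r = -∫ r in (0 : ℝ)..a, P r * (a - r) := by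
      rw [intervalIntegral.integral_of_le ha.le, ← integral_neg,
        setIntegral_Ioc_eq_indicator]
      refine setIntegral_congr_fun measurableSet_Ioi fun r hr => ?_
      rw [hw' r hr]
      by_cases h : r ∈ Set.Ioc 0 a
      · rw [Set.indicator_of_mem h, max_eq_left (by linarith [h.2])]
        ring
      · have h3 : a < r := by
          by_contra h4
          exact h ⟨hr, not_lt.1 h4⟩
        rw [Set.indicator_of_notMem h, max_eq_right (by linarith)]
        ring
    have h3 := (hPT w).2
    rw [h1, h2, mul_neg, neg_inj] at h3
    have h4 := mul_left_cancel₀ (sphereArea_pos (N := N)).ne' h3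
    -- No boundary terms survive: Q vanishes at 0 and a - r vanishes at a. Hence ∫ P (a - r) = ∫ Q.
    have h5 := intervalIntegral.integral_deriv_mul_eq_sub_of_hasDeriv_right (a := 0) (b := a)
      (u := Q) (v := fun r => a - r) (u' := P) (v' := fun _ => -1) (hQc a ha) (by fun_prop)
      (fun x hx => (hQd x (by
        rw [min_eq_left ha.le] at hx
        exact hx.1)).hasDerivWithinAt)
      (fun x _ => ((hasDerivAt_id' x).const_sub a).hasDerivWithinAt) (hPi a ha)
      (by simp)
    have h6 : Q 0 = 0 := intervalIntegral.integral_same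
    rw [h6, sub_self, mul_zero, zero_mul, sub_zero, intervalIntegral.integral_add
      ((hPi a ha).mul_continuousOn (by fun_prop)) ((hQc a ha).intervalIntegrable.mul_const _),
      intervalIntegral.integral_mul_const] at h5
    rw [intervalIntegral.integral_sub (hui a ha) (hQc a ha).intervalIntegrable, ← h4]
    linarith
  have hae := ae_eq_zero_of_intervalIntegral
    (fun b hb => (hui b hb).sub (hQc b hb).intervalIntegrable) hzero
  set v : ℝ → ℝ := fun r => Q r / r ^ (N - 1) with hv
  have hvd : ∀ r > 0, HasDerivAt v
      (V r * phi (u.eval r) - K r * γ (u.eval r) - (N - 1) / r * v r) r := by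
    intro r hr
    refine ((hQd r hr).fun_div (hasDerivAt_pow (N - 1) r) (pow_pos hr _).ne').congr_deriv ?_
    have h1 : N - 1 = (N - 2) + 1 := by have := hN.out; omega
    have h2 : ((N - 1 : ℕ) : ℝ) = (N : ℝ) - 1 := by
      rw [Nat.cast_sub (by have := hN.out; omega), Nat.cast_one]
    have h3 : N - 1 - 1 = N - 2 := by omega
    rw [h3, h2]
    simp only [hv, hP]
    rw [h1, pow_succ]
    have := hr.ne'
    field_simp
  have huv : u.deriv =ᵐ[radialMeasure N] v := by
    refine ae_radialMeasure_iff.2 ?_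
    filter_upwards [hae, ae_restrict_mem measurableSet_Ioi] with r h1 h2
    have h3 : 0 < r ^ (N - 1) := pow_pos h2 _
    simp only [hv]
    rw [eq_div_iff h3.ne']
    linarith
  refine ⟨v, huv, fun r hr => ?_, hvd⟩
  -- The profile depends only on the class of its derivative, so it is the primitive of the
  -- continuous representative and is differentiable at every r > 0.
  have h1 : u.eval = tailIntegral v := tailIntegral_congr_ae huv
  rw [h1]
  refine hasDerivAt_tailIntegral (fun r hr => ?_)
    (fun r hr => (hvd r hr).continuousAt.continuousWithinAt) hr
  exact integrableOn_Ioi_of_memLp ((memLp_congr_ae huv).1 u.memLp_deriv) hr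

namespace RadialSpace

theorem tendsto_eval_atTop (u : RadialSpace N V) : Tendsto u.eval atTop (𝓝 0) := by
  have h1 : Tendsto (fun r : ℝ => decayConst N * ‖u‖ * r ^ (-decay N)) atTop (𝓝 0) := by
    simpa using (tendsto_rpow_neg_atTop (decay_pos (N := N))).const_mul (decayConst N * ‖u‖)
  refine squeeze_zero_norm' ?_ h1
  filter_upwards [eventually_gt_atTop 0] with r hr
  exact u.abs_eval_le hr

/-- The chain rule. -/
theorem tailIntegral_comp {u : RadialSpace N V} {v : ℝ → ℝ}
    (hv : u.deriv =ᵐ[radialMeasure N] v) (hd : ∀ r > 0, HasDerivAt u.eval (v r) r)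
    {P p : ℝ → ℝ} (hP : ∀ t, HasDerivAt P (p t) t) (hp : Continuous p) (h0 : P 0 = 0) {L : ℝ}
    (hL : ∀ t, |p t| ≤ L) :
    MemLp (fun r => p (u.eval r) * u.deriv r) 2 (radialMeasure N) ∧
      ∀ r > 0, tailIntegral (fun r => p (u.eval r) * u.deriv r) r = P (u.eval r) := by
  have hm : MemLp (fun r => p (u.eval r) * u.deriv r) 2 (radialMeasure N) := by
    refine u.memLp_deriv.of_le_mul (c := L)
      ((hp.measurable.comp u.measurable_eval).aestronglyMeasurable.mul u.memLp_deriv.1)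
      (Eventually.of_forall fun r => ?_)
    rw [norm_mul]
    exact mul_le_mul_of_nonneg_right (hL _) (norm_nonneg _)
  have hae : (fun r => p (u.eval r) * u.deriv r) =ᵐ[radialMeasure N]
      fun r => p (u.eval r) * v r := by
    filter_upwards [hv] with r hr
    rw [hr]
  refine ⟨hm, fun r hr => ?_⟩
  have hPc : Continuous P := continuous_iff_continuousAt.2 fun t => (hP t).continuousAt
  rw [tailIntegral_congr_ae hae, tailIntegral_of_pos _ hr,
    integral_Ioi_of_hasDerivAt_of_tendsto' (f := fun r => P (u.eval r)) (m := 0)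
    (fun x hx => (hP _).comp x (hd x (lt_of_lt_of_le hr hx)))
    (integrableOn_Ioi_of_memLp ((memLp_congr_ae hae).1 hm) hr)]
  · ring
  · have := (hPc.tendsto 0).comp u.tendsto_eval_atTop
    rwa [h0] at this

/-- A bounded derivative p makes P Lipschitz with P(0) = 0. Both the energy and the weighted square
integral of P(u) are then controlled by those of u. -/
theorem exists_comp {u : RadialSpace N V} {v : ℝ → ℝ}
    (hv : u.deriv =ᵐ[radialMeasure N] v) (hd : ∀ r > 0, HasDerivAt u.eval (v r) r)
    {P p : ℝ → ℝ} (hP : ∀ t, HasDerivAt P (p t) t) (hp : Continuous p) (h0 : P 0 = 0) {L : ℝ}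
    (hL : ∀ t, |p t| ≤ L) :
    ∃ w : RadialSpace N V, (w.deriv =ᵐ[radialMeasure N] fun r => p (u.eval r) * u.deriv r) ∧
      ∀ r > 0, w.eval r = P (u.eval r) := by
  obtain ⟨hm, ht⟩ := tailIntegral_comp hv hd hP hp h0 hL
  have hPL : ∀ t, |P t| ≤ L * |t| := by
    intro t
    have := Convex.norm_image_sub_le_of_norm_hasDerivWithin_le (f := P) (s := Set.univ)
      (C := L) (x := 0) (y := t) (fun t _ => (hP t).hasDerivWithinAt) (fun t _ => hL t)
      convex_univ trivial trivial
    simpa [h0] using this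
  have hPc : Continuous P := continuous_iff_continuousAt.2 fun t => (hP t).continuousAt
  have hi : Integrable (fun r => V r * tailIntegral (fun r => p (u.eval r) * u.deriv r) r ^ 2)
      (radialMeasure N) := by
    refine (u.integrable_eval_sq.const_mul (L ^ 2)).mono' ?_ ?_
    · exact ((IsPotential.measurable V).mul
        ((measurable_tailIntegral hm).pow_const 2)).aestronglyMeasurable
    · filter_upwards [ae_radialMeasure_pos] with r hr
      rw [Real.norm_of_nonneg (mul_nonneg (hV.nonneg r) (sq_nonneg _)), ht r hr, mul_left_comm,
        ← mul_pow]
      refine mul_le_mul_of_nonneg_left ?_ (hV.nonneg r)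
      refine sq_le_sq.2 ((hPL _).trans ?_)
      rw [abs_mul]
      exact mul_le_mul_of_nonneg_right (le_abs_self L) (abs_nonneg _)
  obtain ⟨w, hw, hw'⟩ := exists_deriv_ae_eq hm hi
  exact ⟨w, hw, fun r hr => by rw [hw', ht r hr]⟩

end RadialSpace

/-- Critical points are nonnegative if the nonlinearity vanishes on the negative numbers. -/
theorem IsNonlinearity.eval_nonneg (hK : IsNonlinearity N V K γ Γ θ)
    (hKc : ContinuousOn K (Set.Ioi 0)) (hγ : ∀ t < 0, γ t = 0) {u : RadialSpace N V}
    (hu : u.quasiGrad = hK.grad u) {r : ℝ} (hr : 0 < r) : 0 ≤ u.eval r := by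
  obtain ⟨v, hv, hd, -⟩ := hK.exists_hasDerivAt hKc hu
  -- The negative part, cut at 1 to stay bounded. Its primitive is continuously differentiable, zero
  -- on [0, ∞) and negative on (-∞, 0), so P(u) is an admissible test function detecting the set
  -- where u < 0.
  set p : ℝ → ℝ := fun s => min (max (-s) 0) 1 with hp
  have hpc : Continuous p := by fun_prop
  have hp0 : ∀ s, 0 ≤ p s := fun s => le_min (le_max_right _ _) zero_le_one
  have hp1 : ∀ s, |p s| ≤ 1 := fun s => by
    rw [abs_of_nonneg (hp0 s)]
    exact min_le_right _ _
  have hpz : ∀ s, 0 ≤ s → p s = 0 := fun s hs => by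
    simp only [hp]
    rw [max_eq_right (by linarith), min_eq_left zero_le_one]
  have hPd : ∀ t, HasDerivAt (primitive p) (p t) t := primitive_hasDerivAt hpc
  have hP0 : ∀ t, 0 ≤ t → primitive p t = 0 := fun t ht => by
    refine (intervalIntegral.integral_congr (g := fun _ => 0) fun s hs => ?_).trans (by simp)
    rw [Set.uIcc_of_le ht] at hs
    exact hpz s hs.1
  have hPneg : ∀ t < 0, primitive p t < 0 := fun t ht => by
    rw [primitive, intervalIntegral.integral_symm, neg_lt_zero]
    refine intervalIntegral.intervalIntegral_pos_of_pos_on (hpc.intervalIntegrable _ _)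
      (fun s hs => ?_) ht
    exact lt_min (lt_max_of_lt_left (by linarith [hs.2])) one_pos
  obtain ⟨w, hw, hw'⟩ := exists_comp hv hd hPd hpc (hP0 0 le_rfl) hp1
  obtain ⟨-, htail⟩ := tailIntegral_comp hv hd hPd hpc (hP0 0 le_rfl) hp1
  have h1 := hK.weak_eq hu w
  have h2 : ∫ r, K r * (γ (u.eval r) * w.eval r) ∂(radialMeasure N) = 0 := by
    refine integral_eq_zero_of_ae ?_
    filter_upwards [ae_radialMeasure_pos] with r hr
    rw [hw' r hr]
    rcases lt_or_ge (u.eval r) 0 with h | h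
    · simp [hγ _ h]
    · simp [hP0 _ h]
  have h3 : 0 ≤ ∫ r, V r * (phi (u.eval r) * w.eval r) ∂(radialMeasure N) := by
    refine integral_nonneg_of_ae ?_
    filter_upwards [ae_radialMeasure_pos] with r hr
    refine mul_nonneg (hV.nonneg r) ?_
    rw [hw' r hr]
    rcases lt_or_ge (u.eval r) 0 with h | h
    · exact mul_nonneg_of_nonpos_of_nonpos (phi_zero ▸ phi_strictMono.monotone h.le) (hPneg _ h).le
    · simp [hP0 _ h]
  have hae : (fun r => u.deriv r * w.deriv r) =ᵐ[radialMeasure N]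
      fun r => p (u.eval r) * u.deriv r ^ 2 := by
    filter_upwards [hw] with r hr
    rw [hr]
    ring
  rw [h2, integral_congr_ae hae] at h1
  have h4 : ∫ r, p (u.eval r) * u.deriv r ^ 2 ∂(radialMeasure N) = 0 := by
    refine le_antisymm (by linarith) (integral_nonneg fun r => mul_nonneg (hp0 _) (sq_nonneg _))
  rw [integral_eq_zero_iff_of_nonneg (fun r => mul_nonneg (hp0 _) (sq_nonneg _))
    ((integrable_congr hae).1 (u.integrable_deriv_mul w))] at h4
  have h5 : (fun r => p (u.eval r) * u.deriv r) =ᵐ[radialMeasure N] fun _ => 0 := by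
    filter_upwards [h4] with r hr
    have : p (u.eval r) * u.deriv r ^ 2 = 0 := hr
    rcases mul_eq_zero.1 this with h | h
    · rw [h, zero_mul]
    · rw [pow_eq_zero_iff two_ne_zero] at h
      rw [h, mul_zero]
  -- The derivative of P(u) vanishes almost everywhere and P(u) vanishes at infinity, so P(u) = 0,
  -- which excludes negative values of u.
  have h6 := htail r hr
  rw [tailIntegral_congr_ae h5, tailIntegral_of_pos _ hr] at h6
  simp only [integral_zero, neg_zero] at h6
  by_contra hneg
  exact (hPneg _ (not_le.1 hneg)).ne h6.symm

end QLS

namespace QLS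

set_option linter.unusedSectionVars false

/-! ### The quasilinear equation -/

variable {N : ℕ} [hN : Fact (3 ≤ N)] {V K γ Γ : ℝ → ℝ} {θ : ℝ} [hV : IsPotential V]

open RadialSpace

theorem tailIntegral_eq_of_hasDerivAt {F F' : ℝ → ℝ} (hd : ∀ r > 0, HasDerivAt F (F' r) r)
    {v : ℝ → ℝ} (hv : MemLp v 2 (radialMeasure N)) (hF : F' =ᵐ[radialMeasure N] v)
    (h0 : Tendsto F atTop (𝓝 0)) {r : ℝ} (hr : 0 < r) : tailIntegral v r = F r := by
  rw [← tailIntegral_congr_ae hF, tailIntegral_of_pos _ hr,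
    integral_Ioi_of_hasDerivAt_of_tendsto' (f := F) (m := 0)
    (fun x hx => hd x (lt_of_lt_of_le hr hx))
    (integrableOn_Ioi_of_memLp ((memLp_congr_ae hF).2 hv) hr) h0]
  ring

theorem abs_two_mul_div_le_one (t : ℝ) : |2 * t / (1 + 2 * t ^ 2)| ≤ 1 := by
  rw [abs_div, abs_of_pos (show 0 < 1 + 2 * t ^ 2 by positivity), div_le_one (by positivity),
    abs_mul, abs_two, ← sq_abs t]
  nlinarith [sq_nonneg (|t| - 1), sq_nonneg |t|]

/-- Since f(u)² ≤ 2|u|, the square of the root grows at most like r^{-κ} at the origin, with κ = (N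
- 2)/2 < N, and this is integrable for the radial measure. -/
theorem RadialSpace.memLp_mul_sqrt_change (u : RadialSpace N V) {η : ℝ → ℝ} (hη : Continuous η)
    (hηc : HasCompactSupport η) :
    MemLp (fun r => η r * √(1 + 2 * change (u.eval r) ^ 2)) 2 (radialMeasure N) := by
  have hκ := decay_pos (N := N)
  have hκN : decay N = ((N : ℝ) - 2) / 2 := rfl
  have hN3 := three_le_cast (N := N)
  obtain ⟨R, hR, hzero⟩ := hηc.exists_pos_le_norm
  obtain ⟨B, hB⟩ := hηc.exists_bound_of_continuous hη
  have hcm : Measurable fun r => change (u.eval r) :=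
    continuous_change.measurable.comp u.measurable_eval
  have hm := hη.measurable
  rw [memLp_two_iff_integrable_sq (by fun_prop)]
  have h1 := integrable_indicator_rpow_Ioo (N := N) (s := 0) (R := R) (by linarith) hR
  have h2 := integrable_indicator_rpow_Ioo (N := N) (s := -decay N) (R := R)
    (by rw [hκN]; linarith) hR
  refine ((h1.const_mul (B ^ 2)).add (h2.const_mul (B ^ 2 * (4 * (decayConst N * ‖u‖))))).mono'
    (by fun_prop) ?_
  filter_upwards [ae_radialMeasure_pos] with r hr
  rw [Real.norm_of_nonneg (sq_nonneg _), mul_pow, sqrt_change_sq]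
  change _ ≤ B ^ 2 * _ + B ^ 2 * (4 * (decayConst N * ‖u‖)) * _
  by_cases hrR : r < R
  · have hmem : r ∈ Set.Ioo 0 R := ⟨hr, hrR⟩
    rw [Set.indicator_of_mem hmem, Set.indicator_of_mem hmem, Real.rpow_zero]
    have h3 : η r ^ 2 ≤ B ^ 2 := sq_le_sq' (by linarith [(abs_le.1 (hB r)).1]) (abs_le.1 (hB r)).2
    have h4 := change_sq_le_two_mul_abs (u.eval r)
    have h5 := u.abs_eval_le hr
    have h6 : 1 + 2 * change (u.eval r) ^ 2
        ≤ 1 + 4 * (decayConst N * ‖u‖ * r ^ (-decay N)) := by linarith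
    calc _ ≤ B ^ 2 * (1 + 4 * (decayConst N * ‖u‖ * r ^ (-decay N))) :=
          mul_le_mul h3 h6 (by positivity) (sq_nonneg _)
      _ = _ := by ring
  · have h3 : η r = 0 := hzero r (by rw [Real.norm_of_nonneg hr.le]; exact not_lt.1 hrR)
    rw [Set.indicator_of_notMem (fun h => hrR h.2), Set.indicator_of_notMem (fun h => hrR h.2), h3]
    simp

/-- Multiplying critical points by test functions: the equation for `f(u)` in radial form. -/
theorem IsNonlinearity.radial_weak (hK : IsNonlinearity N V K γ Γ θ) {u : RadialSpace N V}
    (hu : u.quasiGrad = hK.grad u) {v : ℝ → ℝ} (hv : u.deriv =ᵐ[radialMeasure N] v)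
    (hd : ∀ r > 0, HasDerivAt u.eval (v r) r) {p : ℝ → ℝ} (hp : ContDiff ℝ ∞ p)
    (hpc : HasCompactSupport p) :
    Integrable (fun r => √(1 + 2 * change (u.eval r) ^ 2) * (u.deriv r * deriv p r))
      (radialMeasure N) ∧
    Integrable (fun r => 2 * change (u.eval r) / (1 + 2 * change (u.eval r) ^ 2)
      * u.deriv r ^ 2 * p r) (radialMeasure N) ∧
    Integrable (fun r => V r * change (u.eval r) * p r) (radialMeasure N) ∧
    Integrable (fun r => K r * (γ (u.eval r) * √(1 + 2 * change (u.eval r) ^ 2)) * p r)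
      (radialMeasure N) ∧
    (∫ r, √(1 + 2 * change (u.eval r) ^ 2) * (u.deriv r * deriv p r) ∂(radialMeasure N))
      + (∫ r, 2 * change (u.eval r) / (1 + 2 * change (u.eval r) ^ 2)
        * u.deriv r ^ 2 * p r ∂(radialMeasure N))
      + (∫ r, V r * change (u.eval r) * p r ∂(radialMeasure N))
      = ∫ r, K r * (γ (u.eval r) * √(1 + 2 * change (u.eval r) ^ 2)) * p r
        ∂(radialMeasure N) := by
  have hcm : Measurable fun r => change (u.eval r) :=
    continuous_change.measurable.comp u.measurable_eval
  have hpd : Continuous (deriv p) := hp.continuous_deriv (by simp)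
  have hA := u.memLp_mul_sqrt_change hpd hpc.deriv
  obtain ⟨B, hB⟩ := hpc.exists_bound_of_continuous hp.continuous
  have hB0 : 0 ≤ B := (norm_nonneg _).trans (hB 0)
  set c : ℝ → ℝ := fun r => p r * (2 * change (u.eval r) / (1 + 2 * change (u.eval r) ^ 2)) with hc
  have hcmeas : Measurable c := by
    have := hp.continuous.measurable
    fun_prop
  have hcb : ∀ r, ‖c r‖ ≤ B := fun r => by
    rw [hc]
    beta_reduce
    rw [norm_mul]
    calc _ ≤ B * 1 := mul_le_mul (hB r) (abs_two_mul_div_le_one _) (abs_nonneg _) hB0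
      _ = B := mul_one B
  have hC : MemLp (fun r => c r * u.deriv r) 2 (radialMeasure N) := by
    refine u.memLp_deriv.of_le_mul (c := B)
      (hcmeas.aestronglyMeasurable.mul u.memLp_deriv.1) (Eventually.of_forall fun r => ?_)
    rw [norm_mul]
    exact mul_le_mul_of_nonneg_right (hcb r) (norm_nonneg _)
  have hAC := hA.add hC
  -- Testing the semilinear equation with p √(1 + 2f(u)²) cancels the factor f' in φ and γ. The
  -- derivative of the root produces the term with the squared gradient.
  set F : ℝ → ℝ := fun r => p r * √(1 + 2 * change (u.eval r) ^ 2) with hF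
  have hFd : ∀ r > 0, HasDerivAt F (deriv p r * √(1 + 2 * change (u.eval r) ^ 2) + c r * v r) r := by
    intro r hr
    have h1 := (hp.differentiable (by simp) r).hasDerivAt
    have h2 := (sqrtChange_hasDerivAt (u.eval r)).comp r (hd r hr)
    refine (h1.mul h2).congr_deriv ?_
    simp only [hc, Function.comp_apply]
    ring
  obtain ⟨R, hR, hzero⟩ := hpc.exists_pos_le_norm
  have hF0 : ∀ r, R ≤ r → F r = 0 := fun r hr => by
    simp only [hF]
    rw [hzero r (hr.trans (le_abs_self r)), zero_mul]
  have htail : ∀ r > 0, tailIntegral (fun r => deriv p r * √(1 + 2 * change (u.eval r) ^ 2)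
      + c r * u.deriv r) r = F r := by
    intro r hr
    refine tailIntegral_eq_of_hasDerivAt hFd hAC ?_ ?_ hr
    · filter_upwards [hv] with s hs
      rw [← hs]
      rfl
    · refine tendsto_const_nhds.congr' ?_
      filter_upwards [eventually_ge_atTop R] with s hs
      exact (hF0 s hs).symm
  obtain ⟨H, hH, hH'⟩ := RadialSpace.exists_of_tailIntegral_eq_zero (V := V) hAC (R := R)
    (fun r hr => (htail r (hR.trans_le hr)).trans (hF0 r hr))
  have hHF : ∀ r > 0, H.eval r = F r := fun r hr => by
    rw [hH']
    exact htail r hr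
  have hi1 : Integrable (fun r => √(1 + 2 * change (u.eval r) ^ 2) * (u.deriv r * deriv p r))
      (radialMeasure N) := by
    refine (u.memLp_deriv.integrable_mul hA).congr (Eventually.of_forall fun r => ?_)
    change u.deriv r * (deriv p r * √(1 + 2 * change (u.eval r) ^ 2)) = _
    ring
  have hi2 : Integrable (fun r => 2 * change (u.eval r) / (1 + 2 * change (u.eval r) ^ 2)
      * u.deriv r ^ 2 * p r) (radialMeasure N) := by
    refine (u.memLp_deriv.integrable_mul hC).congr (Eventually.of_forall fun r => ?_)
    change u.deriv r * (c r * u.deriv r) = _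
    rw [hc]
    ring
  have he3 : (fun r => V r * (phi (u.eval r) * H.eval r)) =ᵐ[radialMeasure N]
      fun r => V r * change (u.eval r) * p r := by
    filter_upwards [ae_radialMeasure_pos] with r hr
    have := (sqrt_change_pos (u.eval r)).ne'
    rw [hHF r hr, hF, phi]
    field_simp
  have he4 : (fun r => K r * (γ (u.eval r) * H.eval r)) =ᵐ[radialMeasure N]
      fun r => K r * (γ (u.eval r) * √(1 + 2 * change (u.eval r) ^ 2)) * p r := by
    filter_upwards [ae_radialMeasure_pos] with r hr
    rw [hHF r hr, hF]
    ring
  refine ⟨hi1, hi2, (u.integrable_phi_mul H).congr he3, (hK.integrable_mul u H).congr he4, ?_⟩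
  have h1 := hK.weak_eq hu H
  rw [integral_congr_ae he3, integral_congr_ae he4] at h1
  rw [← h1, ← integral_add hi1 hi2]
  congr 1
  refine integral_congr_ae ?_
  filter_upwards [hH] with r hr
  rw [hr]
  change _ = u.deriv r * (deriv p r * √(1 + 2 * change (u.eval r) ^ 2) + c r * u.deriv r)
  rw [hc]
  ring

/-! ### Second derivatives and the Laplacian of radial functions -/

theorem contDiffOn_two_of_hasDerivAt {W W₁ W₂ : ℝ → ℝ} {s : Set ℝ} (hs : IsOpen s)
    (h1 : ∀ r ∈ s, HasDerivAt W (W₁ r) r) (h2 : ∀ r ∈ s, HasDerivAt W₁ (W₂ r) r)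
    (h3 : ContinuousOn W₂ s) : ContDiffOn ℝ 2 W s := by
  have hc1 : ContDiffOn ℝ 1 W₁ s := by
    have h0 : ContDiffOn ℝ (0 + 1) W₁ s := by
      rw [contDiffOn_succ_iff_deriv_of_isOpen hs]
      refine ⟨fun r hr => (h2 r hr).differentiableAt.differentiableWithinAt, by simp, ?_⟩
      rw [contDiffOn_zero]
      exact h3.congr fun r hr => (h2 r hr).deriv
    simpa using h0
  have h0 : ContDiffOn ℝ (1 + 1) W s := by
    rw [contDiffOn_succ_iff_deriv_of_isOpen hs]
    exact ⟨fun r hr => (h1 r hr).differentiableAt.differentiableWithinAt, by simp,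
      hc1.congr fun r hr => (h1 r hr).deriv⟩
  have h4 : (1 : WithTop ℕ∞) + 1 = 2 := by norm_num
  rwa [h4] at h0

theorem contDiffOn_comp_norm {W : ℝ → ℝ} {n : WithTop ℕ∞} (h : ContDiffOn ℝ n W (Set.Ioi 0)) :
    ContDiffOn ℝ n (fun x : EuclideanSpace ℝ (Fin N) => W ‖x‖) {0}ᶜ := fun x hx =>
  ((h.contDiffAt (Ioi_mem_nhds (norm_pos_iff.2 hx))).comp x
    (contDiffAt_norm ℝ hx)).contDiffWithinAt

/-- The Laplacian of radial functions. -/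
theorem laplacian_comp_norm {W W₁ W₂ : ℝ → ℝ} (h1 : ∀ r > 0, HasDerivAt W (W₁ r) r)
    (h2 : ∀ r > 0, HasDerivAt W₁ (W₂ r) r) {x : EuclideanSpace ℝ (Fin N)} (hx : x ≠ 0) :
    Laplacian.laplacian (fun y : EuclideanSpace ℝ (Fin N) => W ‖y‖) x
      = W₂ ‖x‖ + (N - 1) / ‖x‖ * W₁ ‖x‖ := by
  have hx0 : 0 < ‖x‖ := norm_pos_iff.2 hx
  have hfd : ∀ y : EuclideanSpace ℝ (Fin N), y ≠ 0 →
      fderiv ℝ (fun y : EuclideanSpace ℝ (Fin N) => W ‖y‖) y = (W₁ ‖y‖ / ‖y‖) • innerSL ℝ y := by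
    intro y hy
    have h3 := (hasGradientAt_comp_norm (h1 ‖y‖ (norm_pos_iff.2 hy)) hy).hasFDerivAt.fderiv
    rw [h3, map_smul]
    rfl
  have hq : HasDerivAt (fun r => W₁ r / r) ((W₂ ‖x‖ * ‖x‖ - W₁ ‖x‖ * 1) / ‖x‖ ^ 2) ‖x‖ :=
    (h2 _ hx0).fun_div (hasDerivAt_id' _) hx0.ne'
  have hqx := (hasGradientAt_comp_norm hq hx).hasFDerivAt
  have hI : HasFDerivAt (fun y : EuclideanSpace ℝ (Fin N) => innerSL ℝ y)
      (innerSL ℝ : EuclideanSpace ℝ (Fin N) →L[ℝ] _) x := (innerSL ℝ).hasFDerivAt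
  have h4 := hqx.smul hI
  have h5 : (fderiv ℝ (fun y : EuclideanSpace ℝ (Fin N) => W ‖y‖)) =ᶠ[𝓝 x]
      fun y => (W₁ ‖y‖ / ‖y‖) • innerSL ℝ y := by
    filter_upwards [isOpen_ne.mem_nhds hx] with y hy
    exact hfd y hy
  have h6 := (h4.congr_of_eventuallyEq h5).fderiv
  let b := EuclideanSpace.basisFun (Fin N) ℝ
  rw [InnerProductSpace.laplacian_eq_iteratedFDeriv_orthonormalBasis _ b]
  simp only [iteratedFDeriv_two_apply]
  have h7 : ∀ i, b i = EuclideanSpace.single i 1 := fun i => by simp [b]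
  have hsum : ∑ i, x i ^ 2 = ‖x‖ ^ 2 := by
    rw [EuclideanSpace.norm_sq_eq]
    simp
  have hterm : ∀ i, fderiv ℝ (fderiv ℝ fun y : EuclideanSpace ℝ (Fin N) => W ‖y‖) x (b i) (b i)
      = W₁ ‖x‖ / ‖x‖ + (W₂ ‖x‖ * ‖x‖ - W₁ ‖x‖ * 1) / ‖x‖ ^ 2 / ‖x‖ * x i ^ 2 := by
    intro i
    rw [h6, h7]
    simp only [add_apply, smul_apply,
      ContinuousLinearMap.smulRight_apply, InnerProductSpace.toDual_apply_apply, smul_eq_mul]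
    have h8 : ∀ y z : EuclideanSpace ℝ (Fin N), innerSL ℝ y z = inner ℝ y z := fun _ _ => rfl
    erw [h8, h8]
    simp [EuclideanSpace.inner_single_right, inner_smul_left]
    ring
  refine (Finset.sum_congr rfl fun i _ => hterm i).trans ?_
  rw [Finset.sum_add_distrib, ← Finset.mul_sum, hsum]
  simp
  field_simp
  ring

end QLS

namespace QLS

set_option linter.unusedSectionVars false

/-! ### Transfer to functions on `ℝ^N` -/

variable {N : ℕ} [hN : Fact (3 ≤ N)] {V K γ Γ W : ℝ → ℝ} {θ : ℝ} [hW : IsPotential W]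

open RadialSpace

theorem integrable_comp_norm_iff {F : ℝ → ℝ} (hF : AEStronglyMeasurable F (radialMeasure N)) :
    Integrable (fun x : EuclideanSpace ℝ (Fin N) => F ‖x‖) ↔ Integrable F (radialMeasure N) :=
  (integrable_map_measure hF measurable_norm_euclidean.aemeasurable).symm

theorem integral_comp_norm {F : ℝ → ℝ} (hF : AEStronglyMeasurable F (radialMeasure N)) :
    ∫ x : EuclideanSpace ℝ (Fin N), F ‖x‖ = ∫ r, F r ∂(radialMeasure N) :=
  (integral_map measurable_norm_euclidean.aemeasurable hF).symm

theorem transfer_integral {F : ℝ → ℝ} (hF : Integrable F (radialMeasure N))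
    {f : EuclideanSpace ℝ (Fin N) → ℝ} (h : f =ᵐ[volume] fun x => F ‖x‖) :
    Integrable f ∧ ∫ x, f x = ∫ r, F r ∂(radialMeasure N) :=
  ⟨((integrable_comp_norm_iff hF.1).2 hF).congr h.symm,
    (integral_congr_ae h).trans (integral_comp_norm hF.1)⟩

theorem RadialSpace.weakGrad_ae_eq {u : EuclideanSpace ℝ (Fin N) → ℝ} {U : RadialSpace N W}
    (hu : u =ᵐ[volume] fun x => U.eval ‖x‖) : weakGrad u =ᵐ[volume] radialField N U.deriv :=
  weakGrad_ae_eq_radialField U.memLp_deriv hu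

theorem RadialSpace.integral_weakGrad_sq {u : EuclideanSpace ℝ (Fin N) → ℝ} {U : RadialSpace N W}
    (hu : u =ᵐ[volume] fun x => U.eval ‖x‖) : ∫ x, ‖weakGrad u x‖ ^ 2 = U.dirichlet := by
  refine (transfer_integral U.integrable_deriv_sq ?_).2
  filter_upwards [weakGrad_ae_eq hu, ae_ne_zero_euclidean] with x hx hx0
  rw [hx, norm_radialField _ hx0, sq_abs]

theorem RadialSpace.transfer_orlicz (hVW : ∀ r > 0, V r = W r)
    {u : EuclideanSpace ℝ (Fin N) → ℝ} {U : RadialSpace N W}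
    (hu : u =ᵐ[volume] fun x => U.eval ‖x‖) : Integrable (fun x => V ‖x‖ * change (u x) ^ 2) ∧
      ∫ x, V ‖x‖ * change (u x) ^ 2 = U.orlicz := by
  refine transfer_integral U.integrable_change_sq ?_
  filter_upwards [hu, ae_ne_zero_euclidean] with x hx hx0
  rw [hx, hVW _ (norm_pos_iff.2 hx0)]

theorem RadialSpace.memE (hVW : ∀ r > 0, V r = W r) {u : EuclideanSpace ℝ (Fin N) → ℝ}
    {U : RadialSpace N W} (hu : u =ᵐ[volume] fun x => U.eval ‖x‖) : MemE V u :=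
  ⟨memD12r_of_ae_eq U.memLp_deriv hu, (transfer_orlicz hVW hu).1⟩

/-- Finiteness of the Orlicz integral already gives finiteness of ∫ V u²: Hardy handles the unit
ball, and outside it u is bounded, so u² is at most a multiple of f(u)². -/
theorem MemE.exists_radialSpace (hVW : ∀ r > 0, V r = W r) {u : EuclideanSpace ℝ (Fin N) → ℝ}
    (h : MemE V u) : ∃ U : RadialSpace N W, u =ᵐ[volume] fun x => U.eval ‖x‖ := by
  obtain ⟨v, hv, huv⟩ := h.1.exists_eq_radialFun
  have hκ := decay_pos (N := N)
  have hm := measurable_tailIntegral hv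
  have hcm := continuous_change.measurable
  have hWm := IsPotential.measurable W
  have h1 : Integrable (fun r => W r * change (tailIntegral v r) ^ 2) (radialMeasure N) := by
    refine (integrable_comp_norm_iff
      (Measurable.aestronglyMeasurable (by fun_prop))).1 (h.2.congr ?_)
    filter_upwards [huv, ae_ne_zero_euclidean] with x hx hx0
    rw [hx, hVW _ (norm_pos_iff.2 hx0)]
    rfl
  obtain ⟨C, -, hH⟩ := exists_hardy N W
  set m := decayConst N * (eLpNorm v 2 (radialMeasure N)).toReal with hm'
  have hm0 : 0 ≤ m := mul_nonneg decayConst_nonneg ENNReal.toReal_nonneg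
  have h2 : IntegrableOn (fun r => W r * tailIntegral v r ^ 2) (Set.Ici 1) (radialMeasure N) := by
    refine Integrable.mono' (h1.const_mul (1 + 2 * m ^ 2)).integrableOn
      (Measurable.aestronglyMeasurable (by fun_prop)) ?_
    filter_upwards [ae_restrict_mem measurableSet_Ici] with r hr
    have hr' : 1 ≤ r := hr
    rw [Real.norm_of_nonneg (mul_nonneg (hW.nonneg r) (sq_nonneg _)), mul_left_comm]
    refine mul_le_mul_of_nonneg_left (sq_le_of_abs_le ?_) (hW.nonneg r)
    refine (abs_tailIntegral_le hv (by linarith)).trans ?_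
    exact mul_le_of_le_one_right hm0
      (Real.rpow_le_one_of_one_le_of_nonpos hr' (by linarith))
  obtain ⟨U, -, hU⟩ := RadialSpace.exists_deriv_ae_eq hv (by
    rw [← integrableOn_univ, ← Set.Iio_union_Ici (a := (1 : ℝ))]
    exact (hH v hv).1.union h2)
  refine ⟨U, ?_⟩
  rw [hU]
  exact huv

theorem RadialSpace.orliczNorm_eq (hVW : ∀ r > 0, V r = W r)
    {u : EuclideanSpace ℝ (Fin N) → ℝ} {U : RadialSpace N W}
    (hu : u =ᵐ[volume] fun x => U.eval ‖x‖) :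
    orliczNorm V u = ⨅ k : Set.Ioi (0 : ℝ),
      ENNReal.ofReal (1 / (k : ℝ) * (1 + ((k : ℝ) • U).orlicz)) := by
  unfold orliczNorm
  congr 1
  ext1 k
  have hk : (0 : ℝ) < k := k.2
  have hku : (fun x => (k : ℝ) * u x) =ᵐ[volume] fun x => ((k : ℝ) • U).eval ‖x‖ := by
    filter_upwards [hu] with x hx
    rw [hx, eval_smul]
  obtain ⟨h1, h2⟩ := transfer_orlicz hVW hku
  rw [← ofReal_integral_eq_lintegral_ofReal h1 ?_, h2, ← ENNReal.ofReal_one,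
    ← ENNReal.ofReal_add zero_le_one (orlicz_nonneg _), ← ENNReal.ofReal_mul (by positivity)]
  filter_upwards [ae_ne_zero_euclidean] with x hx0
  rw [hVW _ (norm_pos_iff.2 hx0)]
  exact mul_nonneg (hW.nonneg _) (sq_nonneg _)

/-- Only this direction of the comparison is needed. For μ above the norm of E, both the Dirichlet
and the Orlicz integral of U/μ are at most 1, and `exists_norm_sq_le_orlicz` bounds its Hilbert norm
by 2C. -/
theorem RadialSpace.exists_norm_le_normE (hVW : ∀ r > 0, V r = W r) : ∃ C > 0,
    ∀ (u : EuclideanSpace ℝ (Fin N) → ℝ) (U : RadialSpace N W),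
      (u =ᵐ[volume] fun x => U.eval ‖x‖) → ‖U‖ ≤ C * normE V u := by
  obtain ⟨C, hC, h⟩ := exists_norm_sq_le_orlicz N W
  refine ⟨2 * C, by linarith, fun u U hu => ?_⟩
  by_contra hcon
  rw [not_le] at hcon
  obtain ⟨μ, hμ, hμ'⟩ := exists_between ((lt_div_iff₀' (show 0 < 2 * C by linarith)).2 hcon)
  rw [lt_div_iff₀' (by linarith)] at hμ'
  have heq := orliczNorm_eq hVW hu
  have htop : orliczNorm V u ≠ ⊤ := by
    rw [heq]
    exact ne_top_of_le_ne_top ENNReal.ofReal_ne_top (iInf_le _ ⟨1, Set.mem_Ioi.2 one_pos⟩)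
  have hn : normE V u = √U.dirichlet + (orliczNorm V u).toReal := by
    rw [normE, integral_weakGrad_sq hu]
  have hD := Real.sqrt_nonneg U.dirichlet
  have hO := ENNReal.toReal_nonneg (a := orliczNorm V u)
  have hμ0 : 0 < μ := by linarith
  have hlt : orliczNorm V u < ENNReal.ofReal μ := by
    rw [ENNReal.lt_ofReal_iff_toReal_lt htop]
    linarith
  rw [heq, iInf_lt_iff] at hlt
  obtain ⟨⟨k, hk⟩, hk'⟩ := hlt
  have hk0 : 0 < k := hk
  rw [ENNReal.ofReal_lt_ofReal_iff hμ0, one_div, inv_mul_lt_iff₀ hk0] at hk'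
  simp only at hk'
  have hkO := (k • U).orlicz_nonneg
  have hkμ : 0 < k * μ := by positivity
  -- From (1 + orlicz(kU))/k < μ it follows that kμ > 1. Convexity with ratio 1/(kμ) then compares
  -- U/μ with kU.
  have h1 : (μ⁻¹ • U).orlicz ≤ 1 := by
    have h2 : (μ⁻¹ • U).orlicz ≤ (k * μ)⁻¹ * (k • U).orlicz := by
      unfold orlicz
      rw [← integral_const_mul]
      refine integral_mono (μ⁻¹ • U).integrable_change_sq
        ((k • U).integrable_change_sq.const_mul _) fun r => ?_
      change W r * change ((μ⁻¹ • U).eval r) ^ 2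
        ≤ (k * μ)⁻¹ * (W r * change ((k • U).eval r) ^ 2)
      rw [mul_left_comm]
      refine mul_le_mul_of_nonneg_left ?_ (hW.nonneg r)
      have h3 := change_mul_sq_le (l := (k * μ)⁻¹) (by positivity)
        (inv_le_one_of_one_le₀ (by linarith)) ((k • U).eval r)
      rw [eval_smul] at h3 ⊢
      rw [eval_smul]
      have h4 : (k * μ)⁻¹ * (k * U.eval r) = μ⁻¹ * U.eval r := by field_simp
      rwa [h4] at h3
    refine h2.trans ?_
    rw [inv_mul_le_iff₀ hkμ]
    linarith
  have h2 : (μ⁻¹ • U).dirichlet ≤ 1 := by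
    rw [dirichlet_smul, inv_pow, inv_mul_le_iff₀ (by positivity), mul_one,
      ← Real.sqrt_le_left hμ0.le]
    linarith
  have h3 := h (μ⁻¹ • U)
  have h4 := (μ⁻¹ • U).dirichlet_nonneg
  have h5 := (μ⁻¹ • U).orlicz_nonneg
  have h6 : ‖μ⁻¹ • U‖ ^ 2 ≤ (2 * C) ^ 2 := by
    calc _ ≤ C * (1 + (μ⁻¹ • U).dirichlet) * ((μ⁻¹ • U).dirichlet + (μ⁻¹ • U).orlicz) := h3
      _ ≤ C * (1 + 1) * (1 + 1) := by
          have : 0 ≤ C := by linarith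
          gcongr
      _ ≤ _ := by nlinarith
  have h7 := le_of_sq_le_sq h6 (by linarith)
  rw [norm_smul, norm_inv, Real.norm_of_nonneg hμ0.le, inv_mul_le_iff₀ hμ0] at h7
  linarith

theorem IsNonlinearity.transfer_energy (hVW : ∀ r > 0, V r = W r) {g L : ℝ → ℝ}
    (hK : IsNonlinearity N W L γ (fun t => primitive g (change t)) θ) (hKL : ∀ r > 0, K r = L r)
    {u : EuclideanSpace ℝ (Fin N) → ℝ} {U : RadialSpace N W}
    (hu : u =ᵐ[volume] fun x => U.eval ‖x‖) :
    Integrable (fun x => K ‖x‖ * primitive g (change (u x))) ∧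
      energy V K g u = hK.radialEnergy U := by
  have h1 := transfer_integral (hK.integrable_primitive U)
    (f := fun x => K ‖x‖ * primitive g (change (u x))) (by
      filter_upwards [hu, ae_ne_zero_euclidean] with x hx hx0
      rw [hx, hKL _ (norm_pos_iff.2 hx0)])
  refine ⟨h1.1, ?_⟩
  rw [energy, integral_weakGrad_sq hu, (transfer_orlicz hVW hu).2, h1.2]
  rfl

/-- With zero differential the expansion is I(u + h) - I(u) = o(‖H‖), and both the smallness of H
and the error bound pass to the norm of E through the inequality ‖H‖ ≤ C ‖h‖. -/
theorem IsNonlinearity.isCriticalPoint (hVW : ∀ r > 0, V r = W r) {g L : ℝ → ℝ}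
    (hK : IsNonlinearity N W L γ (fun t => primitive g (change t)) θ) (hKL : ∀ r > 0, K r = L r)
    {u : EuclideanSpace ℝ (Fin N) → ℝ} {U : RadialSpace N W}
    (hu : u =ᵐ[volume] fun x => U.eval ‖x‖) (hU : U.quasiGrad = hK.grad U) :
    IsCriticalPoint V K g u := by
  refine ⟨memE hVW hu, fun ε hε => ?_⟩
  obtain ⟨C, hC, hle⟩ := exists_norm_le_normE (N := N) hVW
  have h1 := hK.hasFDerivAt_radialEnergy U
  rw [hU, sub_self, map_zero, hasFDerivAt_iff_isLittleO_nhds_zero, Asymptotics.isLittleO_iff] at h1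
  obtain ⟨δ, hδ, h2⟩ := Metric.eventually_nhds_iff.1 (h1 (show 0 < ε / C by positivity))
  refine ⟨δ / C, by positivity, fun h hh hhδ => ?_⟩
  obtain ⟨H, hH⟩ := hh.exists_radialSpace hVW
  have h3 := hle h H hH
  have h4 : ‖H‖ < δ := by
    rw [lt_div_iff₀' hC] at hhδ
    linarith
  have h5 := h2 (y := H) (by rwa [dist_zero_right])
  have h6 : (u + h) =ᵐ[volume] fun x => (U + H).eval ‖x‖ := by
    filter_upwards [hu, hH] with x hx hx'
    rw [Pi.add_apply, hx, hx', eval_add]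
  rw [(hK.transfer_energy hVW hKL h6).2, (hK.transfer_energy hVW hKL hu).2]
  rw [zero_apply, sub_zero, Real.norm_eq_abs] at h5
  refine h5.trans ?_
  rw [div_mul_eq_mul_div, div_le_iff₀ hC]
  nlinarith

/-- The weak gradient of one and the same function computes the Dirichlet integrals of both U and 0,
so the first part of the norm vanishes. The second does too, since the profile is zero almost
everywhere. -/
theorem RadialSpace.eq_zero_of_ae_eq_zero {U : RadialSpace N W}
    (h : (fun x : EuclideanSpace ℝ (Fin N) => U.eval ‖x‖) =ᵐ[volume] 0) : U = 0 := by
  have h1 : U.dirichlet = 0 := by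
    have h2 := integral_weakGrad_sq (Filter.EventuallyEq.refl (ae volume)
      fun x : EuclideanSpace ℝ (Fin N) => U.eval ‖x‖)
    have h3 := integral_weakGrad_sq (U := (0 : RadialSpace N W)) (h.trans (by
      refine Eventually.of_forall fun x => ?_
      simp [eval_zero]))
    rw [← h2, h3]
    have h4 := dirichlet_smul 0 (0 : RadialSpace N W)
    simpa using h4
  have h2 : ∫ r, W r * U.eval r ^ 2 ∂(radialMeasure N) = 0 := by
    rw [← integral_comp_norm U.integrable_eval_sq.1]
    refine integral_eq_zero_of_ae ?_
    filter_upwards [h] with x hx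
    rw [hx]
    simp
  have h3 : ‖U‖ ^ 2 = 0 := by
    rw [norm_sq_eq, h2, add_zero]
    exact h1
  simpa using h3

/-- The gradient of w = f(u) is ∇u/√(1 + 2w²). With this, the terms of the weak equation become
those of `radial_weak`. -/
theorem IsNonlinearity.isWeakSolution (hVW : ∀ r > 0, V r = W r) {g L : ℝ → ℝ}
    (hK : IsNonlinearity N W L (fun t => g (change t) * (1 / √(1 + 2 * change t ^ 2))) Γ θ)
    (hKL : ∀ r > 0, K r = L r) (hLc : ContinuousOn L (Set.Ioi 0)) {U : RadialSpace N W}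
    (hU : U.quasiGrad = hK.grad U) :
    IsWeakSolution V K g fun x : EuclideanSpace ℝ (Fin N) => change (U.eval ‖x‖) := by
  obtain ⟨v, hv, hd, -⟩ := hK.exists_hasDerivAt hLc hU
  have hpc : Continuous fun t => 1 / √(1 + 2 * change t ^ 2) := by
    have h1 := continuous_change
    exact continuous_const.div (by fun_prop) fun t => (sqrt_change_pos t).ne'
  obtain ⟨w, hw, hw'⟩ := exists_comp hv hd change_hasDerivAt hpc change_zero (L := 1) fun t => by
    rw [abs_of_pos (one_div_pos.2 (sqrt_change_pos t)), div_le_one (sqrt_change_pos t)]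
    exact one_le_sqrt_aux _
  have hwx : (fun x : EuclideanSpace ℝ (Fin N) => change (U.eval ‖x‖)) =ᵐ[volume]
      fun x => w.eval ‖x‖ := by
    filter_upwards [ae_ne_zero_euclidean] with x hx0
    rw [hw' _ (norm_pos_iff.2 hx0)]
  have hgrad := weakGrad_ae_eq hwx
  refine ⟨⟨memD12r_of_ae_eq w.memLp_deriv hwx,
    (transfer_orlicz hVW (Filter.EventuallyEq.refl (ae volume)
      fun x : EuclideanSpace ℝ (Fin N) => U.eval ‖x‖)).1⟩, fun h hh => ?_⟩
  obtain ⟨p, hp, hpc, hhp, -, hgp⟩ := hh.exists_radial_derivative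
  obtain ⟨i1, i2, i3, i4, hsum⟩ := hK.radial_weak hU hv hd hp hpc
  have hwd := ae_comp_norm hw
  have t1 := transfer_integral i1 (f := fun x => (1 + 2 * change (U.eval ‖x‖) ^ 2) * inner ℝ
    (weakGrad (fun x : EuclideanSpace ℝ (Fin N) => change (U.eval ‖x‖)) x) (gradient h x)) (by
      filter_upwards [hgrad, hgp, hwd, ae_ne_zero_euclidean] with x e1 e2 e3 hx0
      rw [e1, e2, inner_radialField _ _ hx0, e3]
      have hs := sqrt_change_sq (U.eval ‖x‖)
      have := (sqrt_change_pos (U.eval ‖x‖)).ne'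
      set s := √(1 + 2 * change (U.eval ‖x‖) ^ 2)
      rw [← hs]
      field_simp)
  have t2 := transfer_integral i2 (f := fun x => 2 * change (U.eval ‖x‖) *
    ‖weakGrad (fun x : EuclideanSpace ℝ (Fin N) => change (U.eval ‖x‖)) x‖ ^ 2 * h x) (by
      filter_upwards [hgrad, hwd, ae_ne_zero_euclidean] with x e1 e3 hx0
      rw [e1, norm_radialField _ hx0, e3, sq_abs, hhp, mul_pow, div_pow, one_pow, sqrt_change_sq]
      ring)
  have t3 := transfer_integral i3 (f := fun x => V ‖x‖ * change (U.eval ‖x‖) * h x) (by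
      filter_upwards [ae_ne_zero_euclidean] with x hx0
      rw [hVW _ (norm_pos_iff.2 hx0), hhp])
  have t4 := transfer_integral i4 (f := fun x => K ‖x‖ * g (change (U.eval ‖x‖)) * h x) (by
      filter_upwards [ae_ne_zero_euclidean] with x hx0
      have := (sqrt_change_pos (U.eval ‖x‖)).ne'
      rw [hKL _ (norm_pos_iff.2 hx0), hhp]
      field_simp)
  refine ⟨t1.1, t2.1, t3.1, t4.1, ?_⟩
  rw [t1.2, t2.2, t3.2, t4.2, hsum]

theorem changeInv_change (t : ℝ) : changeInv (change t) = t := by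
  have hd : ∀ t, HasDerivAt (fun t => changeInv (change t) - t) 0 t := fun t => by
    have h := ((changeInv_hasDerivAt (change t)).comp t (change_hasDerivAt t)).sub (hasDerivAt_id t)
    rw [mul_one_div_cancel (sqrt_change_pos t).ne', sub_self] at h
    exact h
  have h := is_const_of_deriv_eq_zero (fun t => (hd t).differentiableAt) (fun t => (hd t).deriv) t 0
  simp only [change_zero, changeInv_zero, sub_zero] at h
  linarith

/-- Here s = √(1 + 2f²), v = u', and u'' is replaced through the radial equation. The terms in v²
and in n v cancel, leaving an expression where s² = 1 + 2f² finishes. -/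
theorem quasilinear_identity {s f r : ℝ} (hs : s ≠ 0) (hf : s ^ 2 = 1 + 2 * f ^ 2) (hr : r ≠ 0)
    (n v a b γ : ℝ) :
    -(((a * (f / s) - b * (γ * (1 / s)) - n / r * v) * s - v * (2 * f / s ^ 2 * v)) / s ^ 2
        + n / r * (v / s)) + a * f
      - f * (2 * (1 / (s ^ 2) ^ 2 * v) * v
          + 2 * (f / s) * (a * (f / s) - b * (γ * (1 / s)) - n / r * v)
        + n / r * (2 * (f / s) * v)) = b * γ := by
  trans a * f - (a * f - b * γ) * (1 + 2 * f ^ 2) / s ^ 2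
  · field_simp
    ring
  · rw [← hf]
    field_simp
    ring

theorem IsNonlinearity.isClassicalSolution (hVW : ∀ r > 0, V r = W r) {g L : ℝ → ℝ}
    (hK : IsNonlinearity N W L (fun t => g (change t) * (1 / √(1 + 2 * change t ^ 2))) Γ θ)
    (hKL : ∀ r > 0, K r = L r) (hLc : ContinuousOn L (Set.Ioi 0)) {U : RadialSpace N W}
    (hU : U.quasiGrad = hK.grad U) :
    IsClassicalSolution V K g fun x : EuclideanSpace ℝ (Fin N) => change (U.eval ‖x‖) := by
  obtain ⟨v, hv, hd, hd2⟩ := hK.exists_hasDerivAt hLc hU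
  have hUc := U.continuousOn_eval
  have hUd : ContDiffOn ℝ 2 U.eval (Set.Ioi 0) := by
    refine contDiffOn_two_of_hasDerivAt isOpen_Ioi hd hd2 ?_
    have hvc : ContinuousOn v (Set.Ioi 0) := fun r hr =>
      (hd2 r hr).continuousAt.continuousWithinAt
    refine ((hW.continuousOn.mul (continuous_phi.comp_continuousOn hUc)).sub
      (hLc.mul (hK.continuous.comp_continuousOn hUc))).sub (ContinuousOn.mul ?_ hvc)
    exact continuousOn_const.div continuousOn_id fun r hr => ne_of_gt hr
  refine ⟨contDiffOn_comp_norm (contDiff_change.comp_contDiffOn hUd), fun x hx => ?_⟩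
  have hx0 : 0 < ‖x‖ := norm_pos_iff.2 hx
  set v' : ℝ → ℝ := fun r => W r * phi (U.eval r)
    - L r * (g (change (U.eval r)) * (1 / √(1 + 2 * change (U.eval r) ^ 2)))
    - (N - 1) / r * v r with hv'
  have a1 : ∀ r > 0, HasDerivAt (fun r => change (U.eval r))
      (v r / √(1 + 2 * change (U.eval r) ^ 2)) r := fun r hr => by
    refine ((change_hasDerivAt (U.eval r)).comp r (hd r hr)).congr_deriv ?_
    ring
  have a2 : ∀ r > 0, HasDerivAt (fun r => v r / √(1 + 2 * change (U.eval r) ^ 2))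
      ((v' r * √(1 + 2 * change (U.eval r) ^ 2) - v r * (2 * change (U.eval r)
        / (1 + 2 * change (U.eval r) ^ 2) * v r)) / √(1 + 2 * change (U.eval r) ^ 2) ^ 2) r :=
    fun r hr => (hd2 r hr).fun_div ((sqrtChange_hasDerivAt (U.eval r)).comp r (hd r hr))
      (sqrt_change_pos _).ne'
  have b1 : ∀ r > 0, HasDerivAt (fun r => change (U.eval r) ^ 2)
      (2 * phi (U.eval r) * v r) r := fun r hr => (changeSq_hasDerivAt (U.eval r)).comp r (hd r hr)
  have b2 : ∀ r > 0, HasDerivAt (fun r => 2 * phi (U.eval r) * v r)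
      (2 * (1 / (1 + 2 * change (U.eval r) ^ 2) ^ 2 * v r) * v r + 2 * phi (U.eval r) * v' r) r :=
    fun r hr => (((phi_hasDerivAt (U.eval r)).comp r (hd r hr)).const_mul 2).mul (hd2 r hr)
  rw [laplacian_comp_norm a1 a2 hx, laplacian_comp_norm b1 b2 hx, hVW _ hx0, hKL _ hx0]
  simp only [hv', phi]
  have hs := sqrt_change_pos (U.eval ‖x‖)
  have hs2 := sqrt_change_sq (U.eval ‖x‖)
  set s := √(1 + 2 * change (U.eval ‖x‖) ^ 2)
  rw [← hs2]
  exact quasilinear_identity hs.ne' hs2 hx0.ne' _ _ _ _ _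

end QLS

/-! ### The main theorem -/

open QLS in
theorem theorem7p1 (N : ℕ) (hN : 3 ≤ N) (V K g : ℝ → ℝ) (q₁ q₂ : ℝ)
    (hH : QLS.HypH V K) (hg : Continuous g)
    (hg1 : QLS.HypG1 g) (hg2 : QLS.HypG2 g) (hgq : QLS.HypGrowth g q₁ q₂)
    (R₁ α₀ β₀ : ℝ) (hR₁ : 0 < R₁) (hβ₀ : 0 ≤ β₀) (hβ₀' : β₀ ≤ 1)
    (hα₀ : QLS.alphaStar N β₀ < α₀)
    (hK₀ : QLS.RatioBounded V K (Set.Ioo 0 R₁) α₀ β₀)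
    (hq₁ : max 1 (2 * β₀) < q₁) (hq₁' : q₁ < QLS.qZeroStar N α₀ β₀)
    (R₂ αi βi : ℝ) (hR₂ : 0 < R₂) (hβi : 0 ≤ βi) (hβi' : βi ≤ 1)
    (hKi : QLS.RatioBounded V K (Set.Ioi R₂) αi βi)
    (hq₂ : max 1 (max (2 * βi) (QLS.qInftyStar N αi βi)) < q₂) :
    -- the functional is well defined on the whole of `E`
    (∀ u : EuclideanSpace ℝ (Fin N) → ℝ, QLS.MemE V u →
      MeasureTheory.Integrable (fun x => K ‖x‖ * QLS.primitive g (QLS.change (u x)))) ∧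
    -- it has a nonnegative nontrivial critical point `u`, and `f(u)` solves the equation
    ∃ u : EuclideanSpace ℝ (Fin N) → ℝ,
      QLS.IsCriticalPoint V K g u ∧ (∀ x, 0 ≤ u x) ∧
      ¬ (u =ᵐ[MeasureTheory.volume] 0) ∧
      (∀ x, 0 ≤ QLS.change (u x)) ∧
      ¬ ((fun x => QLS.change (u x)) =ᵐ[MeasureTheory.volume] 0) ∧
      QLS.IsWeakSolution V K g (fun x => QLS.change (u x)) ∧
      QLS.IsClassicalSolution V K g (fun x => QLS.change (u x)) := by
  have : Fact (3 ≤ N) := ⟨hN⟩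
  obtain ⟨hVc, hKc, hV0, hK0, CV, hCV, hVb⟩ := hH
  -- The potentials matter only on (0, ∞). Extension by zero makes them globally measurable and
  -- nonnegative and changes the integrands on space only at the origin.
  set W : ℝ → ℝ := (Set.Ioi 0).indicator V with hW
  set L : ℝ → ℝ := (Set.Ioi 0).indicator K with hL
  have hVW : ∀ r > 0, V r = W r := fun r hr => (Set.indicator_of_mem (Set.mem_Ioi.2 hr) V).symm
  have hKL : ∀ r > 0, K r = L r := fun r hr => (Set.indicator_of_mem (Set.mem_Ioi.2 hr) K).symm
  have hWz : ∀ r ≤ 0, W r = 0 := fun r hr =>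
    Set.indicator_of_notMem (fun h => absurd hr (not_le.2 h)) V
  have hLz : ∀ r ≤ 0, L r = 0 := fun r hr =>
    Set.indicator_of_notMem (fun h => absurd hr (not_le.2 h)) K
  have hLc : ContinuousOn L (Set.Ioi 0) := hKc.congr fun r hr => (hKL r hr).symm
  have hL0 : ∀ r, 0 ≤ L r := fun r => Set.indicator_nonneg (fun r hr => (hK0 r hr).le) r
  have hWp : IsPotential W :=
    { continuousOn := hVc.congr fun r hr => (hVW r hr).symm
      nonneg := fun r => Set.indicator_nonneg (fun r hr => hV0 r hr) r
      eq_zero := hWz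
      bound := ⟨CV, hCV, fun r hr => by
        rw [← hVW r hr.1]
        exact hVb r hr⟩ }
  have hL₀ : RatioBounded W L (Set.Ioo 0 R₁) α₀ β₀ := by
    obtain ⟨Λ, h⟩ := hK₀
    refine ⟨Λ, fun r hr => ?_⟩
    rw [← hVW r hr.1, ← hKL r hr.1]
    exact h r hr
  have hLi : RatioBounded W L (Set.Ioi R₂) αi βi := by
    obtain ⟨Λ, h⟩ := hKi
    refine ⟨Λ, fun r hr => ?_⟩
    have hr0 : 0 < r := hR₂.trans hr
    rw [← hVW r hr0, ← hKL r hr0]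
    exact h r hr
  have hq₁1 : 1 < q₁ := (le_max_left _ _).trans_lt hq₁
  have hq₂1 : 1 < q₂ := (le_max_left _ _).trans_lt hq₂
  have hg0 := hgq.zero hq₁1
  obtain ⟨θ, hθ, hg1⟩ := hg1
  have hNL := isNonlinearity_of_growth (N := N) hLc hL0 hLz hg hθ hg1 hgq hR₁ hβ₀ hα₀ hL₀ hq₁
    hq₁' hβi hβi' hLi hq₂
  -- The truncated nonlinearity yields the critical point; the original one is the nonlinearity in
  -- the energy of the statement.
  have hNLp := isNonlinearity_of_growth (N := N) hLc hL0 hLz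
    (show Continuous fun t => g (max t 0) by fun_prop) hθ (superquadratic_comp_max hg0 hg1)
    (hgq.comp_max hq₁1.le hq₂1.le) hR₁ hβ₀ hα₀ hL₀ hq₁ hq₁' hβi hβi' hLi hq₂
  obtain ⟨t₀, ht₀, hGt₀⟩ := hg2
  obtain ⟨t₁, ht₁⟩ : ∃ t, change t = t₀ := by
    refine ⟨changeInv t₀, changeInv_strictMono.injective (changeInv_change _)⟩
  obtain ⟨U, hU0, hUp⟩ := hNLp.exists_critical (V := W) (fun r hr => by
    rw [← hKL r hr]
    exact hK0 r hr) (t := t₁) (by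
    rw [primitive_comp_max hg0, ht₁, max_eq_left ht₀.le]
    exact hGt₀)
  have hUnn : ∀ r, 0 ≤ U.eval r := by
    intro r
    by_cases hr : 0 < r
    · refine hNLp.eval_nonneg hLc (fun t ht => ?_) hUp hr
      have : change t ≤ 0 := by
        rw [← change_zero]
        exact strictMono_change.monotone ht.le
      rw [max_eq_right this, hg0, zero_mul]
    · simp [RadialSpace.eval, tailIntegral, hr]
  -- On nonnegative profiles the truncation is inactive, so both superlinear gradients agree at U.
  have hU : U.quasiGrad = hNL.grad U := by
    rw [hUp]
    refine ext_inner_right ℝ fun h => ?_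
    rw [hNLp.inner_grad, hNL.inner_grad]
    simp only [max_eq_left (change_nonneg (hUnn _))]
  refine ⟨fun u hu => ?_, fun x => U.eval ‖x‖, hNL.isCriticalPoint hVW hKL
    (Filter.EventuallyEq.refl _ _) hU, fun x => hUnn _, fun h => hU0 (RadialSpace.eq_zero_of_ae_eq_zero h),
    fun x => change_nonneg (hUnn _), fun h => ?_, hNL.isWeakSolution hVW hKL hLc hU,
    hNL.isClassicalSolution hVW hKL hLc hU⟩
  · obtain ⟨U', hU'⟩ := hu.exists_radialSpace hVW
    exact (hNL.transfer_energy hVW hKL hU').1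
  · refine hU0 (RadialSpace.eq_zero_of_ae_eq_zero ?_)
    filter_upwards [h] with x hx
    exact strictMono_change.injective (hx.trans change_zero.symm)
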